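/- Let $n\in\{2,3\}$ and let $\Omega\subset\mathbb{R}^n$ be an admissible domain with inlet $\Gamma_I$, wall $\Gamma_W$ and outlet $\Gamma_O$. This means the following. $\Omega$ is open, bounded and simply connected; its boundary is the disjoint union $\partial\Omega=\Gamma_I\cup\Gamma_W\cup\Gamma_O$; and $\partial\Omega$ is piecewise of class $\mathcal{C}^2$: it is of class $\mathcal{C}^2$, with $\Omega$ locally on one side, except along the rims of $\Gamma_I$ and $\Gamma_O$, where two $\mathcal{C}^2$ faces meet transversally and $\Omega$ is locally the wedge between them. Moreover, in suitable Cartesian coordinate systems (one for each index $j=1,2$): - if $n=2$, $\Omega$ contains two disjoint rectangles $\Omega_j=(0,\ell_j)\times(-h_j,h_j)$ with $\ell_j,h_j>0$, $j=1,2$; $\Gamma_I=\{0\}\times(-h_1,h_1)$ and $\Gamma_O=\{\ell_2\}\times(-h_2,h_2)$; the sides $(0,\ell_j)\times\{\pm h_j\}$ of the rectangles are contained in $\Gamma_W$; and $\Gamma_W$ is the union of two disjoint regular simple arcs of class $\mathcal{C}^2$ connecting the endpoints of $\Gamma_I$ with those of $\Gamma_O$; - if $n=3$, $\Omega$ contains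 two disjoint cylinders $\Omega_j=\Theta_j\times(0,\ell_j)$, $j=1,2$, where $\ell_j>0$ and $\Theta_j\subset\mathbb{R}^2$ is a bounded domain with boundary of class $\mathcal{C}^2$, and both cylinders are directed along the same unit vector $\boldsymbol{\xi}_*\in\mathbb{R}^3$ (the third coordinate vector of both coordinate systems); $\Gamma_I=\Theta_1\times\{0\}$ and $\Gamma_O=\Theta_2\times\{\ell_2\}$; and the lateral surfaces $\partial\Theta_j\times(0,\ell_j)$ are contained in $\Gamma_W$. Let $\boldsymbol{\nu}$ denote the outward unit normal to $\partial\Omega$, and let $\boldsymbol{v}\in W^{2,3/2}(\Omega;\mathbb{R}^n)$ be a harmonic vector field such that $$\nabla\cdot\boldsymbol{v}=0 \ \text{ in } \Omega,\qquad \boldsymbol{v}=\boldsymbol{0}\ \text{ on } \Gamma_I\cup\Gamma_W \ \text{ in the sense of traces.}$$ Then $\nabla\boldsymbol{v}$ has a trace in $L^{3/2}(\Gamma_O;\mathbb{R}^{n\times n})$ and, with $\frac{\partial\boldsymbol{v}}{\partial\boldsymbol{\nu}}=(\nabla\boldsymbol{v})\,\boldsymbol{\nu}$ formed from this trace, $$\frac{\partial\boldsymbol{v}}{\partial\boldsymbol{\nu}}\cdot\boldsymbol{\nu}=0\qquad\text{almost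 everywhere on }\Gamma_O .$$ -/

import Mathlib

open MeasureTheory Filter Topology Set InnerProductSpace
open scoped ENNReal ContDiff

/-- Euclidean space `ℝⁿ` with the Euclidean norm. -/
abbrev Euc (n : ℕ) : Type := EuclideanSpace ℝ (Fin n)

/-! ### Sobolev spaces through weak derivatives, and traces -/

section Sobolev

variable {n : ℕ} {F : Type} [NormedAddCommGroup F] [NormedSpace ℝ F]

/-- `U` is the weak (total) derivative of `u` in the open set `Ω`:
`∫_Ω (∂_e φ) u = - ∫_Ω φ (U e)` for all scalar test functions `φ ∈ C_c^∞(Ω)` and all directions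
`e`. -/
def HasWeakFDeriv (Ω : Set (Euc n)) (u : Euc n → F) (U : Euc n → Euc n →L[ℝ] F) : Prop :=
  LocallyIntegrableOn u Ω volume ∧ LocallyIntegrableOn U Ω volume ∧
    ∀ φ : Euc n → ℝ, ContDiff ℝ ∞ φ → HasCompactSupport φ → tsupport φ ⊆ Ω →
      ∀ e : Euc n, ∫ x in Ω, (fderiv ℝ φ x e) • u x = -∫ x in Ω, φ x • U x e

/-- `u ∈ W^{1,p}(Ω; F)`. -/
def MemW1 (p : ℝ≥0∞) (Ω : Set (Euc n)) (u : Euc n → F) : Prop :=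
  MemLp u p (volume.restrict Ω) ∧
    ∃ U : Euc n → Euc n →L[ℝ] F, HasWeakFDeriv Ω u U ∧ MemLp U p (volume.restrict Ω)

/-- `u ∈ W^{2,p}(Ω; F)`: `u` is in `L^p(Ω)` and its weak derivative is in `W^{1,p}(Ω)`. -/
def MemW2 (p : ℝ≥0∞) (Ω : Set (Euc n)) (u : Euc n → F) : Prop :=
  MemLp u p (volume.restrict Ω) ∧
    ∃ U : Euc n → Euc n →L[ℝ] F, HasWeakFDeriv Ω u U ∧ MemW1 p Ω U

/-- `g ∈ L^p(Γ; F)` is the trace on the boundary portion `Γ` of `u ∈ W^{1,p}(Ω; F)`. The trace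
operator is the continuous extension of the restriction to the boundary: `g` is the limit in
`L^p(Γ)` (with respect to the surface measure, the `(n-1)`-dimensional Hausdorff measure) of the
boundary values of functions which are `C¹` in `Ω`, continuous on `Ω ∪ Γ`, and converge to `u` in
`W^{1,p}(Ω)`. -/
def HasTrace (p : ℝ≥0∞) (Ω Γ : Set (Euc n)) (u g : Euc n → F) : Prop :=
  MemLp g p (μHE[n - 1].restrict Γ) ∧ MemLp u p (volume.restrict Ω) ∧
    ∃ U : Euc n → Euc n →L[ℝ] F, HasWeakFDeriv Ω u U ∧ MemLp U p (volume.restrict Ω) ∧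
      ∃ φ : ℕ → Euc n → F,
        (∀ k, ContDiffOn ℝ 1 (φ k) Ω ∧ ContinuousOn (φ k) (Ω ∪ Γ)) ∧
        Tendsto (fun k => eLpNorm (φ k - u) p (volume.restrict Ω)) atTop (𝓝 0) ∧
        Tendsto (fun k => eLpNorm (fderiv ℝ (φ k) - U) p (volume.restrict Ω)) atTop (𝓝 0) ∧
        Tendsto (fun k => eLpNorm (φ k - g) p (μHE[n - 1].restrict Γ)) atTop (𝓝 0)

/-- The (classical) divergence of a vector field. -/
noncomputable def divergence (v : Euc n → Euc n) (x : Euc n) : ℝ :=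
  ∑ i : Fin n, (fderiv ℝ v x (EuclideanSpace.single i 1)) i

end Sobolev

/-! ### Boundary regularity and the outward unit normal -/

section Boundary

variable {n : ℕ}

/-- `ρ` is a `C²` defining function of `Ω` at `x`: near `x`, `Ω = {ρ < 0}`, where `ρ x = 0` and the
gradient of `ρ` at `x` does not vanish. -/
def IsC2DefiningFunctionAt (Ω : Set (Euc n)) (x : Euc n) (ρ : Euc n → ℝ) : Prop :=
  ContDiffAt ℝ 2 ρ x ∧ ρ x = 0 ∧ gradient ρ x ≠ 0 ∧ ∀ᶠ y in 𝓝 x, (y ∈ Ω ↔ ρ y < 0)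

/-- The boundary of `Ω` is of class `C²` near `x` (and `Ω` lies on one side of it). -/
def IsC2BoundaryPoint (Ω : Set (Euc n)) (x : Euc n) : Prop :=
  ∃ ρ : Euc n → ℝ, IsC2DefiningFunctionAt Ω x ρ

/-- Near `x`, `Ω` is a wedge whose two faces are of class `C²` and cross transversally at `x`. -/
def IsC2EdgePoint (Ω : Set (Euc n)) (x : Euc n) : Prop :=
  ∃ ρ σ : Euc n → ℝ, ContDiffAt ℝ 2 ρ x ∧ ContDiffAt ℝ 2 σ x ∧ ρ x = 0 ∧ σ x = 0 ∧
    LinearIndependent ℝ ![gradient ρ x, gradient σ x] ∧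
    ∀ᶠ y in 𝓝 x, (y ∈ Ω ↔ ρ y < 0 ∧ σ y < 0)

/-- The boundary of `Ω` is piecewise of class `C²`: it is of class `C²` off the set `S`, and along
`S` two `C²` pieces meet transversally. -/
def HasPiecewiseC2Boundary (Ω S : Set (Euc n)) : Prop :=
  (∀ x ∈ frontier Ω \ S, IsC2BoundaryPoint Ω x) ∧ ∀ x ∈ S, IsC2EdgePoint Ω x

/-- `ν` is the outward unit normal to `∂Ω` at the boundary point `x`. -/
def IsOutwardUnitNormal (Ω : Set (Euc n)) (x ν : Euc n) : Prop :=
  ∃ ρ : Euc n → ℝ, IsC2DefiningFunctionAt Ω x ρ ∧ ν = ‖gradient ρ x‖⁻¹ • gradient ρ x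

end Boundary

/-! ### Admissible domains

A coordinate system is given by a rigid transformation `T` of `ℝⁿ`; the set which is `A` in the
coordinate system `T` is `T ⁻¹' A`. -/

/-- The requirements common to both dimensions: `Ω` is a bounded, open, simply connected set whose
boundary is decomposed into the inlet `ΓI`, the wall `ΓW` and the outlet `ΓO`, and is piecewise of
class `C²`, namely of class `C²` off the rims of the inlet and of the outlet, where the wall meets
them transversally. -/
structure IsPipeDomain {n : ℕ} (Ω ΓI ΓW ΓO : Set (Euc n)) : Prop where
  isOpen : IsOpen Ω
  isBounded : Bornology.IsBounded Ω
  isSimplyConnected : IsSimplyConnected Ω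
  frontier_eq : frontier Ω = ΓI ∪ ΓW ∪ ΓO
  disjoint_inlet_wall : Disjoint ΓI ΓW
  disjoint_inlet_outlet : Disjoint ΓI ΓO
  disjoint_wall_outlet : Disjoint ΓW ΓO
  piecewiseC2 : HasPiecewiseC2Boundary Ω ((closure ΓI \ ΓI) ∪ (closure ΓO \ ΓO))

/-- The rectangle `(0, ℓ) × (-h, h)`. -/
def rectangle (ℓ h : ℝ) : Set (Euc 2) := {x | x 0 ∈ Ioo 0 ℓ ∧ x 1 ∈ Ioo (-h) h}

/-- The lateral sides `(0, ℓ) × {-h, h}` of the rectangle. -/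
def rectangleSides (ℓ h : ℝ) : Set (Euc 2) := {x | x 0 ∈ Ioo 0 ℓ ∧ (x 1 = -h ∨ x 1 = h)}

/-- The vertical segment `{a} × (-h, h)`. -/
def crossSegment (a h : ℝ) : Set (Euc 2) := {x | x 0 = a ∧ x 1 ∈ Ioo (-h) h}

/-- `γ` restricted to `[0,1]` is a regular simple arc of class `C²` from `a` to `b`. -/
def IsC2Arc (γ : ℝ → Euc 2) (a b : Euc 2) : Prop :=
  ContDiffOn ℝ 2 γ (Icc 0 1) ∧ (∀ t ∈ Icc (0 : ℝ) 1, derivWithin γ (Icc 0 1) t ≠ 0) ∧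
    InjOn γ (Icc 0 1) ∧ γ 0 = a ∧ γ 1 = b

/-- Admissible planar domains. The rectangles `Ω₁ = T₁ ⁻¹' (0,ℓ₁)×(-h₁,h₁)` and
`Ω₂ = T₂ ⁻¹' (0,ℓ₂)×(-h₂,h₂)` are disjoint parts of `Ω` (and `Ω₀` is the rest of `Ω`), the sides of
`Ω₁` and `Ω₂` belong to the wall, and the wall is the union of two disjoint `C²` arcs connecting the
endpoints of the inlet with those of the outlet. Since `T₂` may reverse the orientation and
the rectangle is symmetric, it is no restriction that the arcs connect upper endpoints with upper
endpoints and lower endpoints with lower ones. -/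
structure IsAdmissiblePlanar (Ω ΓI ΓW ΓO : Set (Euc 2)) : Prop
    extends IsPipeDomain Ω ΓI ΓW ΓO where
  exists_geometry : ∃ (T₁ T₂ : Euc 2 ≃ᵃⁱ[ℝ] Euc 2) (ℓ₁ h₁ ℓ₂ h₂ : ℝ),
    0 < ℓ₁ ∧ 0 < h₁ ∧ 0 < ℓ₂ ∧ 0 < h₂ ∧
    T₁ ⁻¹' rectangle ℓ₁ h₁ ⊆ Ω ∧ T₂ ⁻¹' rectangle ℓ₂ h₂ ⊆ Ω ∧
    Disjoint (T₁ ⁻¹' rectangle ℓ₁ h₁) (T₂ ⁻¹' rectangle ℓ₂ h₂) ∧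
    ΓI = T₁ ⁻¹' crossSegment 0 h₁ ∧ ΓO = T₂ ⁻¹' crossSegment ℓ₂ h₂ ∧
    T₁ ⁻¹' rectangleSides ℓ₁ h₁ ⊆ ΓW ∧ T₂ ⁻¹' rectangleSides ℓ₂ h₂ ⊆ ΓW ∧
    ∃ γ₁ γ₂ : ℝ → Euc 2,
      IsC2Arc γ₁ (T₁.symm !₂[0, h₁]) (T₂.symm !₂[ℓ₂, h₂]) ∧
      IsC2Arc γ₂ (T₁.symm !₂[0, -h₁]) (T₂.symm !₂[ℓ₂, -h₂]) ∧
      Disjoint (γ₁ '' Icc 0 1) (γ₂ '' Icc 0 1) ∧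
      ΓW = γ₁ '' Icc 0 1 ∪ γ₂ '' Icc 0 1

/-- The product `Θ × I` in `ℝ² × ℝ = ℝ³`. -/
def cylinder (Θ : Set (Euc 2)) (I : Set ℝ) : Set (Euc 3) := {x | !₂[x 0, x 1] ∈ Θ ∧ x 2 ∈ I}

/-- A bounded planar domain with boundary of class `C²`. -/
def IsC2CrossSection (Θ : Set (Euc 2)) : Prop :=
  IsOpen Θ ∧ Bornology.IsBounded Θ ∧ IsConnected Θ ∧ ∀ x ∈ frontier Θ, IsC2BoundaryPoint Θ x

/-- Admissible three-dimensional domains. The cylinders `Ω₁ = T₁ ⁻¹' (Θ₁ × (0,ℓ₁))` and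
`Ω₂ = T₂ ⁻¹' (Θ₂ × (0,ℓ₂))` are disjoint parts of `Ω` (and `Ω₀` is the rest of `Ω`), they are
directed along the same vector `ξ`, and their lateral surfaces belong to the wall, which is the
`C²` surface `∂Ω \ (ΓI ∪ ΓO)`. -/
structure IsAdmissibleSpatial (Ω ΓI ΓW ΓO : Set (Euc 3)) : Prop
    extends IsPipeDomain Ω ΓI ΓW ΓO where
  exists_geometry : ∃ (T₁ T₂ : Euc 3 ≃ᵃⁱ[ℝ] Euc 3) (Θ₁ Θ₂ : Set (Euc 2)) (ℓ₁ ℓ₂ : ℝ) (ξ : Euc 3),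
    IsC2CrossSection Θ₁ ∧ IsC2CrossSection Θ₂ ∧ 0 < ℓ₁ ∧ 0 < ℓ₂ ∧
    T₁.linearIsometryEquiv ξ = !₂[0, 0, 1] ∧ T₂.linearIsometryEquiv ξ = !₂[0, 0, 1] ∧
    T₁ ⁻¹' cylinder Θ₁ (Ioo 0 ℓ₁) ⊆ Ω ∧ T₂ ⁻¹' cylinder Θ₂ (Ioo 0 ℓ₂) ⊆ Ω ∧
    Disjoint (T₁ ⁻¹' cylinder Θ₁ (Ioo 0 ℓ₁)) (T₂ ⁻¹' cylinder Θ₂ (Ioo 0 ℓ₂)) ∧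
    ΓI = T₁ ⁻¹' cylinder Θ₁ {0} ∧ ΓO = T₂ ⁻¹' cylinder Θ₂ {ℓ₂} ∧
    T₁ ⁻¹' cylinder (frontier Θ₁) (Ioo 0 ℓ₁) ⊆ ΓW ∧ T₂ ⁻¹' cylinder (frontier Θ₂) (Ioo 0 ℓ₂) ⊆ ΓW

/-- `Ω ⊆ ℝⁿ`, `n ∈ {2, 3}`, is an admissible domain with inlet `ΓI`, wall `ΓW` and outlet `ΓO`. -/
def IsAdmissible : (n : ℕ) → (Ω ΓI ΓW ΓO : Set (Euc n)) → Prop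
  | 2, Ω, ΓI, ΓW, ΓO => IsAdmissiblePlanar Ω ΓI ΓW ΓO
  | 3, Ω, ΓI, ΓW, ΓO => IsAdmissibleSpatial Ω ΓI ΓW ΓO
  | _, _, _, _, _ => False

/-! The mechanism is unique continuation from vanishing Cauchy data on a flat piece of the boundary.
Let `a` be the unit inward normal of a flat piece on which `v` has zero trace, and put `u = a · v`.
Then `u` is harmonic and vanishes on the piece. Formally its normal derivative vanishes there too:
the tangential derivatives of `v` are zero, so `div v = 0` leaves `∂ₐ(a · v) = 0`. Hence the
extension of `u` by zero across the piece is weakly harmonic. It is zero on one side, so it vanishes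
near the piece, and by connectedness `u = 0` in all of `Ω` (`inner_axis_eq_zero`).

The formal argument becomes rigorous without any trace of `∇v`. Cut the test function off at height
`t` above the piece. The term with two derivatives on the cutoff is removed by testing `div v = 0`,
and the terms with one derivative are at most a multiple of `t⁻¹ ∫ |v|` over a cylinder of height
comparable to `t`. This tends to zero because a `W^{1,p}` function with zero trace has mass `o(t)`
there (`tendsto_lintegral_cyl_of_hasTrace_zero`, `isWeaklyHarmonicOn_indicator`).

Unique continuation comes from mean values. Averages of a weakly harmonic function against a smooth
radial kernel do not depend on the radius, because the radial derivative of the kernel is the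
Laplacian of a test function. The mean value property gives factorial bounds on directional
derivatives, and Taylor's formula spreads vanishing near a centre to a ball whose radius is a fixed
fraction of the ball of harmonicity. That this fraction ignores the size of the initial zero set is
what allows a step across the flat piece.

In the plane the inlet and a side of the first rectangle have orthogonal normals, so `v = 0`. In
space the inlet gives `ξ · v = 0`, and the outlet normal is parallel to `ξ`. In both cases `ν · v =
0` in `Ω` with `ν` the constant outlet normal, so `(∇v ν) · ν = 0` in `Ω`. The trace inequality
carries this identity to every trace of `∇v` (`ae_apply_eq_zero_of_hasTrace`). A trace exists
because shifting `∇v` inward along the outlet cylinder gives approximants continuous up to the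
outlet (`IsInletCylinder.exists_hasTrace`). -/

set_option linter.unusedSectionVars false

/-! ### A radial mollifier with the mean value property -/

/-- A smooth profile on `ℝ`, nondecreasing and vanishing on `[1, ∞)`. -/
noncomputable def radialProfile (τ : ℝ) : ℝ := -expNegInvGlue (1 - τ)

lemma contDiff_radialProfile : ContDiff ℝ ∞ radialProfile :=
  (expNegInvGlue.contDiff.comp (contDiff_const.sub contDiff_id)).neg

lemma radialProfile_eq_zero {τ : ℝ} (h : 1 ≤ τ) : radialProfile τ = 0 := by
  simp [radialProfile, expNegInvGlue.zero_of_nonpos (by linarith : 1 - τ ≤ 0)]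

lemma contDiff_deriv_radialProfile : ContDiff ℝ ∞ (deriv radialProfile) :=
  (contDiff_infty_iff_deriv.1 contDiff_radialProfile).2

lemma contDiff_deriv_deriv_radialProfile : ContDiff ℝ ∞ (deriv (deriv radialProfile)) :=
  (contDiff_infty_iff_deriv.1 contDiff_deriv_radialProfile).2

lemma hasDerivAt_radialProfile (τ : ℝ) :
    HasDerivAt radialProfile (deriv radialProfile τ) τ :=
  (contDiff_radialProfile.differentiable (by simp) τ).hasDerivAt

lemma hasDerivAt_deriv_radialProfile (τ : ℝ) :
    HasDerivAt (deriv radialProfile) (deriv (deriv radialProfile) τ) τ :=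
  (contDiff_deriv_radialProfile.differentiable (by simp) τ).hasDerivAt

lemma eqOn_zero_Ici_of_eqOn_zero_Ioi {f : ℝ → ℝ} (hf : Continuous f)
    (h : ∀ τ, 1 < τ → f τ = 0) {τ : ℝ} (hτ : 1 ≤ τ) : f τ = 0 := by
  have : closure (Ioi (1 : ℝ)) ⊆ f ⁻¹' {0} :=
    closure_minimal (fun τ hτ => h τ hτ) (isClosed_singleton.preimage hf)
  rw [closure_Ioi] at this
  exact this hτ

lemma deriv_radialProfile_eq_zero {τ : ℝ} (h : 1 ≤ τ) : deriv radialProfile τ = 0 := by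
  refine eqOn_zero_Ici_of_eqOn_zero_Ioi contDiff_deriv_radialProfile.continuous ?_ h
  intro τ hτ
  have : radialProfile =ᶠ[𝓝 τ] fun _ => 0 := by
    filter_upwards [lt_mem_nhds hτ] with s hs using radialProfile_eq_zero hs.le
  rw [this.deriv_eq, deriv_const]

lemma deriv_deriv_radialProfile_eq_zero {τ : ℝ} (h : 1 ≤ τ) :
    deriv (deriv radialProfile) τ = 0 := by
  refine eqOn_zero_Ici_of_eqOn_zero_Ioi contDiff_deriv_deriv_radialProfile.continuous ?_ h
  intro τ hτ
  have : deriv radialProfile =ᶠ[𝓝 τ] fun _ => 0 := by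
    filter_upwards [lt_mem_nhds hτ] with s hs using deriv_radialProfile_eq_zero hs.le
  rw [this.deriv_eq, deriv_const]

lemma monotone_radialProfile : Monotone radialProfile := by
  intro a b hab
  exact neg_le_neg (expNegInvGlue.monotone (by linarith))

lemma deriv_radialProfile_nonneg (τ : ℝ) : 0 ≤ deriv radialProfile τ :=
  monotone_radialProfile.deriv_nonneg

lemma exists_deriv_radialProfile_pos : ∃ τ ∈ Ioo (0 : ℝ) 1, 0 < deriv radialProfile τ := by
  obtain ⟨τ, hτ, h⟩ := exists_deriv_eq_slope radialProfile (zero_lt_one)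
    contDiff_radialProfile.continuous.continuousOn
    (contDiff_radialProfile.differentiable (by simp)).differentiableOn
  refine ⟨τ, hτ, ?_⟩
  rw [h, radialProfile_eq_zero le_rfl]
  have : 0 < expNegInvGlue 1 := expNegInvGlue.pos_of_pos one_pos
  simpa [radialProfile]

section Kernel

variable {E : Type*} [NormedAddCommGroup E] [InnerProductSpace ℝ E] [FiniteDimensional ℝ E]
  [MeasurableSpace E] [BorelSpace E]

/-- The second derivative in a direction `v` is `2 φ' ‖v‖² + 4 φ'' ⟨v, x - y⟩²`; summing over an
orthonormal basis, Parseval turns the last factor into `‖x - y‖²`. -/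
lemma laplacian_radial {φ : ℝ → ℝ} (hφ : ContDiff ℝ 2 φ) (x y : E) :
    Laplacian.laplacian (fun y : E => φ (‖x - y‖ ^ 2)) y =
      2 * Module.finrank ℝ E * deriv φ (‖x - y‖ ^ 2) +
        4 * ‖x - y‖ ^ 2 * deriv (deriv φ) (‖x - y‖ ^ 2) := by
  have hφ1 : ∀ τ, HasDerivAt φ (deriv φ τ) τ := fun τ =>
    (hφ.differentiable (by simp) τ).hasDerivAt
  have hφ2 : ∀ τ, HasDerivAt (deriv φ) (deriv (deriv φ) τ) τ := fun τ =>
    ((hφ.iterate_deriv' 1 1).differentiable (by simp) τ).hasDerivAt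
  have hn : ∀ y : E, HasFDerivAt (fun y : E => ‖x - y‖ ^ 2) (-(2 : ℝ) • innerSL ℝ (x - y)) y := by
    intro y
    refine HasFDerivAt.congr_fderiv ((hasFDerivAt_id y).const_sub x).norm_sq ?_
    ext v
    simp
    ring
  have h1 : fderiv ℝ (fun y : E => φ (‖x - y‖ ^ 2)) =
      fun y => (-(2 : ℝ) * deriv φ (‖x - y‖ ^ 2)) • innerSL ℝ (x - y) := by
    ext y v
    have : HasFDerivAt (fun y : E => φ (‖x - y‖ ^ 2)) _ y := (hφ1 _).comp_hasFDerivAt y (hn y)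
    rw [this.fderiv]
    simp
    ring
  have h2 : ∀ v : E, fderiv ℝ (fderiv ℝ (fun y : E => φ (‖x - y‖ ^ 2))) y v v =
      2 * deriv φ (‖x - y‖ ^ 2) * ‖v‖ ^ 2 +
        4 * deriv (deriv φ) (‖x - y‖ ^ 2) * ‖inner ℝ v (x - y)‖ ^ 2 := by
    intro v
    rw [h1]
    have hA : HasFDerivAt (fun y : E => -(2 : ℝ) * deriv φ (‖x - y‖ ^ 2)) _ y :=
      ((hφ2 _).comp_hasFDerivAt y (hn y)).const_mul (-(2 : ℝ))
    have hB : HasFDerivAt (fun y : E => innerSL ℝ (x - y)) (-(innerSL ℝ : E →L[ℝ] E →L[ℝ] ℝ)) y := by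
      refine HasFDerivAt.congr_fderiv ((innerSL ℝ : E →L[ℝ] E →L[ℝ] ℝ).hasFDerivAt.comp y
        ((hasFDerivAt_id y).const_sub x)) ?_
      ext; simp
    have hAB : HasFDerivAt
      (fun y : E => (-(2 : ℝ) * deriv φ (‖x - y‖ ^ 2)) • innerSL ℝ (x - y)) _ y := hA.smul hB
    rw [hAB.fderiv]
    simp only [innerSL_apply_apply, add_apply, smul_apply,
      neg_apply, ContinuousLinearMap.smulRight_apply, smul_eq_mul,
      Real.norm_eq_abs, sq_abs, ← real_inner_self_eq_norm_sq v]
    rw [real_inner_comm v (x - y), innerSL_apply_apply]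
    ring
  rw [laplacian_eq_iteratedFDeriv_stdOrthonormalBasis]
  simp only [iteratedFDeriv_two_apply, Matrix.cons_val_zero, Matrix.cons_val_one, h2]
  rw [Finset.sum_add_distrib, ← Finset.mul_sum, ← Finset.mul_sum,
    OrthonormalBasis.sum_sq_norm_inner_right]
  simp
  ring

variable (E) in
/-- The mass of the unnormalized radial kernel. -/
noncomputable def radialMass : ℝ := ∫ z : E, deriv radialProfile (‖z‖ ^ 2)

variable (E) in
lemma continuous_radial : Continuous fun z : E => deriv radialProfile (‖z‖ ^ 2) :=
  contDiff_deriv_radialProfile.continuous.comp (continuous_norm.pow 2)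

variable (E) in
lemma hasCompactSupport_radial : HasCompactSupport fun z : E => deriv radialProfile (‖z‖ ^ 2) := by
  refine HasCompactSupport.intro (isCompact_closedBall (0 : E) 1) fun z hz => ?_
  apply deriv_radialProfile_eq_zero
  simp only [Metric.mem_closedBall, dist_zero_right, not_le] at hz
  nlinarith

variable (E) in
lemma radialMass_pos [Nontrivial E] : 0 < radialMass E := by
  obtain ⟨τ, hτ, h⟩ := exists_deriv_radialProfile_pos
  obtain ⟨z, hz⟩ := exists_norm_eq E (Real.sqrt_nonneg τ)
  refine (continuous_radial E).integral_pos_of_hasCompactSupport_nonneg_nonzero (x := z)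
    (hasCompactSupport_radial E) (fun z => deriv_radialProfile_nonneg _) ?_
  rw [hz, Real.sq_sqrt hτ.1.le]
  exact h.ne'

/-- The mean value kernel: a smooth radial probability density on the ball of radius `r`. -/
noncomputable def meanKernel (r : ℝ) (z : E) : ℝ :=
  (radialMass E)⁻¹ * ((r ^ Module.finrank ℝ E)⁻¹ * deriv radialProfile (‖z‖ ^ 2 * (r ^ 2)⁻¹))

/-- All kernels are dilations of the unit one, so the total mass and the gradient mass need to be
known only at radius `1`. -/
lemma meanKernel_eq_smul {r : ℝ} (z : E) :
    meanKernel r z = (r ^ Module.finrank ℝ E)⁻¹ * meanKernel 1 (r⁻¹ • z) := by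
  simp [meanKernel, norm_smul, mul_pow, mul_comm, mul_left_comm]

lemma contDiff_meanKernel (r : ℝ) : ContDiff ℝ ∞ (meanKernel r : E → ℝ) := by
  unfold meanKernel
  refine contDiff_const.mul (contDiff_const.mul (contDiff_deriv_radialProfile.comp ?_))
  exact (contDiff_norm_sq ℝ).mul contDiff_const

lemma meanKernel_nonneg [Nontrivial E] {r : ℝ} (hr : 0 < r) (z : E) : 0 ≤ meanKernel r z := by
  have := radialMass_pos E
  have := deriv_radialProfile_nonneg (‖z‖ ^ 2 * (r ^ 2)⁻¹)
  unfold meanKernel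
  positivity

lemma meanKernel_eq_zero {r : ℝ} (hr : 0 < r) {z : E} (hz : r ≤ ‖z‖) : meanKernel r z = 0 := by
  have h : 1 ≤ ‖z‖ ^ 2 * (r ^ 2)⁻¹ := by
    rw [← div_eq_mul_inv, one_le_div (by positivity)]
    gcongr
  simp [meanKernel, deriv_radialProfile_eq_zero h]

lemma hasCompactSupport_meanKernel {r : ℝ} (hr : 0 < r) :
    HasCompactSupport (meanKernel r : E → ℝ) := by
  refine HasCompactSupport.intro (isCompact_closedBall (0 : E) r) fun z hz => ?_
  apply meanKernel_eq_zero hr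
  simp only [Metric.mem_closedBall, dist_zero_right, not_le] at hz
  exact hz.le

lemma integral_meanKernel [Nontrivial E] {r : ℝ} (hr : 0 < r) :
    ∫ z : E, meanKernel r z = 1 := by
  simp_rw [meanKernel_eq_smul (r := r)]
  rw [integral_const_mul, Measure.integral_comp_inv_smul volume (meanKernel 1 : E → ℝ) r,
    abs_of_pos (by positivity), smul_eq_mul, inv_mul_cancel_left₀ (by positivity)]
  have := (radialMass_pos E).ne'
  simp only [meanKernel, one_pow, inv_one, mul_one, one_mul]
  rw [integral_const_mul]
  exact inv_mul_cancel₀ this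

/-- The derivative of the mean value kernel in the radius. -/
noncomputable def meanKernelDeriv (r : ℝ) (z : E) : ℝ :=
  -(radialMass E)⁻¹ * (r * r ^ Module.finrank ℝ E)⁻¹ *
    (Module.finrank ℝ E * deriv radialProfile (‖z‖ ^ 2 * (r ^ 2)⁻¹) +
      2 * (‖z‖ ^ 2 * (r ^ 2)⁻¹) * deriv (deriv radialProfile) (‖z‖ ^ 2 * (r ^ 2)⁻¹))

lemma hasDerivAt_meanKernel {r : ℝ} (hr : 0 < r) (z : E) :
    HasDerivAt (fun r => meanKernel r z) (meanKernelDeriv r z) r := by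
  have h1 : HasDerivAt (fun r : ℝ => ‖z‖ ^ 2 * (r ^ 2)⁻¹) (‖z‖ ^ 2 * (-(2 * r) / (r ^ 2) ^ 2)) r := by
    have := ((hasDerivAt_pow 2 r).inv (by positivity)).const_mul (‖z‖ ^ 2)
    simpa using this
  have h2 := (hasDerivAt_deriv_radialProfile (‖z‖ ^ 2 * (r ^ 2)⁻¹)).comp r h1
  have h3 := ((hasDerivAt_pow (Module.finrank ℝ E) r).inv (by positivity)).mul h2
  have h4 := h3.const_mul (radialMass E)⁻¹
  refine HasDerivAt.congr_deriv h4 ?_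
  unfold meanKernelDeriv
  -- The power rule produces the truncated exponent `finrank - 1`, so dimension zero is treated
  -- apart.
  rcases Nat.eq_zero_or_pos (Module.finrank ℝ E) with h0 | h0
  · simp [h0]
    field_simp
  · obtain ⟨k, hk⟩ : ∃ k, Module.finrank ℝ E = k + 1 := ⟨_, (Nat.succ_pred_eq_of_pos h0).symm⟩
    simp only [hk, Function.comp, Nat.add_sub_cancel]
    simp only [Pi.inv_apply]
    field_simp
    ring

/-- A test function about `x` whose Laplacian is the derivative of the mean value kernel in the
radius. -/
noncomputable def meanPotential (r : ℝ) (x y : E) : ℝ :=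
  -(radialMass E)⁻¹ * (r * r ^ Module.finrank ℝ E)⁻¹ * (r ^ 2 / 2) *
    radialProfile (‖x - y‖ ^ 2 * (r ^ 2)⁻¹)

lemma contDiff_meanPotential (r : ℝ) (x : E) : ContDiff ℝ ∞ (meanPotential r x) := by
  unfold meanPotential
  refine contDiff_const.mul (contDiff_radialProfile.comp ?_)
  exact ((contDiff_const.sub contDiff_id).norm_sq ℝ).mul contDiff_const

lemma tsupport_meanPotential_subset {r : ℝ} (hr : 0 < r) (x : E) :
    tsupport (meanPotential r x) ⊆ Metric.closedBall x r := by
  refine closure_minimal (fun y hy => ?_) Metric.isClosed_closedBall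
  by_contra h
  apply hy
  rw [Metric.mem_closedBall, dist_comm, dist_eq_norm, not_le] at h
  have h : 1 ≤ ‖x - y‖ ^ 2 * (r ^ 2)⁻¹ := by
    rw [← div_eq_mul_inv, one_le_div (by positivity)]
    gcongr
  simp [meanPotential, radialProfile_eq_zero h]

lemma hasCompactSupport_meanPotential {r : ℝ} (hr : 0 < r) (x : E) :
    HasCompactSupport (meanPotential r x) :=
  (isCompact_closedBall x r).of_isClosed_subset (isClosed_tsupport _)
    (tsupport_meanPotential_subset hr x)

/-- With `P` the profile, `N` the dimension and `τ = ‖x - y‖² / r²`, both sides are multiples of `N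
P'(τ) + 2 τ P''(τ)`. The Laplacian of `P(τ)` carries the factor `2 / r²`, which the factor `r² / 2`
of the potential cancels. -/
lemma laplacian_meanPotential {r : ℝ} (hr : 0 < r) (x y : E) :
    Laplacian.laplacian (meanPotential r x) y = meanKernelDeriv r (x - y) := by
  set C := -(radialMass E)⁻¹ * (r * r ^ Module.finrank ℝ E)⁻¹ with hC
  set b := (r ^ 2)⁻¹ with hb
  have hd1 : deriv (fun τ => C * (r ^ 2 / 2) * radialProfile (τ * b)) =
      fun τ => C * (r ^ 2 / 2) * (deriv radialProfile (τ * b) * b) := by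
    ext τ
    have : HasDerivAt (fun τ => C * (r ^ 2 / 2) * radialProfile (τ * b)) _ τ :=
      ((hasDerivAt_radialProfile (τ * b)).comp τ ((hasDerivAt_id τ).mul_const b)).const_mul _
    rw [this.deriv, one_mul]
  have hd2 : deriv (fun τ => C * (r ^ 2 / 2) * (deriv radialProfile (τ * b) * b)) =
      fun τ => C * (r ^ 2 / 2) * (deriv (deriv radialProfile) (τ * b) * b * b) := by
    ext τ
    have : HasDerivAt (fun τ => C * (r ^ 2 / 2) * (deriv radialProfile (τ * b) * b)) _ τ :=
      (((hasDerivAt_deriv_radialProfile (τ * b)).comp τ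
        ((hasDerivAt_id τ).mul_const b)).mul_const b).const_mul _
    rw [this.deriv, one_mul]
  have := laplacian_radial (E := E) (φ := fun τ => C * (r ^ 2 / 2) * radialProfile (τ * b))
    (contDiff_const.mul ((contDiff_infty.1 contDiff_radialProfile 2).comp
      (contDiff_id.mul contDiff_const))) x y
  refine Eq.trans this ?_
  rw [hd1, hd2, meanKernelDeriv, ← hC, ← hb]
  have hrb : r ^ 2 * b = 1 := mul_inv_cancel₀ (by positivity)
  linear_combination (C * (Module.finrank ℝ E * deriv radialProfile (‖x - y‖ ^ 2 * b) +
      2 * (‖x - y‖ ^ 2 * b) * deriv (deriv radialProfile) (‖x - y‖ ^ 2 * b))) * hrb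

/-- Supplies the domination for differentiating averages in the radius. The bracket is a continuous
function of `τ = ‖z‖² / r²` that vanishes for `τ ≥ 1`, hence is bounded, and the prefactor decreases
in `r`. -/
lemma exists_bound_meanKernelDeriv {r₀ : ℝ} (hr₀ : 0 < r₀) :
    ∃ C, ∀ r, r₀ ≤ r → ∀ z : E, ‖meanKernelDeriv r z‖ ≤ C := by
  have hcont : Continuous fun τ : ℝ => (Module.finrank ℝ E * deriv radialProfile τ +
      2 * τ * deriv (deriv radialProfile) τ) :=
    (continuous_const.mul contDiff_deriv_radialProfile.continuous).add
      ((continuous_const.mul continuous_id).mul contDiff_deriv_deriv_radialProfile.continuous)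
  obtain ⟨C, hC⟩ := isCompact_Icc.exists_bound_of_continuousOn (s := Icc (0 : ℝ) 1)
    hcont.continuousOn
  have hC0 : 0 ≤ C := (norm_nonneg _).trans (hC 0 (by simp))
  refine ⟨‖(radialMass E)⁻¹‖ * (r₀ * r₀ ^ Module.finrank ℝ E)⁻¹ * C, fun r hr z => ?_⟩
  have hr' : 0 < r := hr₀.trans_le hr
  rw [meanKernelDeriv, norm_mul, norm_mul, norm_neg]
  have h0 : 0 ≤ ‖z‖ ^ 2 * (r ^ 2)⁻¹ := by positivity
  gcongr
  · rw [Real.norm_of_nonneg (by positivity)]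
    gcongr
  · rcases le_or_gt (‖z‖ ^ 2 * (r ^ 2)⁻¹) 1 with h | h
    · exact hC _ ⟨h0, h⟩
    · rw [deriv_radialProfile_eq_zero h.le, deriv_deriv_radialProfile_eq_zero h.le]
      simpa using hC0

end Kernel

/-! ### Weakly harmonic functions: radial averages independent of the radius. -/

section WeaklyHarmonic

variable {E : Type*} [NormedAddCommGroup E] [InnerProductSpace ℝ E] [FiniteDimensional ℝ E]
  [MeasurableSpace E] [BorelSpace E]

/-- `f` is harmonic in `V` in the sense of distributions. -/
def IsWeaklyHarmonicOn (f : E → ℝ) (V : Set E) : Prop :=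
  ∀ ψ : E → ℝ, ContDiff ℝ ∞ ψ → HasCompactSupport ψ → tsupport ψ ⊆ V →
    ∫ x, f x * Laplacian.laplacian ψ x = 0

/-- The radial average of `f` over the ball of radius `r` about `x`. -/
noncomputable def ballMean (r : ℝ) (f : E → ℝ) (x : E) : ℝ := ∫ y, meanKernel r (x - y) * f y

lemma ballMean_eq_convolution (r : ℝ) (f : E → ℝ) :
    ballMean r f = convolution (meanKernel r) f (ContinuousLinearMap.lsmul ℝ ℝ) volume := by
  ext x
  rw [convolution_lsmul_swap]
  rfl

lemma hasDerivAt_ballMean {f : E → ℝ} (hf : Integrable f) (x : E) {r : ℝ} (hr : 0 < r) :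
    HasDerivAt (fun r => ballMean r f x) (∫ y, meanKernelDeriv r (x - y) * f y) r := by
  obtain ⟨C, hC⟩ := exists_bound_meanKernelDeriv (E := E) (half_pos hr)
  have hmeas : ∀ r, AEStronglyMeasurable (fun y => meanKernel r (x - y) * f y) volume := fun r =>
    (((contDiff_meanKernel r).continuous.comp
      (continuous_const.sub continuous_id)).aestronglyMeasurable).mul hf.1
  have hcD : Continuous fun y : E => meanKernelDeriv r (x - y) := by
    unfold meanKernelDeriv
    have h1 : Continuous fun y : E => ‖x - y‖ ^ 2 * (r ^ 2)⁻¹ := by fun_prop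
    exact continuous_const.mul
      ((continuous_const.mul (contDiff_deriv_radialProfile.continuous.comp h1)).add
        ((continuous_const.mul h1).mul (contDiff_deriv_deriv_radialProfile.continuous.comp h1)))
  -- Nearby radii are kept above `r / 2`, where the radial derivative of the kernel is uniformly
  -- bounded.
  refine (hasDerivAt_integral_of_dominated_loc_of_deriv_le (s := Ioi (r / 2))
    (bound := fun y => C * ‖f y‖) (F' := fun s y => meanKernelDeriv s (x - y) * f y) (Ioi_mem_nhds (half_lt_self hr)) (Eventually.of_forall hmeas) ?_
    (hcD.aestronglyMeasurable.mul hf.1) ?_ (hf.norm.const_mul C) ?_).2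
  · obtain ⟨B, hB⟩ := (hasCompactSupport_meanKernel hr).exists_bound_of_continuous
      (contDiff_meanKernel (E := E) r).continuous
    exact hf.bdd_mul (((contDiff_meanKernel r).continuous.comp
      (continuous_const.sub continuous_id)).aestronglyMeasurable)
      (Eventually.of_forall fun y => hB _)
  · refine Eventually.of_forall fun y s hs => ?_
    rw [norm_mul]
    gcongr
    exact hC s (le_of_lt hs) _
  · refine Eventually.of_forall fun y s hs => ?_
    exact (hasDerivAt_meanKernel ((half_pos hr).trans hs) (x - y)).mul_const _

/-- The derivative of the average in the radius is the integral of `f` against the Laplacian of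
`meanPotential`, an admissible test function as long as the closed ball stays in `V`. It therefore
vanishes on `(0, R]`. -/
lemma IsWeaklyHarmonicOn.ballMean_eq {f : E → ℝ} {V : Set E} (h : IsWeaklyHarmonicOn f V)
    (hf : Integrable f) {x : E} {R : ℝ} (hR : Metric.closedBall x R ⊆ V) {r s : ℝ}
    (hr : r ∈ Ioc 0 R) (hs : s ∈ Ioc 0 R) : ballMean r f x = ballMean s f x := by
  have hd : ∀ t ∈ Ioc 0 R, HasDerivAt (fun r => ballMean r f x) 0 t := by
    intro t ht
    refine (hasDerivAt_ballMean hf x ht.1).congr_deriv ?_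
    have := h (meanPotential t x) (contDiff_meanPotential t x)
      (hasCompactSupport_meanPotential ht.1 x)
      ((tsupport_meanPotential_subset ht.1 x).trans
        ((Metric.closedBall_subset_closedBall ht.2).trans hR))
    simp_rw [laplacian_meanPotential ht.1, mul_comm (f _)] at this
    exact this
  have := (convex_Ioc 0 R).norm_image_sub_le_of_norm_hasDerivWithin_le
    (fun t ht => (hd t ht).hasDerivWithinAt) (C := 0) (by simp) hs hr
  simpa [sub_eq_zero] using this

lemma tendsto_ballMean [Nontrivial E] {f : E → ℝ} (hf : AEStronglyMeasurable f volume) {x : E}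
    (hx : ContinuousAt f x) : Tendsto (fun r => ballMean r f x) (𝓝[>] 0) (𝓝 (f x)) := by
  simp_rw [ballMean_eq_convolution]
  refine convolution_tendsto_right (φ := fun r => meanKernel r) (g := fun _ => f)
    (k := fun _ => x) ?_ ?_ ?_ (Eventually.of_forall fun _ => hf) ?_ tendsto_const_nhds
  · filter_upwards [self_mem_nhdsWithin] with r hr using meanKernel_nonneg hr
  · filter_upwards [self_mem_nhdsWithin] with r hr using integral_meanKernel hr
  · rw [tendsto_smallSets_iff]
    intro t ht
    obtain ⟨ε, hε, h⟩ := Metric.mem_nhds_iff.1 ht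
    filter_upwards [Ioo_mem_nhdsGT hε] with r hr z hz
    apply h
    by_contra hz'
    refine hz (meanKernel_eq_zero hr.1 ?_)
    simp only [Metric.mem_ball, dist_zero_right, not_lt] at hz'
    exact hr.2.le.trans hz'
  · exact hx.tendsto.comp tendsto_snd

lemma IsWeaklyHarmonicOn.ballMean_eq_self [Nontrivial E] {f : E → ℝ} {V : Set E}
    (h : IsWeaklyHarmonicOn f V) (hf : Integrable f) {x : E} {r : ℝ} (hr : 0 < r)
    (hR : Metric.closedBall x r ⊆ V) (hx : ContinuousAt f x) : ballMean r f x = f x := by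
  refine tendsto_nhds_unique (tendsto_const_nhds.congr' ?_) (tendsto_ballMean hf.1 hx)
  filter_upwards [Ioc_mem_nhdsGT hr] with s hs using h.ballMean_eq hf hR ⟨hr, le_rfl⟩ hs

/-- `h` coincides in the ball of radius `ρ` about `a` with its radial averages over smaller
balls. -/
def HasMeanValueProperty (h : E → ℝ) (a : E) (ρ : ℝ) : Prop :=
  ∀ x r, 0 < r → dist x a + r < ρ → ballMean r h x = h x

/-! ### Interior derivative estimates and quantitative unique continuation. -/

lemma contDiff_ballMean {f : E → ℝ} (hf : LocallyIntegrable f) {r : ℝ} (hr : 0 < r) :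
    ContDiff ℝ ∞ (ballMean r f) := by
  rw [ballMean_eq_convolution]
  exact (hasCompactSupport_meanKernel hr).contDiff_convolution_left _ (contDiff_meanKernel r) hf

lemma hasCompactSupport_ballMean {f : E → ℝ} (hf : HasCompactSupport f) {r : ℝ} (hr : 0 < r) :
    HasCompactSupport (ballMean r f) := by
  rw [ballMean_eq_convolution]
  exact (hasCompactSupport_meanKernel hr).convolution _ hf

/-- Here the derivative falls on `h`, which shows that derivatives inherit the mean value property.
-/
lemma fderiv_ballMean {h : E → ℝ} (hh : ContDiff ℝ ∞ h) (hc : HasCompactSupport h) {r : ℝ}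
    (x e : E) : fderiv ℝ (ballMean r h) x e = ballMean r (fun y => fderiv ℝ h y e) x := by
  have hK : LocallyIntegrable (meanKernel r : E → ℝ) :=
    (contDiff_meanKernel r).continuous.locallyIntegrable
  rw [ballMean_eq_convolution, ballMean_eq_convolution,
    (hc.hasFDerivAt_convolution_right _ hK (hh.of_le (by simp)) x).fderiv,
    convolution_precompR_apply _ hK (hc.fderiv ℝ) (hh.continuous_fderiv (by simp))]

/-- Here the derivative falls on the kernel, which bounds it by the size of `h` alone. -/
lemma fderiv_ballMean_eq_integral {h : E → ℝ} (hh : Continuous h) {r : ℝ} (hr : 0 < r) (x e : E) :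
    fderiv ℝ (ballMean r h) x e = ∫ z, fderiv ℝ (meanKernel r) z e * h (x - z) := by
  have hc := hasCompactSupport_meanKernel (E := E) hr
  have : ballMean r h =
      convolution h (meanKernel r) (ContinuousLinearMap.mul ℝ ℝ) volume := by
    ext x
    rw [convolution_def]
    simp [ballMean, mul_comm]
  rw [this, (hc.hasFDerivAt_convolution_right _ hh.locallyIntegrable
    ((contDiff_meanKernel r).of_le (by simp)) x).fderiv,
    convolution_precompR_apply _ hh.locallyIntegrable (hc.fderiv ℝ)
      ((contDiff_meanKernel r).continuous_fderiv (by simp)), convolution_mul_swap]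
  simp_rw [mul_comm]

variable (E) in
/-- The total mass of the gradient of the unit mean value kernel. -/
noncomputable def kernelGradientMass : ℝ := ∫ z : E, ‖fderiv ℝ (meanKernel 1 : E → ℝ) z‖

variable (E) in
lemma kernelGradientMass_nonneg : 0 ≤ kernelGradientMass E := integral_nonneg fun _ => norm_nonneg _

lemma integrable_norm_fderiv_meanKernel {r : ℝ} (hr : 0 < r) :
    Integrable fun z : E => ‖fderiv ℝ (meanKernel r : E → ℝ) z‖ :=
  (((contDiff_meanKernel r).continuous_fderiv (by simp)).integrable_of_hasCompactSupport
    ((hasCompactSupport_meanKernel hr).fderiv ℝ)).norm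

lemma integral_norm_fderiv_meanKernel {r : ℝ} (hr : 0 < r) :
    ∫ z : E, ‖fderiv ℝ (meanKernel r : E → ℝ) z‖ = kernelGradientMass E / r := by
  have h1 : ∀ z : E, fderiv ℝ (meanKernel r : E → ℝ) z =
      ((r ^ Module.finrank ℝ E)⁻¹ * r⁻¹) • fderiv ℝ (meanKernel 1 : E → ℝ) (r⁻¹ • z) := by
    intro z
    have h2 : (meanKernel r : E → ℝ) =
        fun z => (r ^ Module.finrank ℝ E)⁻¹ • meanKernel 1 (r⁻¹ • z) := by
      ext z; exact meanKernel_eq_smul z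
    have hd : DifferentiableAt ℝ (fun z : E => meanKernel 1 (r⁻¹ • z)) z :=
      (((contDiff_meanKernel 1).comp (contDiff_id.const_smul r⁻¹)).differentiable (by simp)) z
    rw [h2, fderiv_fun_const_smul hd, fderiv_comp_smul, smul_smul]
  simp_rw [h1, norm_smul]
  rw [integral_const_mul, Measure.integral_comp_inv_smul volume
    (fun z : E => ‖fderiv ℝ (meanKernel 1 : E → ℝ) z‖) r, abs_of_pos (by positivity),
    Real.norm_of_nonneg (by positivity), kernelGradientMass, smul_eq_mul]
  field_simp

/-- The iterated derivative of `h` in the direction `e`. -/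
noncomputable def iterLineDeriv (e : E) (h : E → ℝ) : ℕ → E → ℝ
  | 0 => h
  | k + 1 => fun x => fderiv ℝ (iterLineDeriv e h k) x e

lemma contDiff_iterLineDeriv (e : E) {h : E → ℝ} (hh : ContDiff ℝ ∞ h) (k : ℕ) :
    ContDiff ℝ ∞ (iterLineDeriv e h k) := by
  induction k with
  | zero => exact hh
  | succ k ih => exact (ih.fderiv_right (by simp)).clm_apply contDiff_const

lemma hasCompactSupport_iterLineDeriv (e : E) {h : E → ℝ} (hh : HasCompactSupport h) (k : ℕ) :
    HasCompactSupport (iterLineDeriv e h k) := by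
  induction k with
  | zero => exact hh
  | succ k ih => exact ih.fderiv_apply ℝ e

lemma HasMeanValueProperty.fderiv_apply {h : E → ℝ} {a : E} {ρ : ℝ}
    (H : HasMeanValueProperty h a ρ) (hh : ContDiff ℝ ∞ h) (hc : HasCompactSupport h) (e : E) :
    HasMeanValueProperty (fun x => fderiv ℝ h x e) a ρ := by
  intro x r hr hx
  rw [← fderiv_ballMean hh hc]
  have : ballMean r h =ᶠ[𝓝 x] h := by
    have : Continuous fun x => dist x a + r := by fun_prop
    filter_upwards [this.continuousAt.eventually_lt continuousAt_const hx] with y hy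
    exact H y r hr hy
  rw [this.fderiv_eq]

/-- Near `x` the function equals its own average at radius `δ`. Differentiating the kernel under the
integral costs its gradient mass, which is `kernelGradientMass E / δ` by scaling. -/
lemma HasMeanValueProperty.norm_fderiv_apply_le {h : E → ℝ} {a : E} {ρ : ℝ}
    (H : HasMeanValueProperty h a ρ) (hh : Continuous h) {M : ℝ}
    (hM : ∀ x, dist x a < ρ → ‖h x‖ ≤ M) {x e : E} {δ : ℝ} (hδ : 0 < δ) (hx : dist x a + δ < ρ)
    (he : ‖e‖ ≤ 1) : ‖fderiv ℝ h x e‖ ≤ kernelGradientMass E / δ * M := by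
  have hloc : ballMean δ h =ᶠ[𝓝 x] h := by
    have : Continuous fun x => dist x a + δ := by fun_prop
    filter_upwards [this.continuousAt.eventually_lt continuousAt_const hx] with y hy
    exact H y δ hδ hy
  rw [← hloc.fderiv_eq, fderiv_ballMean_eq_integral hh hδ, ← integral_norm_fderiv_meanKernel hδ,
    ← integral_mul_const]
  refine norm_integral_le_of_norm_le ((integrable_norm_fderiv_meanKernel hδ).mul_const M)
    (Eventually.of_forall fun z => ?_)
  rw [norm_mul]
  have hle : ‖fderiv ℝ (meanKernel δ) z e‖ ≤ ‖fderiv ℝ (meanKernel δ : E → ℝ) z‖ :=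
    ((fderiv ℝ (meanKernel δ) z).le_opNorm e).trans (mul_le_of_le_one_right (norm_nonneg _) he)
  rcases le_or_gt δ ‖z‖ with hz | hz
  -- The kernel is identically zero near `t • z` for `t > 1`, so its gradient vanishes there;
  -- continuity as `t ↓ 1` gives the value at `z`, including the sphere `‖z‖ = δ`.
  · have : fderiv ℝ (meanKernel δ : E → ℝ) z = 0 := by
      have hcont := (contDiff_meanKernel (E := E) δ).continuous_fderiv (by simp)
      have hz0 : z ≠ 0 := by rintro rfl; simp at hz; linarith
      have hs : ∀ t : ℝ, 1 < t → fderiv ℝ (meanKernel δ : E → ℝ) (t • z) = 0 := by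
        intro t ht
        have : (meanKernel δ : E → ℝ) =ᶠ[𝓝 (t • z)] fun _ => 0 := by
          have hlt : δ < ‖t • z‖ := by
            rw [norm_smul, Real.norm_of_nonneg (by linarith)]
            nlinarith [norm_pos_iff.2 hz0]
          filter_upwards [continuousAt_const.eventually_lt continuous_norm.continuousAt hlt]
            with w hw using meanKernel_eq_zero hδ hw.le
        rw [this.fderiv_eq, fderiv_fun_const]; rfl
      have hlim : Tendsto (fun t : ℝ => fderiv ℝ (meanKernel δ : E → ℝ) (t • z)) (𝓝[>] 1)
          (𝓝 (fderiv ℝ (meanKernel δ : E → ℝ) ((1 : ℝ) • z))) :=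
        ((hcont.comp (continuous_id.smul continuous_const)).tendsto 1).mono_left
          nhdsWithin_le_nhds
      rw [one_smul] at hlim
      refine tendsto_nhds_unique hlim (tendsto_const_nhds.congr' ?_)
      filter_upwards [self_mem_nhdsWithin] with t ht using (hs t ht).symm
    simp [this]
  · have hxz : dist (x - z) a < ρ := by
      calc dist (x - z) a ≤ dist (x - z) x + dist x a := dist_triangle _ _ _
        _ = ‖z‖ + dist x a := by simp [dist_eq_norm]
        _ < ρ := by linarith
    have := hM _ hxz
    gcongr

lemma HasMeanValueProperty.mono {h : E → ℝ} {a : E} {ρ ρ' : ℝ} (H : HasMeanValueProperty h a ρ)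
    (hρ : ρ' ≤ ρ) : HasMeanValueProperty h a ρ' := fun x r hr hx => H x r hr (hx.trans_le hρ)

lemma HasMeanValueProperty.iterLineDeriv {h : E → ℝ} {a : E} {ρ : ℝ}
    (H : HasMeanValueProperty h a ρ) (hh : ContDiff ℝ ∞ h) (hc : HasCompactSupport h) (e : E)
    (k : ℕ) : HasMeanValueProperty (iterLineDeriv e h k) a ρ := by
  induction k with
  | zero => exact H
  | succ k ih =>
    exact ih.fderiv_apply (contDiff_iterLineDeriv e hh k) (hasCompactSupport_iterLineDeriv e hc k) e

/-- Each derivative costs a width `δ` of the ball and a factor `kernelGradientMass E / δ`. Leaving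
`δ` free lets it be chosen according to the order `k`. -/
lemma HasMeanValueProperty.norm_iterLineDeriv_le {h : E → ℝ} {a : E} {ρ : ℝ}
    (H : HasMeanValueProperty h a ρ) (hh : ContDiff ℝ ∞ h) (hc : HasCompactSupport h) {M : ℝ}
    (hM : ∀ x, dist x a < ρ → ‖h x‖ ≤ M) {e : E} (he : ‖e‖ ≤ 1) {δ : ℝ} (hδ : 0 < δ) (k : ℕ) {x : E}
    (hx : dist x a + k * δ < ρ) :
    ‖_root_.iterLineDeriv e h k x‖ ≤ (kernelGradientMass E / δ) ^ k * M := by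
  induction k generalizing x with
  | zero => simpa [_root_.iterLineDeriv] using hM x (by simpa using hx)
  | succ k ih =>
    push_cast at hx
    rw [pow_succ', mul_assoc]
    -- The induction hypothesis holds on the ball of radius `ρ - k δ`; one further width `δ` pays
    -- for the next derivative.
    refine HasMeanValueProperty.norm_fderiv_apply_le (ρ := ρ - k * δ)
      ((H.iterLineDeriv hh hc e k).mono (by nlinarith [(Nat.cast_nonneg k : (0 : ℝ) ≤ k)]))
      (contDiff_iterLineDeriv e hh k).continuous (fun y hy => ih (by linarith)) hδ (by linarith) he

lemma iteratedDeriv_comp_line {h : E → ℝ} (hh : ContDiff ℝ ∞ h) (a e : E) (k : ℕ) :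
    iteratedDeriv k (fun t : ℝ => h (a + t • e)) = fun t => iterLineDeriv e h k (a + t • e) := by
  induction k with
  | zero => simp [iterLineDeriv]
  | succ k ih =>
    rw [iteratedDeriv_succ, ih]
    ext t
    have h1 : HasDerivAt (fun t : ℝ => a + t • e) e t := by
      simpa using ((hasDerivAt_id t).smul_const e).const_add a
    exact (((contDiff_iterLineDeriv e hh k).differentiable (by simp)
      (a + t • e)).hasFDerivAt.comp_hasDerivAt t h1).deriv

/-- A function with the mean value property which vanishes near the center of a ball vanishes in a
smaller ball whose size depends on the dimension only. -/
lemma HasMeanValueProperty.eq_zero_of_eventually_eq_zero {h : E → ℝ} {a : E} {ρ : ℝ}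
    (H : HasMeanValueProperty h a ρ) (hh : ContDiff ℝ ∞ h) (hc : HasCompactSupport h)
    (h0 : ∀ᶠ x in 𝓝 a, h x = 0) {x : E} (hx : 16 * (kernelGradientMass E + 1) * dist x a < ρ) :
    h x = 0 := by
  obtain ⟨M, hM⟩ := hc.exists_bound_of_continuous hh.continuous
  have hG := kernelGradientMass_nonneg E
  set G := kernelGradientMass E + 1 with hGdef
  set d := dist x a with hd
  have hd0 : 0 ≤ d := dist_nonneg
  have hρ : 0 < ρ := by
    refine lt_of_le_of_lt ?_ hx
    positivity
  have hM0 : 0 ≤ M := (norm_nonneg _).trans (hM a)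
  rcases eq_or_ne x a with rfl | hxa
  · exact h0.self_of_nhds
  have hdpos : 0 < d := dist_pos.2 hxa
  set e : E := d⁻¹ • (x - a) with he
  have hen : ‖e‖ = 1 := by
    rw [he, norm_smul, ← dist_eq_norm, ← hd, Real.norm_of_nonneg (by positivity),
      inv_mul_cancel₀ hdpos.ne']
  have hxe : a + d • e = x := by
    rw [he, smul_smul, mul_inv_cancel₀ hdpos.ne', one_smul, add_sub_cancel]
  set g : ℝ → ℝ := fun t => h (a + t • e) with hg
  have hgs : ContDiff ℝ ∞ g := hh.comp (contDiff_const.add (contDiff_id.smul contDiff_const))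
  have hg0 : g =ᶠ[𝓝 0] fun _ => 0 := by
    have : Tendsto (fun t : ℝ => a + t • e) (𝓝 0) (𝓝 a) := by
      have hcont : Continuous fun t : ℝ => a + t • e := by fun_prop
      simpa using hcont.tendsto 0
    exact this.eventually h0
  have hder0 : ∀ k, iteratedDeriv k g 0 = 0 := by
    intro k
    rw [(hg0.iteratedDeriv_eq k)]
    cases k <;> simp
  have hud := uniqueDiffOn_Icc hdpos
  have hle : d < ρ / 4 := by nlinarith
  -- the Taylor estimate of order `n`
  have key : ∀ n : ℕ, ‖h x‖ ≤ M * ((n + 1 : ℕ) * (1 / 2 : ℝ) ^ (n + 1)) := by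
    intro n
    -- The `n + 1` derivatives together use up `ρ / 2`, and the segment from `a` to `x` has length
    -- below `ρ / 4`, so the derivative bound applies on all of it.
    set δ : ℝ := ρ / (2 * (n + 1 : ℕ)) with hδ
    have hδ0 : 0 < δ := by positivity
    have hbound : ∀ t ∈ Icc 0 d, ‖iteratedDerivWithin (n + 1) g (Icc 0 d) t‖ ≤
        (kernelGradientMass E / δ) ^ (n + 1) * M := by
      intro t ht
      rw [iteratedDerivWithin_eq_iteratedDeriv hud (hgs.contDiffAt.of_le (by
        exact_mod_cast le_top)) ht, iteratedDeriv_comp_line hh]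
      refine H.norm_iterLineDeriv_le hh hc (fun y _ => hM y) hen.le hδ0 (n + 1) ?_
      have h1 : dist (a + t • e) a = t := by
        simp [dist_eq_norm, norm_smul, hen, abs_of_nonneg ht.1]
      have h2 : ((n + 1 : ℕ) : ℝ) * δ = ρ / 2 := by
        rw [hδ]; field_simp
      rw [h1, h2]
      linarith [ht.2]
    have htay := taylor_mean_remainder_bound hdpos.le
      (hgs.contDiffOn.of_le (by exact_mod_cast le_top)) (right_mem_Icc.2 hdpos.le) hbound
    have hT : taylorWithinEval g n (Icc 0 d) 0 d = 0 := by
      rw [taylor_within_apply]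
      refine Finset.sum_eq_zero fun k _ => ?_
      rw [iteratedDerivWithin_eq_iteratedDeriv hud (hgs.contDiffAt.of_le (by
        exact_mod_cast le_top)) (left_mem_Icc.2 hdpos.le), hder0, smul_zero]
    have hgd : g d = h x := by rw [hg]; simp only [hxe]
    rw [hT, sub_zero, sub_zero, hgd] at htay
    refine htay.trans ?_
    -- A crude Stirling bound, from `m ^ m / m! ≤ e ^ m` and `e ≤ 4`. It leaves the ratio `4 · (1 /
    -- 8) = 1 / 2` in the Taylor remainder, which is what the constant `16` in the hypothesis on `x`
    -- is for.
    have hfac : ((n + 1 : ℕ) : ℝ) ^ (n + 1) ≤ (4 : ℝ) ^ (n + 1) * ((n + 1).factorial : ℝ) := by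
      have h1 := Real.pow_div_factorial_le_exp ((n + 1 : ℕ) : ℝ) (by positivity) (n + 1)
      rw [div_le_iff₀ (by positivity)] at h1
      refine h1.trans ?_
      gcongr
      rw [show ((n + 1 : ℕ) : ℝ) = ((n + 1 : ℕ) : ℝ) * 1 by ring, Real.exp_nat_mul]
      gcongr
      exact (Real.exp_one_lt_d9.trans (by norm_num)).le
    have hq : kernelGradientMass E / δ * d ≤ ((n + 1 : ℕ) : ℝ) * (1 / 8) := by
      have : kernelGradientMass E / δ * d = ((n + 1 : ℕ) : ℝ) * (2 * kernelGradientMass E * d / ρ) := by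
        rw [hδ]; field_simp
      rw [this]
      refine mul_le_mul_of_nonneg_left ?_ (by positivity)
      rw [div_le_iff₀ hρ]
      nlinarith
    calc (kernelGradientMass E / δ) ^ (n + 1) * M * d ^ (n + 1) / (n.factorial : ℝ)
        = (kernelGradientMass E / δ * d) ^ (n + 1) * M / (n.factorial : ℝ) := by
          rw [mul_pow]; ring
      _ ≤ (((n + 1 : ℕ) : ℝ) * (1 / 8)) ^ (n + 1) * M / (n.factorial : ℝ) := by gcongr
      _ = ((n + 1 : ℕ) : ℝ) ^ (n + 1) * (1 / 8 : ℝ) ^ (n + 1) * M / (n.factorial : ℝ) := by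
          rw [mul_pow]
      _ ≤ ((4 : ℝ) ^ (n + 1) * ((n + 1).factorial : ℝ)) * (1 / 8 : ℝ) ^ (n + 1) * M /
            (n.factorial : ℝ) := by gcongr
      _ = M * ((n + 1 : ℕ) * (1 / 2 : ℝ) ^ (n + 1)) := by
          have : (1 / 2 : ℝ) ^ (n + 1) = 4 ^ (n + 1) * (1 / 8) ^ (n + 1) := by
            rw [← mul_pow]; norm_num
          rw [this, Nat.factorial_succ]
          push_cast
          field_simp
  have hlim : Tendsto (fun n : ℕ => M * ((n + 1 : ℕ) * (1 / 2 : ℝ) ^ (n + 1))) atTop (𝓝 (M * 0)) :=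
    ((tendsto_self_mul_const_pow_of_lt_one (by norm_num) (by norm_num : (1 / 2 : ℝ) < 1)).comp
      (tendsto_add_atTop_nat 1)).const_mul M
  rw [mul_zero] at hlim
  exact norm_le_zero_iff.1 (ge_of_tendsto' hlim key)

/-- Quantitative unique continuation for weakly harmonic functions. -/
lemma IsWeaklyHarmonicOn.eq_zero_of_ae_eq_zero [Nontrivial E] {f : E → ℝ} {V : Set E}
    (h : IsWeaklyHarmonicOn f V) (hf : Integrable f) (hfc : HasCompactSupport f)
    (hcont : ∀ᵐ x, x ∈ V → ContinuousAt f x) {a : E} {R : ℝ} (hR : Metric.closedBall a R ⊆ V)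
    {ε : ℝ} (hε : 0 < ε) (h0 : ∀ᵐ x, x ∈ Metric.ball a ε → f x = 0) {x : E}
    (hx : 32 * (kernelGradientMass E + 1) * dist x a < R) (hxc : ContinuousAt f x) : f x = 0 := by
  have hG := kernelGradientMass_nonneg E
  have hd0 : 0 ≤ dist x a := dist_nonneg
  have hR0 : 0 < R / 2 := by
    refine half_pos (lt_of_le_of_lt ?_ hx)
    positivity
  have hball : ∀ y, dist y a ≤ R / 2 → Metric.closedBall y (R / 2) ⊆ V := fun y hy =>
    (Metric.closedBall_subset_closedBall' (by linarith)).trans hR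
  have hmean : ∀ y, dist y a ≤ R / 2 → ∀ r ∈ Ioc 0 (R / 2), ballMean r f y = ballMean (R / 2) f y :=
    fun y hy r hr => h.ballMean_eq hf (hball y hy) hr ⟨hR0, le_rfl⟩
  have hself : ∀ y, dist y a ≤ R / 2 → ContinuousAt f y → ballMean (R / 2) f y = f y :=
    fun y hy hc => h.ballMean_eq_self hf hR0 (hball y hy) hc
  have hself' : ∀ᵐ y, dist y a ≤ R / 2 → ballMean (R / 2) f y = f y := by
    filter_upwards [hcont] with y hy hya
    exact hself y hya (hy (hball y hya (Metric.mem_closedBall_self hR0.le)))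
  -- Under the integral the smooth average may be replaced by `f`, to which it is equal almost
  -- everywhere in the ball. Its average at radius `r` is thus that of `f`, which does not depend on
  -- `r`.
  have hMV : HasMeanValueProperty (ballMean (R / 2) f) a (R / 2) := by
    intro y r hr hy
    rw [← hmean y (by linarith) r ⟨hr, by linarith [dist_nonneg (x := y) (y := a)]⟩]
    refine integral_congr_ae ?_
    filter_upwards [hself'] with z hz
    rcases le_or_gt r ‖y - z‖ with hyz | hyz
    · simp [meanKernel_eq_zero hr hyz]
    · rw [← dist_eq_norm] at hyz
      rw [hz]
      linarith [dist_triangle_left z a y]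
  have hdx : dist x a ≤ R / 2 := by nlinarith
  rw [← hself x hdx hxc]
  refine hMV.eq_zero_of_eventually_eq_zero (contDiff_ballMean hf.locallyIntegrable hR0)
    (hasCompactSupport_ballMean hfc hR0) ?_ (by linarith)
  -- For `y` within this distance of `a`, the average at this same radius only sees points of the
  -- ball of radius `ε`, where `f` vanishes.
  have hmin : 0 < min (ε / 2) (R / 2) := lt_min (by linarith) hR0
  filter_upwards [Metric.ball_mem_nhds a hmin] with y hy
  rw [Metric.mem_ball] at hy
  rw [← hmean y (hy.le.trans (min_le_right _ _)) _ ⟨hmin, min_le_right _ _⟩]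
  refine integral_eq_zero_of_ae ?_
  filter_upwards [h0] with z hz
  rcases le_or_gt (min (ε / 2) (R / 2)) ‖y - z‖ with hyz | hyz
  · simp [meanKernel_eq_zero hmin hyz]
  · rw [← dist_eq_norm] at hyz
    have : min (ε / 2) (R / 2) ≤ ε / 2 := min_le_left _ _
    simp [hz (by rw [Metric.mem_ball]; linarith [dist_triangle_left z a y])]

/-- Unique continuation for weakly harmonic functions which are continuous in a connected open
set. -/
lemma IsWeaklyHarmonicOn.eqOn_zero [Nontrivial E] {f : E → ℝ} {V : Set E}
    (h : IsWeaklyHarmonicOn f V) (hf : Integrable f) (hfc : HasCompactSupport f) (hV : IsOpen V)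
    (hVc : IsPreconnected V) (hcont : ContinuousOn f V) {W : Set E} (hW : IsOpen W) (hWV : W ⊆ V)
    (hne : W.Nonempty) (h0 : EqOn f 0 W) : EqOn f 0 V := by
  have hca : ∀ x ∈ V, ContinuousAt f x := fun x hx => hcont.continuousAt (hV.mem_nhds hx)
  have hG := kernelGradientMass_nonneg E
  set Z : Set E := {x | ∀ᶠ y in 𝓝 x, f y = 0} with hZ
  have hZo : IsOpen Z := isOpen_setOfPred_eventually_nhds
  have hsub : V ⊆ Z := by
    -- The set `Z` of points near which `f` vanishes is open; it remains to see that it meets `V`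
    -- and is relatively closed in `V`.
    refine hVc.subset_of_closure_inter_subset hZo ?_ ?_
    · obtain ⟨w, hw⟩ := hne
      exact ⟨w, hWV hw, Filter.mem_of_superset (hW.mem_nhds hw) fun y hy => h0 hy⟩
    · rintro x ⟨hxZ, hxV⟩
      obtain ⟨R, hR, hRV⟩ := Metric.nhds_basis_closedBall.mem_iff.1 (hV.mem_nhds hxV)
      -- Around a point `a` of `Z` within `κ` of `x` there is still a ball of radius `R / 2` in `V`,
      -- and points within `κ` of `x` are within `2 κ` of `a`; the reach condition then reads `64
      -- (kernelGradientMass E + 1) κ = R / 2`.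
      set κ := R / (128 * (kernelGradientMass E + 1)) with hκ
      have hκ0 : 0 < κ := by positivity
      have hκR : 128 * (kernelGradientMass E + 1) * κ = R := by
        rw [hκ]; field_simp
      obtain ⟨a, ha, hxa⟩ := Metric.mem_closure_iff.1 hxZ κ hκ0
      obtain ⟨ε, hε, hεa⟩ := Metric.eventually_nhds_iff_ball.1 ha
      show ∀ᶠ y in 𝓝 x, f y = 0
      filter_upwards [Metric.ball_mem_nhds x hκ0, hV.mem_nhds hxV] with y hy hyV
      rw [Metric.mem_ball] at hy
      have hya : dist y a < 2 * κ := by linarith [dist_triangle y x a]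
      refine h.eq_zero_of_ae_eq_zero hf hfc (Eventually.of_forall hca) (a := a) (R := R / 2)
        ((Metric.closedBall_subset_closedBall' ?_).trans hRV) hε
        (Eventually.of_forall hεa) ?_ (hca y hyV)
      · rw [dist_comm]
        nlinarith
      · nlinarith
  exact fun x hx => (hsub hx : ∀ᶠ y in 𝓝 x, f y = 0).self_of_nhds

end WeaklyHarmonic

/-! ### Flat charts -/

section Chart

variable {m : ℕ}

/-- Isometric coordinates `(y, s)` on `ℝ^{m+1}`, with `y ∈ ℝ^m` and `s ∈ ℝ`. -/
abbrev FlatChart (m : ℕ) : Type := WithLp 2 (Euc m × ℝ) ≃ᵃⁱ[ℝ] Euc (m + 1)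

/-- The point with coordinates `p = (y, s)`. -/
noncomputable def FlatChart.point (A : FlatChart m) (p : Euc m × ℝ) : Euc (m + 1) := A (WithLp.toLp 2 p)

/-- The coordinates of a point. -/
noncomputable def FlatChart.coord (A : FlatChart m) (x : Euc (m + 1)) : Euc m × ℝ := WithLp.ofLp (A.symm x)

/-- The direction of the last coordinate. -/
noncomputable def FlatChart.axis (A : FlatChart m) : Euc (m + 1) :=
  A.linearIsometryEquiv (WithLp.toLp 2 (0, 1))

namespace FlatChart

variable (A : FlatChart m)

@[simp] lemma point_coord (x : Euc (m + 1)) : A.point (A.coord x) = x := by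
  simp [point, coord]

@[simp] lemma coord_point (p : Euc m × ℝ) : A.coord (A.point p) = p := by
  simp [point, coord]

lemma norm_axis : ‖A.axis‖ = 1 := by
  rw [axis, LinearIsometryEquiv.norm_map]
  simp

lemma point_add (p q : Euc m × ℝ) :
    A.point (p + q) = A.point p + A.linearIsometryEquiv (WithLp.toLp 2 q) := by
  have := A.map_vadd (WithLp.toLp 2 p) (WithLp.toLp 2 q)
  simp only [vadd_eq_add] at this
  rw [add_comm (A.point p), point, point, add_comm p, WithLp.toLp_add, this]

lemma point_add_axis (y : Euc m) (s t : ℝ) : A.point (y, s + t) = A.point (y, s) + t • A.axis := by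
  have : ((y, s + t) : Euc m × ℝ) = (y, s) + t • (0, 1) := by simp
  rw [this, point_add, axis, ← map_smul, WithLp.toLp_smul]

lemma continuous_point : Continuous A.point :=
  A.continuous.comp (WithLp.prod_continuous_toLp 2 _ _)

lemma continuous_coord : Continuous A.coord :=
  (WithLp.prod_continuous_ofLp 2 _ _).comp A.symm.continuous

/-- Flat coordinates as a homeomorphism. -/
noncomputable def homeomorph : Euc m × ℝ ≃ₜ Euc (m + 1) where
  toFun := A.point
  invFun := A.coord
  left_inv := A.coord_point
  right_inv := A.point_coord
  continuous_toFun := A.continuous_point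
  continuous_invFun := A.continuous_coord

lemma measurableEmbedding_point : MeasurableEmbedding A.point :=
  A.homeomorph.measurableEmbedding

lemma injective_point : Function.Injective A.point := A.homeomorph.injective

lemma measurePreserving_point : MeasurePreserving A.point := by
  have h1 : MeasurePreserving (fun x : Euc (m + 1) => x + A (WithLp.toLp 2 0)) :=
    measurePreserving_add_right volume _
  have h2 := (h1.comp A.linearIsometryEquiv.measurePreserving).comp
    (WithLp.volume_preserving_toLp (Euc m) ℝ)
  refine (funext fun p => ?_ : _ = A.point) ▸ h2
  have := A.point_add 0 p
  rw [zero_add] at this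
  rw [this, add_comm (A.point 0)]
  rfl

lemma isometry_base : Isometry fun y : Euc m => A.point (y, 0) := by
  refine A.isometry.comp (g := A) (f := fun y : Euc m => WithLp.toLp 2 (y, (0 : ℝ))) ?_
  refine Isometry.of_dist_eq fun y z => ?_
  rw [WithLp.prod_dist_eq_of_L2]
  simp [Real.sqrt_sq dist_nonneg]

lemma contDiff_line (y : Euc m) : ContDiff ℝ ∞ fun s : ℝ => A.point (y, s) := by
  have : (fun s : ℝ => A.point (y, s)) = fun s => A.point (y, 0) + s • A.axis := by
    ext1 s; rw [← point_add_axis, zero_add]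
  rw [this]
  fun_prop

lemma hasDerivAt_line (y : Euc m) (s : ℝ) :
    HasDerivAt (fun s : ℝ => A.point (y, s)) A.axis s := by
  have : (fun s : ℝ => A.point (y, s)) = fun s => A.point (y, 0) + s • A.axis := by
    ext1 s; rw [← point_add_axis, zero_add]
  rw [this]
  simpa using ((hasDerivAt_id s).smul_const A.axis).const_add (A.point (y, 0))

/-- An isometric embedding preserves Hausdorff measure, and on `ℝ^m` that measure is Lebesgue
measure. Surface integrals over the flat piece thereby become integrals over `Θ`. -/
lemma map_base_restrict (Θ : Set (Euc m)) (hΘ : MeasurableSet Θ) :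
    (volume.restrict Θ).map (fun y => A.point (y, 0)) =
      μHE[m].restrict (A.point '' (Θ ×ˢ {0})) := by
  have hemb : MeasurableEmbedding fun y : Euc m => A.point (y, 0) :=
    A.isometry_base.isClosedEmbedding.measurableEmbedding
  have himg : A.point '' (Θ ×ˢ {0}) = (fun y : Euc m => A.point (y, 0)) '' Θ := by
    rw [prod_singleton, image_image]
  rw [himg, ← EuclideanSpace.euclideanHausdorffMeasure_eq_volume,
    ← hemb.injective.preimage_image (s := Θ), ← hemb.restrict_map,
    A.isometry_base.map_euclideanHausdorffMeasure, hemb.injective.preimage_image,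
    Measure.restrict_restrict (hemb.measurableSet_image.2 hΘ),
    inter_eq_left.2 (image_subset_range _ _)]

lemma map_point_restrict (S : Set (Euc m × ℝ)) :
    (volume.restrict S).map A.point = volume.restrict (A.point '' S) :=
  (A.measurePreserving_point.restrict_image_emb A.measurableEmbedding_point S).map_eq

lemma lintegral_image (S : Set (Euc m × ℝ)) (f : Euc (m + 1) → ℝ≥0∞) :
    ∫⁻ x in A.point '' S, f x = ∫⁻ p in S, f (A.point p) := by
  rw [← map_point_restrict, A.measurableEmbedding_point.lintegral_map]

lemma eLpNorm_image {F : Type*} [NormedAddCommGroup F] (S : Set (Euc m × ℝ)) (p : ℝ≥0∞)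
    (f : Euc (m + 1) → F) :
    eLpNorm f p (volume.restrict (A.point '' S)) =
      eLpNorm (fun q => f (A.point q)) p (volume.restrict S) := by
  rw [← map_point_restrict, A.measurableEmbedding_point.eLpNorm_map_measure]
  rfl

lemma eLpNorm_base {F : Type*} [NormedAddCommGroup F] {Θ : Set (Euc m)} (hΘ : MeasurableSet Θ)
    (p : ℝ≥0∞) (f : Euc (m + 1) → F) :
    eLpNorm f p (μHE[m].restrict (A.point '' (Θ ×ˢ {0}))) =
      eLpNorm (fun y => f (A.point (y, 0))) p (volume.restrict Θ) := by
  rw [← A.map_base_restrict Θ hΘ,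
    A.isometry_base.isClosedEmbedding.measurableEmbedding.eLpNorm_map_measure]
  rfl

end FlatChart

end Chart

/-! ### Line estimates and the trace inequality over a flat piece. -/

section OneDim

variable {F : Type*} [NormedAddCommGroup F] [NormedSpace ℝ F]

/-- At the endpoint `0` only continuity is known, which is all that approximants of a trace offer at
the boundary. The estimate holds on `[a, s]` and passes to the limit `a ↓ 0`. -/
lemma enorm_sub_le_lintegral_deriv_of_continuousOn_Ico {g : ℝ → F} {ℓ : ℝ}
    (hc : ContinuousOn g (Ico 0 ℓ)) (hd : ContDiffOn ℝ 1 g (Ioo 0 ℓ)) {s : ℝ} (hs : s ∈ Ioo 0 ℓ) :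
    ‖g s - g 0‖ₑ ≤ ∫⁻ τ in Ioo 0 s, ‖deriv g τ‖ₑ := by
  have hlim : Tendsto (fun a => ‖g s - g a‖ₑ) (𝓝[>] 0) (𝓝 ‖g s - g 0‖ₑ) := by
    have h0 : Tendsto g (𝓝[>] 0) (𝓝 (g 0)) := by
      refine (hc 0 ⟨le_rfl, hs.1.trans hs.2⟩).mono_left ?_
      rw [nhdsWithin_Ico_eq_nhdsGE (hs.1.trans hs.2)]
      exact nhdsWithin_mono _ Ioi_subset_Ici_self
    exact (tendsto_const_nhds.sub h0).enorm
  refine le_of_tendsto hlim ?_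
  filter_upwards [Ioo_mem_nhdsGT hs.1] with a ha
  refine (enorm_sub_le_lintegral_deriv_of_contDiffOn_Icc
    (hd.mono (Icc_subset_Ioo ha.1 hs.2)) ha.2.le).trans ?_
  rw [← restrict_Ioo_eq_restrict_Icc]
  exact lintegral_mono_set (Ioo_subset_Ioo_left ha.1.le)

end OneDim

section TraceInequalities

variable {m : ℕ} {F : Type*} [NormedAddCommGroup F] [NormedSpace ℝ F]

namespace FlatChart

/-- The open cylinder of height `ℓ` over the flat piece `Θ`. -/
def cyl (A : FlatChart m) (Θ : Set (Euc m)) (ℓ : ℝ) : Set (Euc (m + 1)) :=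
  A.point '' (Θ ×ˢ Ioo 0 ℓ)

/-- The flat piece `Θ` in the hyperplane `s = 0`. -/
def base (A : FlatChart m) (Θ : Set (Euc m)) : Set (Euc (m + 1)) := A.point '' (Θ ×ˢ {0})

variable (A : FlatChart m) {Θ : Set (Euc m)} {ℓ : ℝ}

lemma isOpen_cyl (hΘ : IsOpen Θ) (ℓ : ℝ) : IsOpen (A.cyl Θ ℓ) :=
  A.homeomorph.isOpenMap _ (hΘ.prod isOpen_Ioo)

lemma point_mem_cyl {y : Euc m} {s : ℝ} : A.point (y, s) ∈ A.cyl Θ ℓ ↔ y ∈ Θ ∧ s ∈ Ioo 0 ℓ := by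
  rw [cyl, A.injective_point.mem_set_image, mem_prod]

lemma point_mem_base {y : Euc m} {s : ℝ} : A.point (y, s) ∈ A.base Θ ↔ y ∈ Θ ∧ s = 0 := by
  rw [base, A.injective_point.mem_set_image, mem_prod, mem_singleton_iff]

lemma cyl_mono {Θ' : Set (Euc m)} {t : ℝ} (hΘ : Θ' ⊆ Θ) (ht : t ≤ ℓ) : A.cyl Θ' t ⊆ A.cyl Θ ℓ :=
  image_mono (prod_mono hΘ (Ioo_subset_Ioo_right ht))

variable {A}

lemma continuousOn_line {w : Euc (m + 1) → F} (hc : ContinuousOn w (A.cyl Θ ℓ ∪ A.base Θ))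
    {y : Euc m} (hy : y ∈ Θ) : ContinuousOn (fun s => w (A.point (y, s))) (Ico 0 ℓ) := by
  refine hc.comp (A.contDiff_line y).continuous.continuousOn fun s hs => ?_
  rcases hs.1.eq_or_lt with h | h
  · exact Or.inr (A.point_mem_base.2 ⟨hy, h.symm⟩)
  · exact Or.inl (A.point_mem_cyl.2 ⟨hy, h, hs.2⟩)

lemma enorm_sub_base_le (hΘ : IsOpen Θ) {w : Euc (m + 1) → F} (hw : ContDiffOn ℝ 1 w (A.cyl Θ ℓ))
    (hc : ContinuousOn w (A.cyl Θ ℓ ∪ A.base Θ)) {y : Euc m} (hy : y ∈ Θ) {s : ℝ}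
    (hs : s ∈ Ioo 0 ℓ) :
    ‖w (A.point (y, s)) - w (A.point (y, 0))‖ₑ ≤
      ∫⁻ τ in Ioo 0 s, ‖fderiv ℝ w (A.point (y, τ))‖ₑ := by
  have hd : ContDiffOn ℝ 1 (fun s => w (A.point (y, s))) (Ioo 0 ℓ) :=
    hw.comp ((A.contDiff_line y).of_le (by simp)).contDiffOn fun s hs => A.point_mem_cyl.2 ⟨hy, hs⟩
  refine (enorm_sub_le_lintegral_deriv_of_continuousOn_Ico (continuousOn_line hc hy) hd hs).trans ?_
  refine setLIntegral_mono' measurableSet_Ioo fun τ hτ => ?_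
  have hmem : A.point (y, τ) ∈ A.cyl Θ ℓ := A.point_mem_cyl.2 ⟨hy, hτ.1, hτ.2.trans hs.2⟩
  have hdw : DifferentiableAt ℝ w (A.point (y, τ)) :=
    (hw.contDiffAt ((A.isOpen_cyl hΘ ℓ).mem_nhds hmem)).differentiableAt (by simp)
  have hder : HasDerivAt (fun s => w (A.point (y, s))) _ τ :=
    hdw.hasFDerivAt.comp_hasDerivAt τ (A.hasDerivAt_line y τ)
  rw [hder.deriv, ← ofReal_norm, ← ofReal_norm]
  refine ENNReal.ofReal_le_ofReal (((fderiv ℝ w (A.point (y, τ))).le_opNorm A.axis).trans ?_)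
  rw [A.norm_axis, mul_one]

lemma measurableSet_prod_Ioo (hΘ : IsOpen Θ) (t : ℝ) : MeasurableSet (Θ ×ˢ Ioo (0 : ℝ) t) :=
  hΘ.measurableSet.prod measurableSet_Ioo

lemma aestronglyMeasurable_comp_point {G : Type*} [NormedAddCommGroup G] (hΘ : IsOpen Θ)
    {w : Euc (m + 1) → G}
    (hw : ContinuousOn w (A.cyl Θ ℓ)) {t : ℝ} (ht : t ≤ ℓ) :
    AEStronglyMeasurable (fun q => w (A.point q)) (volume.restrict (Θ ×ˢ Ioo 0 t)) := by
  refine ContinuousOn.aestronglyMeasurable ?_ (measurableSet_prod_Ioo hΘ t)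
  exact hw.comp A.continuous_point.continuousOn fun q hq =>
    A.point_mem_cyl.2 ⟨hq.1, hq.2.1, hq.2.2.trans_le ht⟩

lemma lintegral_prod_Ioo {f : Euc m × ℝ → ℝ≥0∞} {t : ℝ}
    (hf : AEMeasurable f (volume.restrict (Θ ×ˢ Ioo 0 t))) :
    ∫⁻ q in Θ ×ˢ Ioo 0 t, f q = ∫⁻ y in Θ, ∫⁻ s in Ioo 0 t, f (y, s) := by
  rw [Measure.volume_eq_prod, ← Measure.prod_restrict] at hf ⊢
  exact lintegral_prod f hf

/-- The mass of a function in a thin cylinder is controlled by its values on the base and its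
derivative. -/
lemma lintegral_cyl_le (hΘ : IsOpen Θ) {w : Euc (m + 1) → F} (hw : ContDiffOn ℝ 1 w (A.cyl Θ ℓ))
    (hc : ContinuousOn w (A.cyl Θ ℓ ∪ A.base Θ)) {t : ℝ} (ht : t ≤ ℓ) :
    ∫⁻ q in Θ ×ˢ Ioo 0 t, ‖w (A.point q)‖ₑ ≤
      ENNReal.ofReal t * ((∫⁻ y in Θ, ‖w (A.point (y, 0))‖ₑ) +
        ∫⁻ q in Θ ×ˢ Ioo 0 t, ‖fderiv ℝ w (A.point q)‖ₑ) := by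
  have hDc : ContinuousOn (fderiv ℝ w) (A.cyl Θ ℓ) :=
    hw.continuousOn_fderiv_of_isOpen (A.isOpen_cyl hΘ ℓ) le_rfl
  have hDm := (aestronglyMeasurable_comp_point hΘ hDc ht).enorm
  have hWm := (aestronglyMeasurable_comp_point hΘ
    (hc.mono subset_union_left) ht).enorm
  have hDm' : AEMeasurable (fun y : Euc m => ∫⁻ s in Ioo 0 t, ‖fderiv ℝ w (A.point (y, s))‖ₑ)
      (volume.restrict Θ) := by
    rw [Measure.volume_eq_prod, ← Measure.prod_restrict] at hDm
    exact hDm.lintegral_prod_right'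
  rw [lintegral_prod_Ioo hWm, lintegral_prod_Ioo hDm, ← lintegral_add_right' _ hDm',
    ← lintegral_const_mul' _ _ ENNReal.ofReal_ne_top]
  -- On each line over the base, `‖w‖` is at most its base value plus the total variation up to
  -- height `t`; integrating this constant over an interval of length `t` gives the factor `t`.
  refine setLIntegral_mono' hΘ.measurableSet fun y hy => ?_
  calc ∫⁻ s in Ioo 0 t, ‖w (A.point (y, s))‖ₑ
      ≤ ∫⁻ s in Ioo 0 t, (‖w (A.point (y, 0))‖ₑ +
          ∫⁻ τ in Ioo 0 t, ‖fderiv ℝ w (A.point (y, τ))‖ₑ) := by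
        refine setLIntegral_mono' measurableSet_Ioo fun s hs => ?_
        have h := enorm_sub_base_le hΘ hw hc hy ⟨hs.1, hs.2.trans_le ht⟩
        calc ‖w (A.point (y, s))‖ₑ
            = ‖w (A.point (y, 0)) + (w (A.point (y, s)) - w (A.point (y, 0)))‖ₑ := by
              rw [add_sub_cancel]
          _ ≤ _ := (enorm_add_le _ _).trans (add_le_add le_rfl
              (h.trans (lintegral_mono_set (Ioo_subset_Ioo_right hs.2.le))))
    _ = _ := by
        rw [setLIntegral_const, Real.volume_Ioo, sub_zero, mul_comm]

/-- The base value is compared with the value at height `s` and the comparison is integrated over `s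
∈ (0, ℓ)`. -/
lemma ofReal_mul_enorm_base_le (hΘ : IsOpen Θ) {w : Euc (m + 1) → F}
    (hw : ContDiffOn ℝ 1 w (A.cyl Θ ℓ)) (hc : ContinuousOn w (A.cyl Θ ℓ ∪ A.base Θ)) {y : Euc m}
    (hy : y ∈ Θ) (hℓ : 0 < ℓ) :
    ENNReal.ofReal ℓ * ‖w (A.point (y, 0))‖ₑ ≤
      ∫⁻ s in Ioo 0 ℓ, ‖‖w (A.point (y, s))‖ + ℓ * ‖fderiv ℝ w (A.point (y, s))‖‖ₑ := by
  have hmeas : Measurable fun s : ℝ => A.point (y, s) := (A.contDiff_line y).continuous.measurable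
  have hWm : AEMeasurable (fun s => ‖w (A.point (y, s))‖ₑ) (volume.restrict (Ioo 0 ℓ)) :=
    (((continuousOn_line hc hy).mono Ioo_subset_Ico_self).aestronglyMeasurable
      measurableSet_Ioo).enorm
  calc ENNReal.ofReal ℓ * ‖w (A.point (y, 0))‖ₑ
      = ∫⁻ s in Ioo 0 ℓ, ‖w (A.point (y, 0))‖ₑ := by
        rw [setLIntegral_const, Real.volume_Ioo, sub_zero, mul_comm]
    _ ≤ ∫⁻ s in Ioo 0 ℓ, (‖w (A.point (y, s))‖ₑ +
          ∫⁻ τ in Ioo 0 ℓ, ‖fderiv ℝ w (A.point (y, τ))‖ₑ) := by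
        refine setLIntegral_mono' measurableSet_Ioo fun s hs => ?_
        have h := enorm_sub_base_le hΘ hw hc hy hs
        calc ‖w (A.point (y, 0))‖ₑ
            = ‖w (A.point (y, s)) - (w (A.point (y, s)) - w (A.point (y, 0)))‖ₑ := by
              rw [sub_sub_cancel]
          _ ≤ _ := (enorm_sub_le).trans (add_le_add le_rfl
              (h.trans (lintegral_mono_set (Ioo_subset_Ioo_right hs.2.le))))
    _ = (∫⁻ s in Ioo 0 ℓ, ‖w (A.point (y, s))‖ₑ) +
          ENNReal.ofReal ℓ * ∫⁻ τ in Ioo 0 ℓ, ‖fderiv ℝ w (A.point (y, τ))‖ₑ := by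
        rw [lintegral_add_left' hWm, setLIntegral_const, Real.volume_Ioo, sub_zero,
          mul_comm (ENNReal.ofReal ℓ)]
    _ = ∫⁻ s in Ioo 0 ℓ, ‖‖w (A.point (y, s))‖ + ℓ * ‖fderiv ℝ w (A.point (y, s))‖‖ₑ := by
        rw [← lintegral_const_mul' _ _ ENNReal.ofReal_ne_top, ← lintegral_add_left' hWm]
        refine lintegral_congr fun s => ?_
        rw [Real.enorm_of_nonneg (by positivity), ENNReal.ofReal_add (by positivity) (by positivity),
          ENNReal.ofReal_mul hℓ.le, ofReal_norm, ofReal_norm]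

/-- The trace inequality in `W^{1,p}` for a flat piece of the boundary. -/
lemma eLpNorm_base_le (hΘ : IsOpen Θ) {w : Euc (m + 1) → F} (hw : ContDiffOn ℝ 1 w (A.cyl Θ ℓ))
    (hc : ContinuousOn w (A.cyl Θ ℓ ∪ A.base Θ)) (hℓ : 0 < ℓ) {p : ℝ≥0∞} (hp : 1 ≤ p)
    (hp' : p ≠ ⊤) :
    eLpNorm w p (μHE[m].restrict (A.base Θ)) ≤
      ENNReal.ofReal (ℓ ^ (-p.toReal⁻¹)) * (eLpNorm w p (volume.restrict (A.cyl Θ ℓ)) +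
        ENNReal.ofReal ℓ * eLpNorm (fderiv ℝ w) p (volume.restrict (A.cyl Θ ℓ))) := by
  have hDc : ContinuousOn (fderiv ℝ w) (A.cyl Θ ℓ) :=
    hw.continuousOn_fderiv_of_isOpen (A.isOpen_cyl hΘ ℓ) le_rfl
  have hDm := (aestronglyMeasurable_comp_point hΘ hDc le_rfl).norm
  have hWm := (aestronglyMeasurable_comp_point hΘ (hc.mono subset_union_left) le_rfl).norm
  set f : Euc m × ℝ → ℝ := fun q => ‖w (A.point q)‖ + ℓ * ‖fderiv ℝ w (A.point q)‖ with hf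
  have hfm : AEStronglyMeasurable f (volume.restrict (Θ ×ˢ Ioo 0 ℓ)) :=
    hWm.add (hDm.const_mul ℓ)
  have hp0 : p ≠ 0 := (zero_lt_one.trans_le hp).ne'
  set r := p.toReal with hr
  have hr1 : 1 ≤ r := by
    rw [hr, ← ENNReal.toReal_one]
    exact (ENNReal.toReal_le_toReal ENNReal.one_ne_top hp').2 hp
  have hr0 : 0 < r := by linarith
  -- pointwise estimate
  have hpt : ∀ y ∈ Θ, ‖w (A.point (y, 0))‖ₑ ^ r ≤
      ENNReal.ofReal ℓ⁻¹ * ∫⁻ s in Ioo 0 ℓ, ‖f (y, s)‖ₑ ^ r := by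
    intro y hy
    have h1 := ofReal_mul_enorm_base_le hΘ hw hc hy hℓ
    have hfy : AEStronglyMeasurable (fun s => f (y, s)) (volume.restrict (Ioo 0 ℓ)) := by
      have hmaps : MapsTo (fun s : ℝ => A.point (y, s)) (Ioo 0 ℓ) (A.cyl Θ ℓ) := fun s hs =>
        A.point_mem_cyl.2 ⟨hy, hs⟩
      have hcl := (A.contDiff_line y).continuous.continuousOn (s := Ioo 0 ℓ)
      exact (((hc.mono subset_union_left).comp hcl hmaps).norm.add
        (continuousOn_const.mul (hDc.comp hcl hmaps).norm)).aestronglyMeasurable measurableSet_Ioo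
    -- Hölder on an interval of length `ℓ` costs `ℓ ^ (1 - 1 / r)`. After raising to the power `r`
    -- and dividing by `ℓ ^ r`, the factor left is `ℓ⁻¹`.
    have h2 := eLpNorm_le_eLpNorm_mul_rpow_measure_univ hp hfy
    rw [eLpNorm_one_eq_lintegral_enorm, Measure.restrict_apply_univ, Real.volume_Ioo, sub_zero,
      eLpNorm_eq_lintegral_rpow_enorm_toReal hp0 hp', ENNReal.toReal_one, ← hr] at h2
    have h3 := h1.trans h2
    have h4 := ENNReal.rpow_le_rpow h3 hr0.le
    rw [ENNReal.mul_rpow_of_nonneg _ _ hr0.le, ENNReal.mul_rpow_of_nonneg _ _ hr0.le,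
      ← ENNReal.rpow_mul, ← ENNReal.rpow_mul, one_div, inv_mul_cancel₀ hr0.ne', ENNReal.rpow_one,
      ENNReal.ofReal_rpow_of_pos hℓ, ENNReal.ofReal_rpow_of_pos hℓ] at h4
    have h5 : (1 / 1 - r⁻¹) * r = r - 1 := by field_simp
    rw [h5] at h4
    calc ‖w (A.point (y, 0))‖ₑ ^ r
        = ENNReal.ofReal (ℓ ^ (-r)) * (ENNReal.ofReal (ℓ ^ r) * ‖w (A.point (y, 0))‖ₑ ^ r) := by
          rw [← mul_assoc, ← ENNReal.ofReal_mul (by positivity), ← Real.rpow_add hℓ]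
          simp
      _ ≤ ENNReal.ofReal (ℓ ^ (-r)) *
            ((∫⁻ s in Ioo 0 ℓ, ‖f (y, s)‖ₑ ^ r) * ENNReal.ofReal (ℓ ^ (r - 1))) := by gcongr
      _ = _ := by
          rw [mul_comm (∫⁻ s in Ioo 0 ℓ, ‖f (y, s)‖ₑ ^ r), ← mul_assoc,
            ← ENNReal.ofReal_mul (by positivity), ← Real.rpow_add hℓ]
          congr 2
          rw [show -r + (r - 1) = -1 by ring, Real.rpow_neg_one]
  have hint : ∫⁻ y in Θ, ‖w (A.point (y, 0))‖ₑ ^ r ≤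
      ENNReal.ofReal ℓ⁻¹ * ∫⁻ q in Θ ×ˢ Ioo 0 ℓ, ‖f q‖ₑ ^ r := by
    rw [lintegral_prod_Ioo (hfm.enorm.pow_const r),
      ← lintegral_const_mul' _ _ ENNReal.ofReal_ne_top]
    exact setLIntegral_mono' hΘ.measurableSet hpt
  have hbase : eLpNorm w p (μHE[m].restrict (A.base Θ)) ≤
      ENNReal.ofReal (ℓ ^ (-r⁻¹)) * eLpNorm f p (volume.restrict (Θ ×ˢ Ioo 0 ℓ)) := by
    rw [base, A.eLpNorm_base hΘ.measurableSet, eLpNorm_eq_lintegral_rpow_enorm_toReal hp0 hp',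
      eLpNorm_eq_lintegral_rpow_enorm_toReal hp0 hp', ← hr]
    refine (ENNReal.rpow_le_rpow hint (by positivity)).trans (le_of_eq ?_)
    rw [ENNReal.mul_rpow_of_nonneg _ _ (by positivity), ENNReal.ofReal_rpow_of_pos (by positivity)]
    congr 2
    rw [Real.inv_rpow hℓ.le, one_div, Real.rpow_neg hℓ.le]
  refine hbase.trans ?_
  gcongr
  refine (eLpNorm_add_le hWm (hDm.const_mul ℓ) hp).trans (le_of_eq ?_)
  rw [cyl, A.eLpNorm_image, A.eLpNorm_image, eLpNorm_norm]
  congr 1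
  have : (fun q : Euc m × ℝ => ℓ * ‖fderiv ℝ w (A.point q)‖) =
      ℓ • fun q : Euc m × ℝ => ‖fderiv ℝ w (A.point q)‖ := rfl
  rw [this, eLpNorm_const_smul, eLpNorm_norm, Real.enorm_of_nonneg hℓ.le]

end FlatChart

end TraceInequalities

/-! ### Integration by parts against test functions -/

section Green

variable {E : Type*} [NormedAddCommGroup E] [InnerProductSpace ℝ E] [FiniteDimensional ℝ E]
  [MeasurableSpace E] [BorelSpace E]

lemma continuous_mul_of_tsupport_subset {Ω : Set E} (hΩ : IsOpen Ω) {u g : E → ℝ}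
    (hu : ContinuousOn u Ω) (hg : Continuous g) (hs : tsupport g ⊆ Ω) :
    Continuous fun x => u x * g x := by
  refine continuous_of_tsupport fun x hx => ?_
  have hx' : x ∈ Ω := hs (tsupport_mul_subset_right hx)
  exact (hu.continuousAt (hΩ.mem_nhds hx')).mul hg.continuousAt

lemma integrable_mul_of_tsupport_subset {Ω : Set E} (hΩ : IsOpen Ω) {u g : E → ℝ}
    (hu : ContinuousOn u Ω) (hg : Continuous g) (hc : HasCompactSupport g) (hs : tsupport g ⊆ Ω) :
    Integrable fun x => u x * g x :=
  (continuous_mul_of_tsupport_subset hΩ hu hg hs).integrable_of_hasCompactSupport hc.mul_left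

/-- Regularity of `u` is needed only on the support of `g`, which lies inside `Ω`; the products
extend by zero, so no boundary term appears. -/
lemma integral_mul_fderiv_eq_neg {Ω : Set E} (hΩ : IsOpen Ω) {u g : E → ℝ}
    (hu : ContDiffOn ℝ 1 u Ω) (hg : ContDiff ℝ 1 g) (hc : HasCompactSupport g)
    (hs : tsupport g ⊆ Ω) (e : E) :
    ∫ x, u x * fderiv ℝ g x e = -∫ x, fderiv ℝ u x e * g x := by
  have hDg : Continuous fun x => fderiv ℝ g x e :=
    (hg.continuous_fderiv (by simp)).clm_apply continuous_const
  have hDu : ContinuousOn (fun x => fderiv ℝ u x e) Ω :=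
    (hu.continuousOn_fderiv_of_isOpen hΩ le_rfl).clm_apply continuousOn_const
  refine integral_mul_fderiv_eq_neg_fderiv_mul_of_integrable
    (integrable_mul_of_tsupport_subset hΩ hDu hg.continuous hc hs)
    (integrable_mul_of_tsupport_subset hΩ hu.continuousOn hDg (hc.fderiv_apply ℝ e)
      ((tsupport_fderiv_apply_subset ℝ e).trans hs))
    (integrable_mul_of_tsupport_subset hΩ hu.continuousOn hg.continuous hc hs) ?_ ?_
  · intro x hx
    exact (hu.contDiffAt (hΩ.mem_nhds (hs hx))).differentiableAt (by simp)
  · intro x _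
    exact hg.differentiable (by simp) x

lemma laplacian_eq_sum {f : E → ℝ} {ι : Type*} [Fintype ι] (b : OrthonormalBasis ι ℝ E) (x : E) :
    Laplacian.laplacian f x = ∑ i, fderiv ℝ (fderiv ℝ f) x (b i) (b i) := by
  rw [laplacian_eq_iteratedFDeriv_orthonormalBasis f b]
  simp [iteratedFDeriv_two_apply]

lemma fderiv_fderiv_apply {f : E → ℝ} {x : E} (hf : ContDiffAt ℝ 2 f x) (e w : E) :
    fderiv ℝ (fun y => fderiv ℝ f y e) x w = fderiv ℝ (fderiv ℝ f) x w e := by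
  have hd : DifferentiableAt ℝ (fderiv ℝ f) x :=
    (hf.fderiv_right (m := 1) (by norm_num)).differentiableAt (by simp)
  rw [fderiv_clm_apply hd (differentiableAt_const e)]
  simp

/-- A harmonic function is weakly harmonic. -/
lemma integral_mul_laplacian_eq_zero {Ω : Set E} (hΩ : IsOpen Ω) {u ψ : E → ℝ}
    (hu : HarmonicOnNhd u Ω) (hψ : ContDiff ℝ ∞ ψ) (hc : HasCompactSupport ψ)
    (hs : tsupport ψ ⊆ Ω) : ∫ x, u x * Laplacian.laplacian ψ x = 0 := by
  set b := stdOrthonormalBasis ℝ E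
  have hψ2 : ∀ x, ContDiffAt ℝ 2 ψ x := fun x => (contDiff_infty.1 hψ 2).contDiffAt
  have hDψ : ∀ i, ContDiff ℝ 1 fun x => fderiv ℝ ψ x (b i) := fun i =>
    ((contDiff_infty.1 hψ 2).fderiv_right (m := 1) (by norm_num)).clm_apply contDiff_const
  have hDu : ∀ i, ContDiffOn ℝ 1 (fun x => fderiv ℝ u x (b i)) Ω := fun i =>
    (hu.contDiffOn.fderiv_of_isOpen hΩ (by norm_num)).clm_apply contDiffOn_const
  have hu1 : ContDiffOn ℝ 1 u Ω := hu.contDiffOn.of_le (by norm_num)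
  have hDc : ∀ i, HasCompactSupport fun x => fderiv ℝ ψ x (b i) := fun i => hc.fderiv_apply ℝ _
  have hDs : ∀ i, tsupport (fun x => fderiv ℝ ψ x (b i)) ⊆ Ω := fun i =>
    (tsupport_fderiv_apply_subset ℝ _).trans hs
  have hint1 : ∀ i, Integrable fun x => u x * fderiv ℝ (fun y => fderiv ℝ ψ y (b i)) x (b i) :=
    fun i => integrable_mul_of_tsupport_subset hΩ hu1.continuousOn
      (((hDψ i).continuous_fderiv (by simp)).clm_apply continuous_const)
      ((hDc i).fderiv_apply ℝ _) ((tsupport_fderiv_apply_subset ℝ _).trans (hDs i))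
  have hint2 : ∀ i, Integrable fun x => fderiv ℝ (fun y => fderiv ℝ u y (b i)) x (b i) * ψ x :=
    fun i => integrable_mul_of_tsupport_subset hΩ
      (((hDu i).continuousOn_fderiv_of_isOpen hΩ le_rfl).clm_apply continuousOn_const)
      hψ.continuous hc hs
  have h1 : ∀ x, u x * Laplacian.laplacian ψ x =
      ∑ i, u x * fderiv ℝ (fun y => fderiv ℝ ψ y (b i)) x (b i) := by
    intro x
    simp_rw [fderiv_fderiv_apply (hψ2 x), laplacian_eq_sum b, Finset.mul_sum]
  have h2 : ∀ x, ∑ i, fderiv ℝ (fun y => fderiv ℝ u y (b i)) x (b i) * ψ x = 0 := by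
    intro x
    rw [← Finset.sum_mul]
    by_cases hx : x ∈ tsupport ψ
    · have hxu := hu x (hs hx)
      simp_rw [fderiv_fderiv_apply hxu.1]
      rw [← laplacian_eq_sum b, hxu.2.self_of_nhds]
      simp
    · rw [image_eq_zero_of_notMem_tsupport hx, mul_zero]
  calc ∫ x, u x * Laplacian.laplacian ψ x
      = ∑ i, ∫ x, u x * fderiv ℝ (fun y => fderiv ℝ ψ y (b i)) x (b i) := by
        simp_rw [h1]
        exact integral_finsetSum _ fun i _ => hint1 i
    _ = ∑ i, ∫ x, fderiv ℝ (fun y => fderiv ℝ u y (b i)) x (b i) * ψ x := by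
        refine Finset.sum_congr rfl fun i _ => ?_
        rw [integral_mul_fderiv_eq_neg hΩ hu1 (hDψ i) (hDc i) (hDs i),
          integral_mul_fderiv_eq_neg hΩ (hDu i) (hψ.of_le (by simp)) hc hs, neg_neg]
    _ = 0 := by
        rw [← integral_finsetSum _ fun i _ => hint2 i]
        simp_rw [h2]
        simp

/-- A divergence-free field is orthogonal to gradients of test functions. -/
lemma integral_fderiv_apply_eq_zero {n : ℕ} {Ω : Set (Euc n)} (hΩ : IsOpen Ω)
    {v : Euc n → Euc n} {ψ : Euc n → ℝ} (hv : ContDiffOn ℝ 1 v Ω)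
    (hdiv : ∀ x ∈ Ω, divergence v x = 0) (hψ : ContDiff ℝ 1 ψ) (hc : HasCompactSupport ψ)
    (hs : tsupport ψ ⊆ Ω) : ∫ x, fderiv ℝ ψ x (v x) = 0 := by
  have hvi : ∀ i, ContDiffOn ℝ 1 (fun x => v x i) Ω := fun i =>
    (EuclideanSpace.proj (𝕜 := ℝ) i).contDiff.comp_contDiffOn hv
  have h1 : ∀ x, fderiv ℝ ψ x (v x) =
      ∑ i, v x i * fderiv ℝ ψ x (EuclideanSpace.single i 1) := by
    intro x
    have hx : v x = ∑ i, v x i • EuclideanSpace.single i (1 : ℝ) := by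
      have := (EuclideanSpace.basisFun (Fin n) ℝ).sum_repr (v x)
      simpa using this.symm
    conv_lhs => rw [hx]
    simp
  have h2 : ∀ i, ∀ x ∈ Ω, fderiv ℝ (fun y => v y i) x (EuclideanSpace.single i 1) =
      (fderiv ℝ v x (EuclideanSpace.single i 1)) i := by
    intro i x hx
    have hd : DifferentiableAt ℝ v x := (hv.contDiffAt (hΩ.mem_nhds hx)).differentiableAt (by simp)
    have : HasFDerivAt (fun y => v y i) _ x :=
      (EuclideanSpace.proj (𝕜 := ℝ) i).hasFDerivAt.comp x hd.hasFDerivAt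
    rw [this.fderiv]
    rfl
  have h3 : ∀ x, ∑ i, fderiv ℝ (fun y => v y i) x (EuclideanSpace.single i 1) * ψ x = 0 := by
    intro x
    rw [← Finset.sum_mul]
    by_cases hx : x ∈ tsupport ψ
    · have := hdiv x (hs hx)
      rw [divergence] at this
      rw [Finset.sum_congr rfl fun i _ => h2 i x (hs hx), this, zero_mul]
    · rw [image_eq_zero_of_notMem_tsupport hx, mul_zero]
  simp_rw [h1]
  rw [integral_finsetSum _ fun i _ => integrable_mul_of_tsupport_subset hΩ (hvi i).continuousOn
    ((hψ.continuous_fderiv (by simp)).clm_apply continuous_const) (hc.fderiv_apply ℝ _)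
    ((tsupport_fderiv_apply_subset ℝ _).trans hs)]
  rw [Finset.sum_congr rfl fun i _ => integral_mul_fderiv_eq_neg hΩ (hvi i) hψ hc hs _,
    Finset.sum_neg_distrib, ← integral_finsetSum _ fun i _ => integrable_mul_of_tsupport_subset hΩ
      (((hvi i).continuousOn_fderiv_of_isOpen hΩ le_rfl).clm_apply continuousOn_const)
      hψ.continuous hc hs]
  simp_rw [h3]
  simp

end Green

/-! ### Vanishing traces -/

section VanishingTrace

variable {m : ℕ} {F : Type} [NormedAddCommGroup F] [NormedSpace ℝ F]

lemma tendsto_lintegral_enorm_of_tendsto_eLpNorm {α : Type*} [MeasurableSpace α] {μ : Measure α}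
    {G : Type*} [NormedAddCommGroup G] {p : ℝ≥0∞} (hp : 1 ≤ p) {S T : Set α} (hST : S ⊆ T)
    (hS : μ S ≠ ⊤) {f : ℕ → α → G} (hf : ∀ k, AEStronglyMeasurable (f k) (μ.restrict S))
    (h : Tendsto (fun k => eLpNorm (f k) p (μ.restrict T)) atTop (𝓝 0)) :
    Tendsto (fun k => ∫⁻ x in S, ‖f k x‖ₑ ∂μ) atTop (𝓝 0) := by
  have h1 : Tendsto (fun k => eLpNorm (f k) p (μ.restrict T) *
      (μ S) ^ (1 / (1 : ℝ≥0∞).toReal - 1 / p.toReal)) atTop (𝓝 0) := by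
    have hfin : (μ S) ^ (1 / (1 : ℝ≥0∞).toReal - 1 / p.toReal) ≠ ⊤ := by
      refine ENNReal.rpow_ne_top_of_nonneg ?_ hS
      rcases eq_or_ne p ⊤ with rfl | hp'
      · simp
      · have : 1 ≤ p.toReal := by
          rw [← ENNReal.toReal_one]
          exact (ENNReal.toReal_le_toReal ENNReal.one_ne_top hp').2 hp
        rw [ENNReal.toReal_one, sub_nonneg]
        exact one_div_le_one_div_of_le one_pos this
    simpa using ENNReal.Tendsto.mul_const h (Or.inr hfin)
  refine tendsto_of_tendsto_of_tendsto_of_le_of_le tendsto_const_nhds h1 (fun _ => zero_le)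
    fun k => ?_
  have h2 := eLpNorm_le_eLpNorm_mul_rpow_measure_univ hp (hf k)
  rw [Measure.restrict_apply_univ, eLpNorm_one_eq_lintegral_enorm] at h2
  refine h2.trans ?_
  gcongr

namespace FlatChart

variable (A : FlatChart m) {Θ : Set (Euc m)} {ℓ : ℝ} {Ω Γ : Set (Euc (m + 1))}

lemma volume_cyl_ne_top (hΘ : volume Θ ≠ ⊤) (t : ℝ) : volume (A.cyl Θ t) ≠ ⊤ := by
  rw [cyl, ← A.measurePreserving_point.measure_preimage_emb A.measurableEmbedding_point,
    A.injective_point.preimage_image, Measure.volume_eq_prod, Measure.prod_prod]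
  exact ENNReal.mul_ne_top hΘ (by simp)

lemma measure_base_ne_top (hΘ : IsOpen Θ) (hΘ' : volume Θ ≠ ⊤) : μHE[m] (A.base Θ) ≠ ⊤ := by
  have := congrArg (fun μ => μ univ) (A.map_base_restrict Θ hΘ.measurableSet)
  simp only [Measure.restrict_apply_univ] at this
  rw [base, ← this, Measure.map_apply A.isometry_base.continuous.measurable MeasurableSet.univ]
  simpa using hΘ'

lemma measurableSet_base (hΘ : IsOpen Θ) : MeasurableSet (A.base Θ) :=
  A.measurableEmbedding_point.measurableSet_image.2
    (hΘ.measurableSet.prod (measurableSet_singleton 0))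

variable {A}

lemma lintegral_base (hΘ : IsOpen Θ) (f : Euc (m + 1) → ℝ≥0∞) :
    ∫⁻ x in A.base Θ, f x ∂μHE[m] = ∫⁻ y in Θ, f (A.point (y, 0)) := by
  rw [base, ← A.map_base_restrict Θ hΘ.measurableSet,
    A.isometry_base.isClosedEmbedding.measurableEmbedding.lintegral_map]

/-- A function with vanishing trace on a flat piece is small in thin cylinders over it. -/
lemma tendsto_lintegral_cyl_of_hasTrace_zero {p : ℝ≥0∞} (hp : 1 ≤ p) (hΩ : IsOpen Ω)
    (hΘ : IsOpen Θ) (hΘ' : volume Θ ≠ ⊤) (hℓ : 0 < ℓ) (hcyl : A.cyl Θ ℓ ⊆ Ω) (hbase : A.base Θ ⊆ Γ)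
    {u : Euc (m + 1) → F} (hu : HasTrace p Ω Γ u 0) :
    Tendsto (fun t : ℝ => ENNReal.ofReal t⁻¹ * ∫⁻ x in A.cyl Θ t, ‖u x‖ₑ) (𝓝[>] 0) (𝓝 0) := by
  obtain ⟨-, hup, U, -, hU, φ, hφ, h1, h2, h3⟩ := hu
  -- The estimate `lintegral_cyl_le` is applied to the approximants from `HasTrace`. In the limit
  -- the base term disappears because the trace is zero.
  have hle : ∀ t ∈ Ioc 0 ℓ, ∫⁻ x in A.cyl Θ t, ‖u x‖ₑ ≤
      ENNReal.ofReal t * ∫⁻ x in A.cyl Θ t, ‖U x‖ₑ := by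
    intro t ht
    have hct : A.cyl Θ t ⊆ Ω := (A.cyl_mono le_rfl ht.2).trans hcyl
    have hrm : volume.restrict (A.cyl Θ t) ≤ volume.restrict Ω := Measure.restrict_mono hct le_rfl
    have hmφ : ∀ k, AEStronglyMeasurable (φ k) (volume.restrict (A.cyl Θ t)) := fun k =>
      (((hφ k).1.continuousOn).aestronglyMeasurable hΩ.measurableSet).mono_measure hrm
    have hmD : ∀ k, AEStronglyMeasurable (fderiv ℝ (φ k)) (volume.restrict (A.cyl Θ t)) := fun k =>
      (((hφ k).1.continuousOn_fderiv_of_isOpen hΩ le_rfl).aestronglyMeasurable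
        hΩ.measurableSet).mono_measure hrm
    have hmb : ∀ k, AEStronglyMeasurable (φ k) (μHE[m].restrict (A.base Θ)) := fun k =>
      ((hφ k).2.mono (hbase.trans subset_union_right)).aestronglyMeasurable
        (A.measurableSet_base hΘ)
    have hmu := hup.1.mono_measure hrm
    have hmU := hU.1.mono_measure hrm
    have e1 := tendsto_lintegral_enorm_of_tendsto_eLpNorm hp hct (A.volume_cyl_ne_top hΘ' t)
      (fun k => (hmφ k).sub hmu) h1
    have e2 := tendsto_lintegral_enorm_of_tendsto_eLpNorm hp hct (A.volume_cyl_ne_top hΘ' t)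
      (fun k => (hmD k).sub hmU) h2
    have e3 := tendsto_lintegral_enorm_of_tendsto_eLpNorm hp hbase (A.measure_base_ne_top hΘ hΘ')
      (fun k => (hmb k).sub aestronglyMeasurable_zero) h3
    have hlim := e1.add (ENNReal.Tendsto.const_mul (a := ENNReal.ofReal t)
      (e3.add (e2.add_const (∫⁻ x in A.cyl Θ t, ‖U x‖ₑ))) (Or.inr ENNReal.ofReal_ne_top))
    rw [zero_add, zero_add, zero_add] at hlim
    refine ge_of_tendsto' hlim fun k => ?_
    have hk := lintegral_cyl_le (A := A) (Θ := Θ) (ℓ := ℓ) hΘ ((hφ k).1.mono hcyl)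
      ((hφ k).2.mono (union_subset_union hcyl hbase)) ht.2
    rw [← A.lintegral_image (Θ ×ˢ Ioo 0 t) fun x => ‖φ k x‖ₑ,
      ← A.lintegral_image (Θ ×ˢ Ioo 0 t) fun x => ‖fderiv ℝ (φ k) x‖ₑ,
      ← lintegral_base hΘ fun x => ‖φ k x‖ₑ] at hk
    calc ∫⁻ x in A.cyl Θ t, ‖u x‖ₑ
        ≤ ∫⁻ x in A.cyl Θ t, (‖(φ k - u) x‖ₑ + ‖φ k x‖ₑ) := by
          refine lintegral_mono fun x => ?_
          calc ‖u x‖ₑ = ‖φ k x - (φ k - u) x‖ₑ := by simp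
            _ ≤ ‖φ k x‖ₑ + ‖(φ k - u) x‖ₑ := enorm_sub_le
            _ = _ := add_comm _ _
      _ = (∫⁻ x in A.cyl Θ t, ‖(φ k - u) x‖ₑ) + ∫⁻ x in A.cyl Θ t, ‖φ k x‖ₑ :=
          lintegral_add_right' _ (hmφ k).enorm
      _ ≤ _ := by
          refine add_le_add le_rfl (hk.trans ?_)
          refine mul_le_mul_right (add_le_add (by simp) ?_) _
          rw [← lintegral_add_left' ((hmD k).sub hmU).enorm]
          refine lintegral_mono fun x => ?_
          calc ‖fderiv ℝ (φ k) x‖ₑ = ‖(fderiv ℝ (φ k) - U) x + U x‖ₑ := by simp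
            _ ≤ _ := by
              rw [← ofReal_norm, ← ofReal_norm, ← ofReal_norm,
                ← ENNReal.ofReal_add (norm_nonneg _) (norm_nonneg _)]
              exact ENNReal.ofReal_le_ofReal (norm_add_le _ _)
  have hUfin : ∫⁻ x in A.cyl Θ ℓ, ‖U x‖ₑ ≠ ⊤ := by
    have hUc : MemLp U p (volume.restrict (A.cyl Θ ℓ)) :=
      hU.mono_measure (Measure.restrict_mono hcyl le_rfl)
    have : IsFiniteMeasure (volume.restrict (A.cyl Θ ℓ)) :=
      ⟨by simpa using (A.volume_cyl_ne_top hΘ' ℓ).lt_top⟩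
    exact (hUc.integrable hp).2.ne
  -- Absolute continuity of the integral improves `O(t)` to `o(t)`, which is what beats the `t⁻¹`
  -- from differentiating a cutoff at height `t`.
  have hU0 : Tendsto (fun t : ℝ => ∫⁻ x in A.cyl Θ t, ‖U x‖ₑ) (𝓝[>] 0) (𝓝 0) := by
    have hvol : Tendsto (fun t : ℝ => (volume.restrict (A.cyl Θ ℓ)) (A.cyl Θ t)) (𝓝[>] 0) (𝓝 0) := by
      have hlim : Tendsto (fun t : ℝ => volume Θ * ENNReal.ofReal t) (𝓝[>] 0) (𝓝 0) := by
        have h0 : Tendsto (fun t : ℝ => ENNReal.ofReal t) (𝓝[>] 0) (𝓝 0) := by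
          have := (ENNReal.continuous_ofReal.tendsto 0).mono_left
            (nhdsWithin_le_nhds (s := Ioi (0 : ℝ)))
          simpa using this
        simpa using ENNReal.Tendsto.const_mul h0 (Or.inr hΘ')
      refine tendsto_of_tendsto_of_tendsto_of_le_of_le tendsto_const_nhds hlim
        (fun _ => zero_le) fun t => (Measure.restrict_apply_le _ _).trans (le_of_eq ?_)
      rw [cyl, ← A.measurePreserving_point.measure_preimage_emb A.measurableEmbedding_point,
        A.injective_point.preimage_image, Measure.volume_eq_prod, Measure.prod_prod,
        Real.volume_Ioo, sub_zero]
    have := tendsto_setLIntegral_zero hUfin hvol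
    refine this.congr' ?_
    filter_upwards [Ioc_mem_nhdsGT hℓ] with t ht
    rw [Measure.restrict_restrict (A.isOpen_cyl hΘ t).measurableSet,
      inter_eq_left.2 (A.cyl_mono le_rfl ht.2)]
  refine tendsto_of_tendsto_of_tendsto_of_le_of_le' tendsto_const_nhds hU0
    (Eventually.of_forall fun _ => zero_le) ?_
  filter_upwards [Ioc_mem_nhdsGT hℓ] with t ht
  calc ENNReal.ofReal t⁻¹ * ∫⁻ x in A.cyl Θ t, ‖u x‖ₑ
      ≤ ENNReal.ofReal t⁻¹ * (ENNReal.ofReal t * ∫⁻ x in A.cyl Θ t, ‖U x‖ₑ) := by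
        gcongr
        exact hle t ht
    _ = _ := by
        rw [← mul_assoc, ← ENNReal.ofReal_mul (inv_nonneg.2 ht.1.le), inv_mul_cancel₀ ht.1.ne',
          ENNReal.ofReal_one, one_mul]

end FlatChart

end VanishingTrace

/-! ### Cutoff functions of the height -/

/-- A smooth cutoff which vanishes on `(-∞, t]` and equals `1` on `[2t, ∞)`. -/
noncomputable def heightCutoff (t s : ℝ) : ℝ := Real.smoothTransition (s * t⁻¹ - 1)

lemma contDiff_heightCutoff (t : ℝ) : ContDiff ℝ ∞ (heightCutoff t) :=
  Real.smoothTransition.contDiff.comp ((contDiff_id.mul contDiff_const).sub contDiff_const)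

lemma contDiff_deriv_heightCutoff (t : ℝ) : ContDiff ℝ ∞ (deriv (heightCutoff t)) :=
  (contDiff_infty_iff_deriv.1 (contDiff_heightCutoff t)).2

lemma heightCutoff_eq_zero {t s : ℝ} (ht : 0 < t) (hs : s ≤ t) : heightCutoff t s = 0 := by
  refine Real.smoothTransition.zero_of_nonpos ?_
  rw [sub_nonpos, ← div_eq_mul_inv, div_le_one ht]
  exact hs

lemma heightCutoff_eq_one {t s : ℝ} (ht : 0 < t) (hs : 2 * t ≤ s) : heightCutoff t s = 1 := by
  refine Real.smoothTransition.one_of_one_le ?_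
  rw [le_sub_iff_add_le, ← div_eq_mul_inv, le_div_iff₀ ht]
  linarith

lemma norm_heightCutoff_le (t s : ℝ) : ‖heightCutoff t s‖ ≤ 1 := by
  rw [heightCutoff, Real.norm_of_nonneg (Real.smoothTransition.nonneg _)]
  exact Real.smoothTransition.le_one _

lemma deriv_heightCutoff_of_lt {t s : ℝ} (ht : 0 < t) (hs : s < t) :
    deriv (heightCutoff t) s = 0 := by
  have : heightCutoff t =ᶠ[𝓝 s] fun _ => 0 := by
    filter_upwards [gt_mem_nhds hs] with r hr using heightCutoff_eq_zero ht hr.le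
  rw [this.deriv_eq, deriv_const]

lemma deriv_heightCutoff_of_gt {t s : ℝ} (ht : 0 < t) (hs : 2 * t < s) :
    deriv (heightCutoff t) s = 0 := by
  have : heightCutoff t =ᶠ[𝓝 s] fun _ => 1 := by
    filter_upwards [lt_mem_nhds hs] with r hr using heightCutoff_eq_one ht hr.le
  rw [this.deriv_eq, deriv_const]

/-- By scaling only `t = 1` matters, and there the derivative is continuous and supported in `[1,
2]`. The constant is thus uniform in `t`. -/
lemma exists_norm_deriv_heightCutoff_le :
    ∃ C, ∀ t, 0 < t → ∀ s, ‖deriv (heightCutoff t) s‖ ≤ C * t⁻¹ := by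
  have hcont : Continuous (deriv (heightCutoff 1)) := (contDiff_deriv_heightCutoff 1).continuous
  obtain ⟨C, hC⟩ := isCompact_Icc.exists_bound_of_continuousOn (s := Icc (1 : ℝ) 2)
    hcont.continuousOn
  have hC0 : 0 ≤ C := (norm_nonneg _).trans (hC 1 (by simp))
  have hC' : ∀ s, ‖deriv (heightCutoff 1) s‖ ≤ C := by
    intro s
    rcases lt_or_ge s 1 with h | h
    · simpa [deriv_heightCutoff_of_lt one_pos h] using hC0
    rcases le_or_gt s 2 with h' | h'
    · exact hC s ⟨h, h'⟩
    · simpa [deriv_heightCutoff_of_gt one_pos (show 2 * 1 < s by linarith)] using hC0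
  refine ⟨C, fun t ht s => ?_⟩
  have h1 : heightCutoff t = fun s => heightCutoff 1 (s * t⁻¹) := by
    ext s; simp [heightCutoff]
  have h2 : HasDerivAt (heightCutoff t) (deriv (heightCutoff 1) (s * t⁻¹) * (1 * t⁻¹)) s := by
    rw [h1]
    exact (((contDiff_heightCutoff 1).differentiable (by simp) _).hasDerivAt).comp s
      ((hasDerivAt_id s).mul_const t⁻¹)
  rw [h2.deriv, norm_mul, one_mul, Real.norm_of_nonneg (inv_nonneg.2 ht.le)]
  exact mul_le_mul_of_nonneg_right (hC' _) (inv_nonneg.2 ht.le)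

/-! ### Product rule for a function of the height times a test function. -/

section HeightProduct

variable {E : Type*} [NormedAddCommGroup E] [InnerProductSpace ℝ E] [FiniteDimensional ℝ E]
  [MeasurableSpace E] [BorelSpace E]

lemma continuous_laplacian {ψ : E → ℝ} (hψ : ContDiff ℝ ∞ ψ) :
    Continuous (Laplacian.laplacian ψ : E → ℝ) := by
  have : (Laplacian.laplacian ψ : E → ℝ) = fun x => ∑ i, fderiv ℝ (fderiv ℝ ψ) x
      (stdOrthonormalBasis ℝ E i) (stdOrthonormalBasis ℝ E i) := by
    ext x; exact laplacian_eq_sum _ x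
  rw [this]
  have h2 : Continuous (fderiv ℝ (fderiv ℝ ψ)) :=
    ((contDiff_infty.1 hψ 2).fderiv_right (m := 1) (by norm_num)).continuous_fderiv (by simp)
  exact continuous_finsetSum _ fun i _ =>
    (h2.clm_apply continuous_const).clm_apply continuous_const

lemma tsupport_laplacian_subset (ψ : E → ℝ) :
    tsupport (Laplacian.laplacian ψ : E → ℝ) ⊆ tsupport ψ := by
  refine closure_minimal (fun x hx => ?_) (isClosed_tsupport ψ)
  by_contra h
  have : ψ =ᶠ[𝓝 x] fun _ => 0 := by
    filter_upwards [(isClosed_tsupport ψ).isOpen_compl.mem_nhds h] with y hy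
      using image_eq_zero_of_notMem_tsupport hy
  refine hx ?_
  rw [(laplacian_congr_nhds this).self_of_nhds, laplacian_const]
  rfl

lemma hasFDerivAt_height_mul {g : ℝ → ℝ} {ψ : E → ℝ} (hg : ContDiff ℝ ∞ g) (hψ : ContDiff ℝ ∞ ψ)
    (e a x : E) : HasFDerivAt (fun x => g (inner ℝ e (x - a)) * ψ x)
      (g (inner ℝ e (x - a)) • fderiv ℝ ψ x + ψ x • deriv g (inner ℝ e (x - a)) • innerSL ℝ e) x := by
  have h1 : HasFDerivAt (fun x => inner ℝ e (x - a)) (innerSL ℝ e) x :=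
    (innerSL ℝ e).hasFDerivAt.comp x ((hasFDerivAt_id x).sub_const a)
  have h2 : HasFDerivAt (fun x => g (inner ℝ e (x - a))) _ x :=
    ((hg.differentiable (by simp) _).hasDerivAt).comp_hasFDerivAt x h1
  exact h2.mul (hψ.differentiable (by simp) x).hasFDerivAt

lemma contDiff_height_mul {g : ℝ → ℝ} {ψ : E → ℝ} (hg : ContDiff ℝ ∞ g) (hψ : ContDiff ℝ ∞ ψ)
    (e a : E) : ContDiff ℝ ∞ fun x => g (inner ℝ e (x - a)) * ψ x :=
  (hg.comp (contDiff_const.inner ℝ (contDiff_id.sub contDiff_const))).mul hψ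

/-- The height is linear with gradient `e`, so the cross term only sees the derivative of `ψ` along
`e`, and the Laplacian of `g` of the height is `g'' ‖e‖² = g''`. -/
lemma laplacian_height_mul {g : ℝ → ℝ} {ψ : E → ℝ} (hg : ContDiff ℝ ∞ g) (hψ : ContDiff ℝ ∞ ψ)
    {e : E} (he : ‖e‖ = 1) (a x : E) :
    Laplacian.laplacian (fun x => g (inner ℝ e (x - a)) * ψ x) x =
      g (inner ℝ e (x - a)) * Laplacian.laplacian ψ x +
        2 * deriv g (inner ℝ e (x - a)) * fderiv ℝ ψ x e +
        deriv (deriv g) (inner ℝ e (x - a)) * ψ x := by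
  set b := stdOrthonormalBasis ℝ E
  have hg' : ContDiff ℝ ∞ (deriv g) := (contDiff_infty_iff_deriv.1 hg).2
  have hDψ : ∀ w, ContDiff ℝ ∞ fun x => fderiv ℝ ψ x w := fun w =>
    (hψ.fderiv_right (by simp)).clm_apply contDiff_const
  have h2 : ∀ w, fderiv ℝ (fderiv ℝ fun x => g (inner ℝ e (x - a)) * ψ x) x w w =
      g (inner ℝ e (x - a)) * fderiv ℝ (fderiv ℝ ψ) x w w +
        2 * deriv g (inner ℝ e (x - a)) * (inner ℝ w e * fderiv ℝ ψ x w) +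
        deriv (deriv g) (inner ℝ e (x - a)) * ψ x * ‖inner ℝ w e‖ ^ 2 := by
    intro w
    rw [← fderiv_fderiv_apply (contDiff_infty.1 (contDiff_height_mul hg hψ e a) 2).contDiffAt]
    have hD : (fun x => fderiv ℝ (fun x => g (inner ℝ e (x - a)) * ψ x) x w) = fun x =>
        g (inner ℝ e (x - a)) * fderiv ℝ ψ x w +
          inner ℝ e w * (deriv g (inner ℝ e (x - a)) * ψ x) := by
      ext x
      rw [(hasFDerivAt_height_mul hg hψ e a x).fderiv]
      simp
      ring
    rw [hD]
    have h3 : HasFDerivAt (fun x => g (inner ℝ e (x - a)) * fderiv ℝ ψ x w +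
          inner ℝ e w * (deriv g (inner ℝ e (x - a)) * ψ x)) _ x :=
      (hasFDerivAt_height_mul hg (hDψ w) e a x).add
        ((hasFDerivAt_height_mul hg' hψ e a x).const_mul (inner ℝ e w))
    rw [h3.fderiv]
    simp only [add_apply, smul_apply, innerSL_apply_apply, smul_eq_mul,
      fderiv_fderiv_apply (contDiff_infty.1 hψ 2).contDiffAt, Real.norm_eq_abs, sq_abs,
      real_inner_comm e w]
    ring
  rw [laplacian_eq_sum b, laplacian_eq_sum b]
  simp_rw [h2, Finset.sum_add_distrib, ← Finset.mul_sum]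
  rw [b.sum_sq_norm_inner_right, he]
  have hsum : ∑ i, inner ℝ (b i) e * fderiv ℝ ψ x (b i) = fderiv ℝ ψ x e := by
    conv_rhs => rw [← b.sum_repr' e]
    simp
  rw [hsum]
  ring

end HeightProduct

/-! ### Extension by zero across a flat piece of the boundary -/

namespace FlatChart

variable {m : ℕ} (A : FlatChart m) {Θ : Set (Euc m)} {ℓ : ℝ} {Ω Γ : Set (Euc (m + 1))}

/-- The last coordinate of a point. -/
noncomputable def height (x : Euc (m + 1)) : ℝ := inner ℝ A.axis (x - A.point 0)

@[simp] lemma height_point (y : Euc m) (s : ℝ) : A.height (A.point (y, s)) = s := by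
  have := A.point_add 0 (y, s)
  rw [zero_add] at this
  rw [height, this, add_sub_cancel_left, axis, LinearIsometryEquiv.inner_map_map]
  simp

lemma continuous_height : Continuous A.height := by
  unfold height; fun_prop

/-- The two-sided cylinder about the flat piece `Θ`. -/
def slab (Θ : Set (Euc m)) (ℓ : ℝ) : Set (Euc (m + 1)) := A.point '' (Θ ×ˢ Ioo (-ℓ) ℓ)

lemma isOpen_slab (hΘ : IsOpen Θ) (ℓ : ℝ) : IsOpen (A.slab Θ ℓ) :=
  A.homeomorph.isOpenMap _ (hΘ.prod isOpen_Ioo)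

variable {A}

lemma mem_cyl_of_mem_slab {x : Euc (m + 1)} (hx : x ∈ A.slab Θ ℓ) {t : ℝ} (h0 : 0 < A.height x)
    (ht : A.height x < t) : x ∈ A.cyl Θ t := by
  obtain ⟨⟨y, s⟩, ⟨hy, -⟩, rfl⟩ := hx
  rw [height_point] at h0 ht
  exact A.point_mem_cyl.2 ⟨hy, h0, ht⟩

lemma height_lt_of_mem_slab {x : Euc (m + 1)} (hx : x ∈ A.slab Θ ℓ) : A.height x < ℓ := by
  obtain ⟨⟨y, s⟩, ⟨-, hs⟩, rfl⟩ := hx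
  rw [height_point]
  exact hs.2

lemma height_pos_of_mem_cyl {x : Euc (m + 1)} (hx : x ∈ A.cyl Θ ℓ) : 0 < A.height x := by
  obtain ⟨⟨y, s⟩, ⟨-, hs⟩, rfl⟩ := hx
  rw [height_point]
  exact hs.1

lemma tsupport_height_mul_subset {g : ℝ → ℝ} {ψ : Euc (m + 1) → ℝ} {t : ℝ} (ht : 0 < t)
    (hg : ∀ s < t, g s = 0) (hs : tsupport ψ ⊆ A.slab Θ ℓ) :
    tsupport (fun x => g (A.height x) * ψ x) ⊆ A.cyl Θ ℓ := by
  intro x hx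
  have hxs : x ∈ A.slab Θ ℓ := hs (tsupport_mul_subset_right hx)
  have hxt : x ∈ {x | t ≤ A.height x} := by
    refine closure_minimal (fun y hy => ?_) (isClosed_le continuous_const A.continuous_height) hx
    by_contra h
    exact hy (by simp [hg _ (not_le.1 h)])
  exact mem_cyl_of_mem_slab hxs (ht.trans_le hxt) (height_lt_of_mem_slab hxs)

/-- The normal component of a divergence-free harmonic field with vanishing trace on a flat piece of
the boundary stays weakly harmonic when extended by zero across it. -/
lemma isWeaklyHarmonicOn_indicator (hΘ : IsOpen Θ) (hℓ : 0 < ℓ)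
    {v : Euc (m + 1) → Euc (m + 1)} (hv : HarmonicOnNhd v (A.cyl Θ ℓ))
    (hdiv : ∀ x ∈ A.cyl Θ ℓ, divergence v x = 0)
    (hint : Integrable ((A.cyl Θ ℓ).indicator fun x => inner ℝ A.axis (v x)))
    (hlim : Tendsto (fun t : ℝ => ENNReal.ofReal t⁻¹ * ∫⁻ x in A.cyl Θ t, ‖v x‖ₑ) (𝓝[>] 0) (𝓝 0)) :
    IsWeaklyHarmonicOn ((A.cyl Θ ℓ).indicator fun x => inner ℝ A.axis (v x)) (A.slab Θ ℓ) := by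
  intro ψ hψ hc hs
  set f := (A.cyl Θ ℓ).indicator fun x => inner ℝ A.axis (v x) with hf
  have hcyl := A.isOpen_cyl hΘ ℓ
  have hv1 : ContDiffOn ℝ 1 v (A.cyl Θ ℓ) := hv.contDiffOn.of_le (by norm_num)
  have hu : HarmonicOnNhd (fun x => inner ℝ A.axis (v x)) (A.cyl Θ ℓ) := fun x hx =>
    (hv x hx).comp_CLM (l := innerSL ℝ A.axis)
  have hΔ := continuous_laplacian hψ
  have hΔs : ∀ x, x ∉ tsupport ψ → Laplacian.laplacian ψ x = 0 := fun x hx =>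
    image_eq_zero_of_notMem_tsupport fun h => hx (tsupport_laplacian_subset ψ h)
  have hΔc : HasCompactSupport (Laplacian.laplacian ψ : Euc (m + 1) → ℝ) :=
    HasCompactSupport.intro hc hΔs
  obtain ⟨B, hB⟩ := hΔc.exists_bound_of_continuous hΔ
  obtain ⟨B₁, hB₁⟩ := (hc.fderiv ℝ).exists_bound_of_continuous (hψ.continuous_fderiv (by simp))
  obtain ⟨C, hC⟩ := exists_norm_deriv_heightCutoff_le
  have hC0 : 0 ≤ C := by simpa using (norm_nonneg _).trans (hC 1 one_pos 0)
  have hB₁0 : 0 ≤ B₁ := (norm_nonneg _).trans (hB₁ 0)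
  -- the truncated integrals converge
  have hconv : Tendsto (fun t => ∫ x, f x * (heightCutoff t (A.height x) * Laplacian.laplacian ψ x))
      (𝓝[>] 0) (𝓝 (∫ x, f x * Laplacian.laplacian ψ x)) := by
    refine tendsto_integral_filter_of_dominated_convergence (fun x => ‖f x‖ * B) ?_ ?_
      (hint.norm.mul_const B) ?_
    · exact Eventually.of_forall fun t => hint.1.mul
        (((contDiff_heightCutoff t).continuous.comp A.continuous_height).mul hΔ).aestronglyMeasurable
    · refine Eventually.of_forall fun t => Eventually.of_forall fun x => ?_
      rw [norm_mul, norm_mul]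
      refine mul_le_mul_of_nonneg_left ?_ (norm_nonneg _)
      calc ‖heightCutoff t (A.height x)‖ * ‖Laplacian.laplacian ψ x‖ ≤ 1 * B :=
            mul_le_mul (norm_heightCutoff_le _ _) (hB x) (norm_nonneg _) zero_le_one
        _ = B := one_mul B
    · refine Eventually.of_forall fun x => ?_
      by_cases hx : x ∈ A.cyl Θ ℓ
      · refine tendsto_const_nhds.congr' ?_
        have h0 := height_pos_of_mem_cyl hx
        filter_upwards [Ioo_mem_nhdsGT (half_pos h0)] with t ht
        rw [heightCutoff_eq_one ht.1 (by linarith [ht.2]), one_mul]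
      · have : f x = 0 := indicator_of_notMem hx _
        simp [this]
  -- the truncated integrals are small
  have hsmall : ∀ t, 0 < t →
      ‖∫ x, f x * (heightCutoff t (A.height x) * Laplacian.laplacian ψ x)‖ₑ ≤
        ENNReal.ofReal (9 * C * B₁) *
          (ENNReal.ofReal (3 * t)⁻¹ * ∫⁻ x in A.cyl Θ (3 * t), ‖v x‖ₑ) := by
    intro t ht
    set g := heightCutoff t with hg
    have hgs : ContDiff ℝ ∞ g := contDiff_heightCutoff t
    have hgs' : ContDiff ℝ ∞ (deriv g) := contDiff_deriv_heightCutoff t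
    have hζs : tsupport (fun x => g (A.height x) * ψ x) ⊆ A.cyl Θ ℓ :=
      tsupport_height_mul_subset ht (fun s hs => heightCutoff_eq_zero ht hs.le) hs
    have hζs' : tsupport (fun x => deriv g (A.height x) * ψ x) ⊆ A.cyl Θ ℓ :=
      tsupport_height_mul_subset ht (fun s hs => deriv_heightCutoff_of_lt ht hs) hs
    have hζ : ContDiff ℝ ∞ fun x => g (A.height x) * ψ x := contDiff_height_mul hgs hψ _ _
    have hζ' : ContDiff ℝ ∞ fun x => deriv g (A.height x) * ψ x := contDiff_height_mul hgs' hψ _ _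
    -- Here `h1` tests harmonicity of the normal component with `g ψ`, and `h2` tests `div v = 0`
    -- with `g' ψ`. Expanding `h1` produces `g'' ψ (a · v)`, of order `t⁻² ‖v‖`, too large for the
    -- available `o(t)` mass of `v`. By `h2` its integral equals minus that of `g' ∇ψ · v`, which is
    -- only of order `t⁻¹ ‖v‖`.
    have h1 := integral_mul_laplacian_eq_zero hcyl hu hζ hc.mul_left hζs
    have h2 := integral_fderiv_apply_eq_zero hcyl hv1 hdiv (hζ'.of_le (by simp)) hc.mul_left hζs'
    have hΔζ : ∀ x, Laplacian.laplacian (fun x => g (A.height x) * ψ x) x =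
        g (A.height x) * Laplacian.laplacian ψ x + 2 * deriv g (A.height x) * fderiv ℝ ψ x A.axis +
          deriv (deriv g) (A.height x) * ψ x := laplacian_height_mul hgs hψ A.norm_axis _
    have hDζ : ∀ x w, fderiv ℝ (fun x => deriv g (A.height x) * ψ x) x w =
        deriv g (A.height x) * fderiv ℝ ψ x w +
          ψ x * (deriv (deriv g) (A.height x) * inner ℝ A.axis w) := by
      intro x w
      have := hasFDerivAt_height_mul hgs' hψ A.axis (A.point 0) x
      refine (congrArg (fun L => L w) this.fderiv).trans ?_
      simp [height]
    -- What is left after the cancellation: only first derivatives of the cutoff occur.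
    set I₃ : Euc (m + 1) → ℝ := fun x => deriv g (A.height x) *
      (2 * inner ℝ A.axis (v x) * fderiv ℝ ψ x A.axis - fderiv ℝ ψ x (v x)) with hI₃
    have hzero : ∀ x, x ∉ A.cyl Θ ℓ →
        g (A.height x) * Laplacian.laplacian ψ x = 0 ∧ deriv g (A.height x) • fderiv ℝ ψ x = 0 := by
      intro x hx
      by_cases hxψ : x ∈ tsupport ψ
      · have hxs := hs hxψ
        have hh : A.height x ≤ 0 := by
          by_contra h
          exact hx (mem_cyl_of_mem_slab hxs (not_le.1 h) (height_lt_of_mem_slab hxs))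
        rw [hg, heightCutoff_eq_zero ht (hh.trans ht.le), deriv_heightCutoff_of_lt ht (hh.trans_lt ht)]
        simp
      · rw [hΔs x hxψ, show fderiv ℝ ψ x = 0 from
          image_eq_zero_of_notMem_tsupport fun h => hxψ (tsupport_fderiv_subset ℝ h)]
        simp
    have hI₁ : Integrable fun x => inner ℝ A.axis (v x) *
        Laplacian.laplacian (fun x => g (A.height x) * ψ x) x :=
      integrable_mul_of_tsupport_subset hcyl hu.contDiffOn.continuousOn (continuous_laplacian hζ)
        (HasCompactSupport.of_support_subset_isCompact (hc.mul_left (f := fun x => g (A.height x)))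
          ((subset_tsupport _).trans (tsupport_laplacian_subset _)))
        ((tsupport_laplacian_subset _).trans hζs)
    have hI₂ : Integrable fun x => fderiv ℝ (fun x => deriv g (A.height x) * ψ x) x (v x) := by
      have hsub : Function.support (fun x => fderiv ℝ (fun x => deriv g (A.height x) * ψ x) x (v x)) ⊆
          tsupport fun x => deriv g (A.height x) * ψ x := by
        refine Subset.trans (fun x hx => ?_) (support_fderiv_subset ℝ)
        intro h
        exact hx (by simp only [h]; rfl)
      refine Continuous.integrable_of_hasCompactSupport (continuous_of_tsupport fun x hx => ?_)
        (HasCompactSupport.of_support_subset_isCompact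
          (hc.mul_left (f := fun x => deriv g (A.height x))) hsub)
      have hx' := hζs' (closure_minimal hsub (isClosed_tsupport _) hx)
      exact (hζ'.continuous_fderiv (by simp)).continuousAt.clm_apply
        (hv1.continuousOn.continuousAt (hcyl.mem_nhds hx'))
    have hI₀ : Integrable fun x => f x * (g (A.height x) * Laplacian.laplacian ψ x) := by
      refine hint.mul_bdd (c := B) ((hgs.continuous.comp
        A.continuous_height).mul hΔ).aestronglyMeasurable (Eventually.of_forall fun x => ?_)
      rw [norm_mul]
      calc ‖g (A.height x)‖ * ‖Laplacian.laplacian ψ x‖ ≤ 1 * B :=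
            mul_le_mul (norm_heightCutoff_le _ _) (hB x) (norm_nonneg _) zero_le_one
        _ = B := one_mul B
    have hsum : ∀ x, f x * (g (A.height x) * Laplacian.laplacian ψ x) =
        inner ℝ A.axis (v x) * Laplacian.laplacian (fun x => g (A.height x) * ψ x) x -
          fderiv ℝ (fun x => deriv g (A.height x) * ψ x) x (v x) - I₃ x := by
      intro x
      rw [hΔζ, hDζ, hI₃]
      by_cases hx : x ∈ A.cyl Θ ℓ
      · rw [hf, indicator_of_mem hx]
        ring
      · have := (hzero x hx).1
        rw [this, hf, indicator_of_notMem hx]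
        ring
    have hI₃i : Integrable I₃ := by
      have := (hI₁.sub hI₂).sub hI₀
      refine this.congr (Eventually.of_forall fun x => ?_)
      simp only [Pi.sub_apply, hsum x]
      ring
    have heq : ∫ x, f x * (g (A.height x) * Laplacian.laplacian ψ x) = -∫ x, I₃ x := by
      simp_rw [hsum]
      have e1 := integral_sub (hI₁.sub hI₂) hI₃i
      have e2 := integral_sub hI₁ hI₂
      simp only [Pi.sub_apply] at e1 e2
      rw [e1, e2, h1, h2]
      simp
    rw [heq, enorm_neg]
    refine (enorm_integral_le_lintegral_enorm _).trans ?_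
    have hbd : ∀ x, ‖I₃ x‖ₑ ≤ (A.cyl Θ (3 * t)).indicator
        (fun x => ENNReal.ofReal (3 * C * B₁ * t⁻¹) * ‖v x‖ₑ) x := by
      intro x
      by_cases hx0 : deriv g (A.height x) • fderiv ℝ ψ x = 0
      · have : I₃ x = deriv g (A.height x) * 0 := by
          have hw : ∀ w, deriv g (A.height x) * fderiv ℝ ψ x w = 0 := fun w =>
            congrArg (fun L => L w) hx0
          rw [hI₃]
          linear_combination (2 * inner ℝ A.axis (v x)) * hw A.axis - hw (v x)
        simp [this]
      have hxc : x ∈ A.cyl Θ ℓ := by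
        by_contra h
        exact hx0 (hzero x h).2
      have hxs : x ∈ A.slab Θ ℓ := by
        obtain ⟨⟨y, s⟩, ⟨hy, hs⟩, rfl⟩ := hxc
        exact ⟨(y, s), ⟨hy, by linarith [hs.1], hs.2⟩, rfl⟩
      have hx3 : A.height x ≤ 2 * t := by
        by_contra h
        exact hx0 (by rw [deriv_heightCutoff_of_gt ht (not_le.1 h), zero_smul])
      -- The derivative of the cutoff lives at heights in `[t, 2 t]`; height `3 t` is taken because
      -- the cylinder is open at the top.
      have hxm : x ∈ A.cyl Θ (3 * t) :=
        mem_cyl_of_mem_slab hxs (height_pos_of_mem_cyl hxc) (by linarith)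
      rw [indicator_of_mem hxm, ← ofReal_norm, ← ofReal_norm, ← ENNReal.ofReal_mul (by positivity)]
      refine ENNReal.ofReal_le_ofReal ?_
      have i1 : ‖(inner ℝ A.axis (v x) : ℝ)‖ ≤ ‖v x‖ := by
        simpa [A.norm_axis] using norm_inner_le_norm (𝕜 := ℝ) A.axis (v x)
      have i2 : ‖fderiv ℝ ψ x A.axis‖ ≤ B₁ := by
        simpa [A.norm_axis] using (fderiv ℝ ψ x).le_of_opNorm_le (hB₁ x) A.axis
      have i3 : ‖fderiv ℝ ψ x (v x)‖ ≤ B₁ * ‖v x‖ := (fderiv ℝ ψ x).le_of_opNorm_le (hB₁ x) _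
      calc ‖I₃ x‖ ≤ (C * t⁻¹) * (2 * ‖v x‖ * B₁ + B₁ * ‖v x‖) := by
            rw [hI₃, norm_mul]
            refine mul_le_mul (hC t ht _) ?_ (norm_nonneg _) (by positivity)
            refine (norm_sub_le _ _).trans (add_le_add ?_ i3)
            rw [norm_mul, norm_mul, Real.norm_of_nonneg (by norm_num : (0 : ℝ) ≤ 2)]
            gcongr
        _ = 3 * C * B₁ * t⁻¹ * ‖v x‖ := by ring
    refine (lintegral_mono hbd).trans (le_of_eq ?_)
    rw [lintegral_indicator (A.isOpen_cyl hΘ _).measurableSet,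
      lintegral_const_mul' _ _ ENNReal.ofReal_ne_top, ← mul_assoc,
      ← ENNReal.ofReal_mul (by positivity)]
    congr 2
    field_simp
    ring
  have hlim3 : Tendsto (fun t : ℝ => ENNReal.ofReal (9 * C * B₁) *
      (ENNReal.ofReal (3 * t)⁻¹ * ∫⁻ x in A.cyl Θ (3 * t), ‖v x‖ₑ)) (𝓝[>] 0) (𝓝 0) := by
    have h3 : Tendsto (fun t : ℝ => 3 * t) (𝓝[>] 0) (𝓝[>] 0) := by
      refine tendsto_nhdsWithin_iff.2 ⟨?_, ?_⟩
      · have : Tendsto (fun t : ℝ => 3 * t) (𝓝 0) (𝓝 (3 * 0)) :=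
          (continuous_const.mul continuous_id).tendsto 0
        rw [mul_zero] at this
        exact this.mono_left nhdsWithin_le_nhds
      · filter_upwards [self_mem_nhdsWithin] with t ht
        exact mul_pos (by norm_num : (0 : ℝ) < 3) ht
    simpa using ENNReal.Tendsto.const_mul (hlim.comp h3) (Or.inr ENNReal.ofReal_ne_top)
  have hfin : ‖∫ x, f x * Laplacian.laplacian ψ x‖ₑ ≤ 0 := by
    refine le_of_tendsto_of_tendsto hconv.enorm hlim3 ?_
    filter_upwards [self_mem_nhdsWithin] with t ht using hsmall t ht
  simpa using hfin

end FlatChart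

/-! ### The normal component vanishes identically -/

namespace FlatChart

variable {m : ℕ} (A : FlatChart m) {Θ : Set (Euc m)} {ℓ : ℝ} {Ω Γ : Set (Euc (m + 1))}

lemma volume_height_eq_zero : volume {x : Euc (m + 1) | A.height x = 0} = 0 := by
  rw [← A.measurePreserving_point.measure_preimage
    (measurableSet_eq_fun A.continuous_height.measurable measurable_const).nullMeasurableSet]
  have : A.point ⁻¹' {x | A.height x = 0} = univ ×ˢ {0} := by
    ext ⟨y, s⟩
    simp
  rw [this, Measure.volume_eq_prod, Measure.prod_prod]
  simp

lemma height_point_sub (y : Euc m) (s t : ℝ) : A.point (y, s - t) = A.point (y, s) - t • A.axis := by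
  rw [sub_eq_add_neg, point_add_axis, neg_smul, sub_eq_add_neg]

variable {A}

/-- Discontinuities inside the slab can only lie on the hyperplane of height zero, a null set: below
it the extension is locally zero, above it locally equal to `u`. -/
lemma ae_continuousAt_indicator (hΘ : IsOpen Θ) {u : Euc (m + 1) → ℝ}
    (hu : ContinuousOn u (A.cyl Θ ℓ)) :
    ∀ᵐ x, x ∈ A.slab Θ ℓ → ContinuousAt ((A.cyl Θ ℓ).indicator u) x := by
  have h0 : ∀ᵐ x : Euc (m + 1), A.height x ≠ 0 := by
    rw [ae_iff]
    simpa using A.volume_height_eq_zero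
  filter_upwards [h0] with x hx hxs
  rcases lt_or_gt_of_ne hx with h | h
  · have : (A.cyl Θ ℓ).indicator u =ᶠ[𝓝 x] fun _ => 0 := by
      filter_upwards [A.continuous_height.continuousAt.eventually_lt_const h] with y hy
      exact indicator_of_notMem (fun hyc => (height_pos_of_mem_cyl hyc).not_gt hy) _
    exact continuousAt_const.congr this.symm
  · have hxc := mem_cyl_of_mem_slab hxs h (height_lt_of_mem_slab hxs)
    have hn := (A.isOpen_cyl hΘ ℓ).mem_nhds hxc
    refine (hu.continuousAt hn).congr ?_
    filter_upwards [hn] with y hy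
    rw [indicator_of_mem hy]

/-- The zero extension of the normal component vanishes near the flat piece. -/
lemma exists_isOpen_eqOn_zero (hΘ : IsOpen Θ) (hne : Θ.Nonempty) (hℓ : 0 < ℓ)
    {u : Euc (m + 1) → ℝ} (hu : ContinuousOn u (A.cyl Θ ℓ))
    (hint : Integrable ((A.cyl Θ ℓ).indicator u)) (hb : Bornology.IsBounded (A.cyl Θ ℓ))
    (hw : IsWeaklyHarmonicOn ((A.cyl Θ ℓ).indicator u) (A.slab Θ ℓ)) :
    ∃ W, IsOpen W ∧ W ⊆ A.cyl Θ ℓ ∧ W.Nonempty ∧ EqOn u 0 W := by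
  obtain ⟨y₀, hy₀⟩ := hne
  have hG := kernelGradientMass_nonneg (Euc (m + 1))
  have hp0 : A.point (y₀, 0) ∈ A.slab Θ ℓ := ⟨(y₀, 0), ⟨hy₀, by simpa using hℓ⟩, rfl⟩
  obtain ⟨R, hR, hRs⟩ :=
    Metric.nhds_basis_closedBall.mem_iff.1 ((A.isOpen_slab hΘ ℓ).mem_nhds hp0)
  -- Chosen so that a centre at depth `δ` below the base point still has a ball of radius `R / 2`
  -- inside the slab, while points within `2 δ` of it, some of them above the base, satisfy the
  -- reach condition of unique continuation.
  set δ := R / (128 * (kernelGradientMass (Euc (m + 1)) + 1)) with hδ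
  have hδ0 : 0 < δ := by positivity
  have hδR : 128 * (kernelGradientMass (Euc (m + 1)) + 1) * δ = R := by
    rw [hδ]; field_simp
  have hδR' : 128 * δ ≤ R := by nlinarith
  set a := A.point (y₀, 0) - δ • A.axis with ha
  have hap : dist a (A.point (y₀, 0)) = δ := by
    rw [ha, dist_eq_norm, sub_sub_cancel_left, norm_neg, norm_smul, A.norm_axis, mul_one,
      Real.norm_of_nonneg hδ0.le]
  have hha : A.height a = -δ := by
    rw [ha, ← height_point_sub, height_point, zero_sub]
  have hc : HasCompactSupport ((A.cyl Θ ℓ).indicator u) :=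
    HasCompactSupport.of_support_subset_isCompact hb.isCompact_closure
      (support_indicator_subset.trans subset_closure)
  -- The height of `a` is `-δ`, so this whole ball lies strictly below the base, where the extension
  -- is zero by construction.
  have hz : ∀ x ∈ Metric.ball a δ, (A.cyl Θ ℓ).indicator u x = 0 := by
    intro x hx
    refine indicator_of_notMem (fun hxc => (height_pos_of_mem_cyl hxc).not_ge ?_) _
    have h1 : A.height x = A.height a + inner ℝ A.axis (x - a) := by
      rw [height, height, ← inner_add_right]
      congr 1
      abel
    have h2 : inner ℝ A.axis (x - a) ≤ ‖x - a‖ := by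
      simpa [A.norm_axis] using real_inner_le_norm A.axis (x - a)
    rw [Metric.mem_ball, dist_eq_norm] at hx
    linarith
  refine ⟨Metric.ball (A.point (y₀, 0)) δ ∩ A.cyl Θ ℓ,
    Metric.isOpen_ball.inter (A.isOpen_cyl hΘ ℓ), inter_subset_right, ?_, ?_⟩
  · set s := min (δ / 2) (ℓ / 2) with hs
    have hs0 : 0 < s := by positivity
    refine ⟨A.point (y₀, s), ?_, A.point_mem_cyl.2 ⟨hy₀, hs0, ?_⟩⟩
    · have := A.point_add_axis y₀ 0 s
      rw [zero_add] at this
      rw [this, Metric.mem_ball, dist_eq_norm, add_sub_cancel_left, norm_smul, A.norm_axis, mul_one,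
        Real.norm_of_nonneg hs0.le]
      linarith [min_le_left (δ / 2) (ℓ / 2)]
    · linarith [min_le_right (δ / 2) (ℓ / 2)]
  · rintro x ⟨hxb, hxc⟩
    rw [Metric.mem_ball] at hxb
    have hcx : ContinuousAt ((A.cyl Θ ℓ).indicator u) x := by
      have hn := (A.isOpen_cyl hΘ ℓ).mem_nhds hxc
      refine (hu.continuousAt hn).congr ?_
      filter_upwards [hn] with y hy
      rw [indicator_of_mem hy]
    have hxa : dist x a < 2 * δ := by
      have := dist_triangle x (A.point (y₀, 0)) a
      rw [dist_comm (A.point (y₀, 0)) a, hap] at this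
      linarith
    have := hw.eq_zero_of_ae_eq_zero hint hc (ae_continuousAt_indicator hΘ hu) (a := a) (R := R / 2)
      ((Metric.closedBall_subset_closedBall' (by rw [hap]; linarith)).trans hRs) hδ0
      (Eventually.of_forall hz) (by nlinarith) hcx
    rwa [indicator_of_mem hxc] at this

/-- A divergence-free harmonic field with vanishing trace on a flat piece of the boundary has no
component in the direction normal to that piece. -/
theorem inner_axis_eq_zero {p : ℝ≥0∞} (hp : 1 ≤ p) (hΩ : IsOpen Ω) (hb : Bornology.IsBounded Ω)
    (hconn : IsPreconnected Ω) (hΘ : IsOpen Θ) (hne : Θ.Nonempty) (hΘ' : volume Θ ≠ ⊤) (hℓ : 0 < ℓ)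
    (hcyl : A.cyl Θ ℓ ⊆ Ω) (hbase : A.base Θ ⊆ Γ) {v : Euc (m + 1) → Euc (m + 1)}
    (hv : HarmonicOnNhd v Ω) (hdiv : ∀ x ∈ Ω, divergence v x = 0) (htr : HasTrace p Ω Γ v 0) :
    ∀ x ∈ Ω, inner ℝ A.axis (v x) = 0 := by
  have hvol : volume Ω ≠ ⊤ := hb.measure_lt_top.ne
  have : IsFiniteMeasure (volume.restrict Ω) := ⟨by simpa using hvol.lt_top⟩
  set u : Euc (m + 1) → ℝ := fun x => inner ℝ A.axis (v x) with hu
  have huint : IntegrableOn u Ω := (htr.2.1.integrable hp).const_inner A.axis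
  have hharm : HarmonicOnNhd u Ω := fun x hx => (hv x hx).comp_CLM (l := innerSL ℝ A.axis)
  have huc : ContinuousOn u Ω := hharm.contDiffOn.continuousOn
  have hcylo := A.isOpen_cyl hΘ ℓ
  have hint : Integrable ((A.cyl Θ ℓ).indicator u) :=
    (integrable_indicator_iff hcylo.measurableSet).2 (huint.mono_set hcyl)
  obtain ⟨W, hW, hWc, hWne, hWu⟩ := exists_isOpen_eqOn_zero hΘ hne hℓ (huc.mono hcyl) hint
    (hb.subset hcyl) (isWeaklyHarmonicOn_indicator hΘ hℓ (fun x hx => hv x (hcyl hx))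
      (fun x hx => hdiv x (hcyl hx)) hint
      (tendsto_lintegral_cyl_of_hasTrace_zero hp hΩ hΘ hΘ' hℓ hcyl hbase htr))
  have hind : EqOn (Ω.indicator u) u Ω := fun x hx => indicator_of_mem hx _
  -- Second use of unique continuation, now inside `Ω`. Extending by zero outside `Ω` only serves to
  -- obtain a compactly supported integrable function on the whole space.
  have hweak : IsWeaklyHarmonicOn (Ω.indicator u) Ω := by
    intro ψ hψ hc hs
    rw [← integral_mul_laplacian_eq_zero hΩ hharm hψ hc hs]
    refine integral_congr_ae (Eventually.of_forall fun x => ?_)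
    by_cases hx : x ∈ Ω
    · simp only [hind hx]
    · have : Laplacian.laplacian ψ x = 0 := by
        by_contra h
        exact hx (hs (tsupport_laplacian_subset ψ (subset_closure h)))
      simp only [this, mul_zero]
  have := hweak.eqOn_zero ((integrable_indicator_iff hΩ.measurableSet).2 huint)
    (HasCompactSupport.of_support_subset_isCompact hb.isCompact_closure
      (support_indicator_subset.trans subset_closure)) hΩ hconn (huc.congr hind) hW
    (hWc.trans hcyl) hWne (fun x hx => (hind (hcyl (hWc hx))).trans (hWu hx))
  exact fun x hx => (hind hx).symm.trans (this hx)

end FlatChart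

/-! ### Weak derivatives of continuously differentiable functions -/

section WeakDerivative

variable {n : ℕ} {F : Type} [NormedAddCommGroup F] [NormedSpace ℝ F] {Ω : Set (Euc n)}

lemma LocallyIntegrableOn.integrable_smul_of_tsupport_subset {G : Type*} [NormedAddCommGroup G]
    [NormedSpace ℝ G] {f : Euc n → G} (hf : LocallyIntegrableOn f Ω) {φ : Euc n → ℝ}
    (hφ : Continuous φ) (hc : HasCompactSupport φ) (hs : tsupport φ ⊆ Ω) :
    Integrable fun x => φ x • f x := by
  have h1 := (hf.integrableOn_compact_subset hs hc).continuousOn_smul hφ.continuousOn hc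
  refine (integrableOn_iff_integrable_of_support_subset fun x hx => ?_).1 h1
  exact subset_closure fun h0 => hx (by simp [h0])

lemma setIntegral_smul_eq_integral {G : Type*} [NormedAddCommGroup G] [NormedSpace ℝ G]
    {f : Euc n → G} {φ : Euc n → ℝ} (hs : tsupport φ ⊆ Ω) :
    ∫ x in Ω, φ x • f x = ∫ x, φ x • f x := by
  refine setIntegral_eq_integral_of_forall_compl_eq_zero fun x hx => ?_
  rw [image_eq_zero_of_notMem_tsupport fun h => hx (hs h), zero_smul]

lemma hasWeakFDeriv_fderiv (hΩ : IsOpen Ω) {u : Euc n → F} (hu : ContDiffOn ℝ 1 u Ω) :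
    HasWeakFDeriv Ω u (fderiv ℝ u) := by
  have hl : LocallyIntegrableOn u Ω := hu.continuousOn.locallyIntegrableOn hΩ.measurableSet
  have hDc : ContinuousOn (fderiv ℝ u) Ω := hu.continuousOn_fderiv_of_isOpen hΩ le_rfl
  refine ⟨hl, hDc.locallyIntegrableOn hΩ.measurableSet, fun φ hφ hc hs e => ?_⟩
  have hDe : LocallyIntegrableOn (fun x => fderiv ℝ u x e) Ω :=
    (hDc.clm_apply continuousOn_const).locallyIntegrableOn hΩ.measurableSet
  have hφe : Continuous fun x => fderiv ℝ φ x e :=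
    (hφ.continuous_fderiv (by simp)).clm_apply continuous_const
  have hφs : tsupport (fun x => fderiv ℝ φ x e) ⊆ Ω := (tsupport_fderiv_apply_subset ℝ e).trans hs
  rw [setIntegral_smul_eq_integral (f := u) hφs,
    setIntegral_smul_eq_integral (f := fun x => fderiv ℝ u x e) hs,
    integral_smul_fderiv_eq_neg_fderiv_smul_of_integrable, neg_neg]
  · exact LocallyIntegrableOn.integrable_smul_of_tsupport_subset hl hφe (hc.fderiv_apply ℝ e) hφs
  · exact LocallyIntegrableOn.integrable_smul_of_tsupport_subset hDe hφ.continuous hc hs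
  · exact LocallyIntegrableOn.integrable_smul_of_tsupport_subset hl hφ.continuous hc hs
  · exact fun x _ => hφ.differentiable (by simp) x
  · exact fun x hx => (hu.contDiffAt (hΩ.mem_nhds (hs hx))).differentiableAt (by simp)

/-- Weak derivatives are unique. -/
lemma HasWeakFDeriv.ae_eq [CompleteSpace F] (hΩ : IsOpen Ω) {u : Euc n → F}
    {U U' : Euc n → Euc n →L[ℝ] F} (h : HasWeakFDeriv Ω u U) (h' : HasWeakFDeriv Ω u U') :
    U =ᵐ[volume.restrict Ω] U' := by
  have hl : LocallyIntegrableOn (U - U') Ω := h.2.1.sub h'.2.1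
  have key : ∀ᵐ x : Euc n, x ∈ Ω → (U - U') x = 0 := by
    refine hΩ.ae_eq_zero_of_integral_contDiff_smul_eq_zero hl fun φ hφ hc hs => ?_
    have hi := LocallyIntegrableOn.integrable_smul_of_tsupport_subset h.2.1 hφ.continuous hc hs
    have hi' := LocallyIntegrableOn.integrable_smul_of_tsupport_subset h'.2.1 hφ.continuous hc hs
    have hd := LocallyIntegrableOn.integrable_smul_of_tsupport_subset hl hφ.continuous hc hs
    -- The weak derivative is operator valued, while its definition tests one direction at a time;
    -- evaluating the integral at `e` reconciles the two.
    refine ContinuousLinearMap.ext fun e => ?_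
    have h1 := h.2.2 φ hφ hc hs e
    rw [h'.2.2 φ hφ hc hs e, neg_inj, setIntegral_smul_eq_integral (f := fun x => U x e) hs,
      setIntegral_smul_eq_integral (f := fun x => U' x e) hs] at h1
    rw [ContinuousLinearMap.integral_apply hd]
    simp only [Pi.sub_apply, smul_apply, sub_apply, smul_sub, zero_apply]
    have h2 := integral_sub (hi.apply_continuousLinearMap e) (hi'.apply_continuousLinearMap e)
    simp only [smul_apply] at h2
    rw [h2, h1, sub_self]
  rw [EventuallyEq, ae_restrict_iff' hΩ.measurableSet]
  filter_upwards [key] with x hx hxΩ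
  exact sub_eq_zero.1 (hx hxΩ)

lemma HasWeakFDeriv.ae_eq_fderiv [CompleteSpace F] (hΩ : IsOpen Ω) {u : Euc n → F}
    {U : Euc n → Euc n →L[ℝ] F} (h : HasWeakFDeriv Ω u U) (hu : ContDiffOn ℝ 1 u Ω) :
    U =ᵐ[volume.restrict Ω] fderiv ℝ u :=
  h.ae_eq hΩ (hasWeakFDeriv_fderiv hΩ hu)

/-- A weak derivative may be changed on a null set. -/
lemma HasWeakFDeriv.congr (hΩ : IsOpen Ω) {u u' : Euc n → F} {U : Euc n → Euc n →L[ℝ] F}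
    (h : HasWeakFDeriv Ω u U) (hu : u =ᵐ[volume.restrict Ω] u')
    (hu' : ContinuousOn u' Ω) : HasWeakFDeriv Ω u' U := by
  refine ⟨hu'.locallyIntegrableOn hΩ.measurableSet, h.2.1, fun φ hφ hc hs e => ?_⟩
  rw [← h.2.2 φ hφ hc hs e]
  refine integral_congr_ae ?_
  filter_upwards [hu] with x hx
  rw [hx]

/-- The first and second classical derivatives of a smooth `W^{2,p}` function are in `L^p`. -/
lemma MemW2.memLp_fderiv [CompleteSpace F] {p : ℝ≥0∞} (hΩ : IsOpen Ω) {u : Euc n → F}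
    (h : MemW2 p Ω u) (hu : ContDiffOn ℝ 2 u Ω) :
    MemLp (fderiv ℝ u) p (volume.restrict Ω) ∧
      MemLp (fderiv ℝ (fderiv ℝ u)) p (volume.restrict Ω) := by
  obtain ⟨-, U, hU, hUp, U₂, hU₂, hU₂p⟩ := h
  have h1 : U =ᵐ[volume.restrict Ω] fderiv ℝ u := hU.ae_eq_fderiv hΩ (hu.of_le (by norm_num))
  have hD : ContDiffOn ℝ 1 (fderiv ℝ u) Ω := hu.fderiv_of_isOpen hΩ (by norm_num)
  have h2 : U₂ =ᵐ[volume.restrict Ω] fderiv ℝ (fderiv ℝ u) :=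
    (hU₂.congr hΩ h1 hD.continuousOn).ae_eq_fderiv hΩ hD
  exact ⟨(memLp_congr_ae h1).1 hUp, (memLp_congr_ae h2).1 hU₂p⟩

end WeakDerivative

/-! ### Traces on flat pieces -/

namespace FlatChart

variable {m : ℕ} {A : FlatChart m} {Θ : Set (Euc m)} {ℓ : ℝ} {Ω Γ : Set (Euc (m + 1))}
  {F : Type} [NormedAddCommGroup F] [NormedSpace ℝ F]

/-- If a continuous linear functional annihilates a function in `Ω`, it annihilates its trace. -/
theorem ae_apply_eq_zero_of_hasTrace [CompleteSpace F] {p : ℝ≥0∞} (hp : 1 ≤ p) (hp' : p ≠ ⊤)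
    (hΩ : IsOpen Ω) (hΘ : IsOpen Θ) (hℓ : 0 < ℓ) (hcyl : A.cyl Θ ℓ ⊆ Ω) (hbase : A.base Θ ⊆ Γ)
    {u g : Euc (m + 1) → F} (hu : ContDiffOn ℝ 1 u Ω) (htr : HasTrace p Ω Γ u g) (L : F →L[ℝ] ℝ)
    (hL : ∀ x ∈ Ω, L (u x) = 0) : ∀ᵐ x ∂(μHE[m].restrict (A.base Θ)), L (g x) = 0 := by
  obtain ⟨hg, -, U, hU, -, φ, hφ, h1, h2, h3⟩ := htr
  have hUu := hU.ae_eq_fderiv hΩ hu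
  have hcylo := A.isOpen_cyl hΘ ℓ
  have hbm := A.measurableSet_base hΘ
  have hrm : volume.restrict (A.cyl Θ ℓ) ≤ volume.restrict Ω := Measure.restrict_mono hcyl le_rfl
  have hrb : μHE[m].restrict (A.base Θ) ≤ μHE[m].restrict Γ := Measure.restrict_mono hbase le_rfl
  have hLu : ∀ x ∈ Ω, L ∘L fderiv ℝ u x = 0 := by
    intro x hx
    have hd := (hu.contDiffAt (hΩ.mem_nhds hx)).differentiableAt (by simp)
    have hc : HasFDerivAt (fun y => L (u y)) (L ∘L fderiv ℝ u x) x :=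
      L.hasFDerivAt.comp x hd.hasFDerivAt
    have h0 : (fun y => L (u y)) =ᶠ[𝓝 x] fun _ => 0 := by
      filter_upwards [hΩ.mem_nhds hx] with y hy using hL y hy
    exact (hc.congr_of_eventuallyEq h0.symm).unique (hasFDerivAt_const 0 x)
  -- These functions tend to `L ∘ u = 0` in `W^{1,p}` of the cylinder, so the trace inequality sends
  -- their base values to zero. Those base values also tend to `L ∘ g`.
  set w : ℕ → Euc (m + 1) → ℝ := fun k x => L (φ k x) with hw
  have hwd : ∀ k, ContDiffOn ℝ 1 (w k) (A.cyl Θ ℓ) := fun k =>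
    L.contDiff.comp_contDiffOn ((hφ k).1.mono hcyl)
  have hwc : ∀ k, ContinuousOn (w k) (A.cyl Θ ℓ ∪ A.base Θ) := fun k =>
    L.continuous.comp_continuousOn ((hφ k).2.mono (union_subset_union hcyl hbase))
  have hw1 : ∀ k, eLpNorm (w k) p (volume.restrict (A.cyl Θ ℓ)) ≤
      ENNReal.ofReal ‖L‖ * eLpNorm (φ k - u) p (volume.restrict Ω) := by
    intro k
    refine (eLpNorm_le_mul_eLpNorm_of_ae_le_mul ?_ p).trans
      (mul_le_mul_right (eLpNorm_mono_measure _ hrm) _)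
    filter_upwards [ae_restrict_mem hcylo.measurableSet] with x hx
    have : w k x = L ((φ k - u) x) := by
      rw [Pi.sub_apply, map_sub, hL x (hcyl hx), sub_zero]
    rw [this]
    exact L.le_opNorm _
  have hw2 : ∀ k, eLpNorm (fderiv ℝ (w k)) p (volume.restrict (A.cyl Θ ℓ)) ≤
      ENNReal.ofReal ‖L‖ * eLpNorm (fderiv ℝ (φ k) - U) p (volume.restrict Ω) := by
    intro k
    refine (eLpNorm_le_mul_eLpNorm_of_ae_le_mul ?_ p).trans
      (mul_le_mul_right (eLpNorm_mono_measure _ hrm) _)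
    filter_upwards [ae_restrict_mem hcylo.measurableSet, ae_mono hrm hUu] with x hx hUx
    have hd := ((hφ k).1.contDiffAt (hΩ.mem_nhds (hcyl hx))).differentiableAt (by simp)
    have hc : HasFDerivAt (w k) (L ∘L fderiv ℝ (φ k) x) x := L.hasFDerivAt.comp x hd.hasFDerivAt
    have : fderiv ℝ (w k) x = L ∘L ((fderiv ℝ (φ k) - U) x) := by
      rw [hc.fderiv, Pi.sub_apply, hUx, ContinuousLinearMap.comp_sub, hLu x (hcyl hx), sub_zero]
    rw [this]
    exact L.opNorm_comp_le _
  have hw3 : ∀ k, eLpNorm (fun x => L ((φ k - g) x)) p (μHE[m].restrict (A.base Θ)) ≤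
      ENNReal.ofReal ‖L‖ * eLpNorm (φ k - g) p (μHE[m].restrict Γ) := by
    intro k
    refine (eLpNorm_le_mul_eLpNorm_of_ae_le_mul (Eventually.of_forall fun x => ?_) p).trans
      (mul_le_mul_right (eLpNorm_mono_measure _ hrb) _)
    exact L.le_opNorm _
  have hgm : AEStronglyMeasurable (fun x => L (g x)) (μHE[m].restrict (A.base Θ)) :=
    L.continuous.comp_aestronglyMeasurable (hg.1.mono_measure hrb)
  have hwm : ∀ k, AEStronglyMeasurable (w k) (μHE[m].restrict (A.base Θ)) := fun k =>
    ((hwc k).mono subset_union_right).aestronglyMeasurable hbm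
  have hbound : ∀ k, eLpNorm (fun x => L (g x)) p (μHE[m].restrict (A.base Θ)) ≤
      ENNReal.ofReal (ℓ ^ (-p.toReal⁻¹)) *
        (ENNReal.ofReal ‖L‖ * eLpNorm (φ k - u) p (volume.restrict Ω) + ENNReal.ofReal ℓ *
          (ENNReal.ofReal ‖L‖ * eLpNorm (fderiv ℝ (φ k) - U) p (volume.restrict Ω))) +
        ENNReal.ofReal ‖L‖ * eLpNorm (φ k - g) p (μHE[m].restrict Γ) := by
    intro k
    have heq : (fun x => L (g x)) = w k - fun x => L ((φ k - g) x) := by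
      funext x
      simp [hw]
    have hm : AEStronglyMeasurable (fun x => L ((φ k - g) x)) (μHE[m].restrict (A.base Θ)) := by
      have := (hwm k).sub hgm
      refine this.congr (Eventually.of_forall fun x => ?_)
      simp [hw]
    conv_lhs => rw [heq]
    refine (eLpNorm_sub_le (hwm k) hm hp).trans (add_le_add ?_ (hw3 k))
    refine (A.eLpNorm_base_le hΘ (hwd k) (hwc k) hℓ hp hp').trans ?_
    gcongr
    · exact hw1 k
    · exact hw2 k
  have hlim : Tendsto (fun k => ENNReal.ofReal (ℓ ^ (-p.toReal⁻¹)) *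
        (ENNReal.ofReal ‖L‖ * eLpNorm (φ k - u) p (volume.restrict Ω) + ENNReal.ofReal ℓ *
          (ENNReal.ofReal ‖L‖ * eLpNorm (fderiv ℝ (φ k) - U) p (volume.restrict Ω))) +
        ENNReal.ofReal ‖L‖ * eLpNorm (φ k - g) p (μHE[m].restrict Γ)) atTop (𝓝 0) := by
    have hz : ENNReal.ofReal (ℓ ^ (-p.toReal⁻¹)) * (ENNReal.ofReal ‖L‖ * 0 + ENNReal.ofReal ℓ *
        (ENNReal.ofReal ‖L‖ * 0)) + ENNReal.ofReal ‖L‖ * 0 = 0 := by simp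
    rw [← hz]
    have hof : ∀ {f : ℕ → ℝ≥0∞} {a : ℝ≥0∞} (c : ℝ), Tendsto f atTop (𝓝 a) →
        Tendsto (fun k => ENNReal.ofReal c * f k) atTop (𝓝 (ENNReal.ofReal c * a)) :=
      fun c hf => ENNReal.Tendsto.const_mul hf (Or.inr ENNReal.ofReal_ne_top)
    exact (hof _ ((hof _ h1).add (hof _ (hof _ h2)))).add (hof _ h3)
  have hzero := le_antisymm (ge_of_tendsto' hlim hbound) zero_le
  exact (eLpNorm_eq_zero_iff hgm (by positivity)).1 hzero

end FlatChart

/-! ### Translations and completeness in `L^p` -/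

section LpLimits

/-- Translations are continuous in `L^p`. -/
lemma tendsto_eLpNorm_translate_sub {n : ℕ} {F : Type*} [NormedAddCommGroup F] {p : ℝ≥0∞}
    (hp : 1 ≤ p) (hp' : p ≠ ⊤) {f : Euc n → F} (hf : MemLp f p) :
    Tendsto (fun z : Euc n => eLpNorm (fun x => f (x + z) - f x) p volume) (𝓝 0) (𝓝 0) := by
  have : Fact (1 ≤ p) := ⟨hp⟩
  have : Fact (p ≠ ⊤) := ⟨hp'⟩
  have hmp : ∀ z : Euc n, MemLp (fun x => f (z +ᵥ x)) p := fun z =>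
    hf.comp_measurePreserving (measurePreserving_vadd z volume)
  have h1 : Tendsto (fun z : Euc n => (hmp z).toLp (fun x => f (z +ᵥ x))) (𝓝 0)
      (𝓝 (hf.toLp f)) := by
    -- Translations act continuously on `L^p` for finite `p`; the limit is the orbit map at the zero
    -- shift.
    have h2 : Continuous fun z : Euc n => DomAddAct.mk z +ᵥ hf.toLp f :=
      (DomAddAct.continuous_mk).vadd continuous_const
    have h3 := h2.tendsto 0
    have h4 : (DomAddAct.mk (0 : Euc n) +ᵥ hf.toLp f) = hf.toLp f := by
      rw [DomAddAct.mk_vadd_toLp]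
      simp
    rwa [h4] at h3
  refine ((Lp.tendsto_Lp_iff_tendsto_eLpNorm'' _ hmp f hf).1 h1).congr fun z => ?_
  refine eLpNorm_congr_ae (Eventually.of_forall fun x => ?_)
  simp [add_comm]

/-- The bound `a k + a j` is the form the trace inequality takes when two approximants are compared
through their common limit in `Ω`. -/
lemma exists_tendsto_eLpNorm_of_cauchy {α : Type*} [MeasurableSpace α] {μ : Measure α}
    {F : Type*} [NormedAddCommGroup F] [CompleteSpace F] {p : ℝ≥0∞} (hp : 1 ≤ p)
    {f : ℕ → α → F} (hf : ∀ k, MemLp (f k) p μ) {a : ℕ → ℝ≥0∞} (ha : Tendsto a atTop (𝓝 0))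
    (h : ∀ k j, eLpNorm (f k - f j) p μ ≤ a k + a j) :
    ∃ g, MemLp g p μ ∧ Tendsto (fun k => eLpNorm (f k - g) p μ) atTop (𝓝 0) := by
  have : Fact (1 ≤ p) := ⟨hp⟩
  have hc : CauchySeq fun k => (hf k).toLp (f k) := by
    rw [Lp.cauchySeq_Lp_iff_cauchySeq_eLpNorm]
    have h0 : Tendsto (fun q : ℕ × ℕ => a q.1 + a q.2) atTop (𝓝 0) := by
      rw [← prod_atTop_atTop_eq]
      simpa using (ha.comp tendsto_fst).add (ha.comp tendsto_snd)
    refine tendsto_of_tendsto_of_tendsto_of_le_of_le tendsto_const_nhds h0 (fun _ => zero_le)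
      fun q => le_trans (le_of_eq (eLpNorm_congr_ae ?_)) (h q.1 q.2)
    exact (hf q.1).coeFn_toLp.sub (hf q.2).coeFn_toLp
  obtain ⟨g, hg⟩ := cauchySeq_tendsto_of_complete hc
  refine ⟨g, Lp.memLp g, ((Lp.tendsto_Lp_iff_tendsto_eLpNorm' _ _).1 hg).congr fun k => ?_⟩
  exact eLpNorm_congr_ae ((hf k).coeFn_toLp.sub EventuallyEq.rfl)

lemma eLpNorm_lt_top_of_sub {α : Type*} [MeasurableSpace α] {μ : Measure α} {F : Type*}
    [NormedAddCommGroup F] {p : ℝ≥0∞} {f g : α → F} (hf : AEStronglyMeasurable f μ)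
    (hg : MemLp g p μ) (h : eLpNorm (f - g) p μ ≠ ⊤) : eLpNorm f p μ < ⊤ := by
  have h1 : MemLp (f - g) p μ := ⟨hf.sub hg.1, h.lt_top⟩
  have h2 := h1.add hg
  rw [sub_add_cancel] at h2
  exact h2.2

lemma eLpNorm_sub_le_add {α : Type*} [MeasurableSpace α] {μ : Measure α} {F : Type*}
    [NormedAddCommGroup F] {p : ℝ≥0∞} (hp : 1 ≤ p) {f f' g : α → F}
    (hf : AEStronglyMeasurable f μ) (hf' : AEStronglyMeasurable f' μ)
    (hg : AEStronglyMeasurable g μ) :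
    eLpNorm (f - f') p μ ≤ eLpNorm (f - g) p μ + eLpNorm (f' - g) p μ := by
  rw [← sub_sub_sub_cancel_right f f' g]
  exact eLpNorm_sub_le (hf.sub hg) (hf'.sub hg) hp

end LpLimits

/-! ### Traces as limits of approximants continuous up to a flat piece. -/

namespace FlatChart

variable {m : ℕ} {A : FlatChart m} {Θ : Set (Euc m)} {ℓ : ℝ} {Ω : Set (Euc (m + 1))}
  {F : Type} [NormedAddCommGroup F] [NormedSpace ℝ F]

lemma eLpNorm_base_lt_top {p : ℝ≥0∞} (hp : 1 ≤ p) (hp' : p ≠ ⊤) (hΘ : IsOpen Θ) (hℓ : 0 < ℓ)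
    (hcyl : A.cyl Θ ℓ ⊆ Ω) {w : Euc (m + 1) → F} (hw : ContDiffOn ℝ 1 w Ω)
    (hwc : ContinuousOn w (Ω ∪ A.base Θ)) (h1 : eLpNorm w p (volume.restrict Ω) < ⊤)
    (h2 : eLpNorm (fderiv ℝ w) p (volume.restrict Ω) < ⊤) :
    eLpNorm w p (μHE[m].restrict (A.base Θ)) < ⊤ := by
  have hrm : volume.restrict (A.cyl Θ ℓ) ≤ volume.restrict Ω := Measure.restrict_mono hcyl le_rfl
  refine (A.eLpNorm_base_le hΘ (hw.mono hcyl) (hwc.mono (union_subset_union_left _ hcyl)) hℓ hp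
    hp').trans_lt ?_
  exact ENNReal.mul_lt_top ENNReal.ofReal_lt_top (ENNReal.add_lt_top.2
    ⟨(eLpNorm_mono_measure _ hrm).trans_lt h1,
      ENNReal.mul_lt_top ENNReal.ofReal_lt_top ((eLpNorm_mono_measure _ hrm).trans_lt h2)⟩)

lemma eLpNorm_base_sub_le {p : ℝ≥0∞} (hp : 1 ≤ p) (hp' : p ≠ ⊤) (hΩ : IsOpen Ω) (hΘ : IsOpen Θ)
    (hℓ : 0 < ℓ) (hcyl : A.cyl Θ ℓ ⊆ Ω) {w w' : Euc (m + 1) → F} (hw : ContDiffOn ℝ 1 w Ω)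
    (hwc : ContinuousOn w (Ω ∪ A.base Θ)) (hw' : ContDiffOn ℝ 1 w' Ω)
    (hwc' : ContinuousOn w' (Ω ∪ A.base Θ)) :
    eLpNorm (w - w') p (μHE[m].restrict (A.base Θ)) ≤ ENNReal.ofReal (ℓ ^ (-p.toReal⁻¹)) *
      (eLpNorm (w - w') p (volume.restrict Ω) +
        ENNReal.ofReal ℓ * eLpNorm (fderiv ℝ w - fderiv ℝ w') p (volume.restrict Ω)) := by
  have hrm : volume.restrict (A.cyl Θ ℓ) ≤ volume.restrict Ω := Measure.restrict_mono hcyl le_rfl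
  refine (A.eLpNorm_base_le hΘ ((hw.sub hw').mono hcyl)
    ((hwc.sub hwc').mono (union_subset_union_left _ hcyl)) hℓ hp hp').trans ?_
  have h2 : eLpNorm (fderiv ℝ (w - w')) p (volume.restrict (A.cyl Θ ℓ)) ≤
      eLpNorm (fderiv ℝ w - fderiv ℝ w') p (volume.restrict Ω) := by
    refine (eLpNorm_mono_measure _ hrm).trans (le_of_eq (eLpNorm_congr_ae ?_))
    filter_upwards [ae_restrict_mem hΩ.measurableSet] with x hx
    rw [fderiv_sub ((hw.contDiffAt (hΩ.mem_nhds hx)).differentiableAt (by simp))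
      ((hw'.contDiffAt (hΩ.mem_nhds hx)).differentiableAt (by simp)), Pi.sub_apply]
  exact mul_le_mul_right (add_le_add (eLpNorm_mono_measure _ hrm) (mul_le_mul_right h2 _)) _

/-- A function which can be approximated by functions continuous up to a flat piece of the boundary
has a trace there. -/
lemma exists_hasTrace_of_tendsto [CompleteSpace F] {p : ℝ≥0∞} (hp : 1 ≤ p) (hp' : p ≠ ⊤)
    (hΩ : IsOpen Ω) (hΘ : IsOpen Θ) (hℓ : 0 < ℓ) (hcyl : A.cyl Θ ℓ ⊆ Ω)
    {u : Euc (m + 1) → F} (hu : ContDiffOn ℝ 1 u Ω)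
    (hup : MemLp u p (volume.restrict Ω)) (hDup : MemLp (fderiv ℝ u) p (volume.restrict Ω))
    {φ : ℕ → Euc (m + 1) → F} (hφ : ∀ k, ContDiffOn ℝ 1 (φ k) Ω ∧ ContinuousOn (φ k) (Ω ∪ A.base Θ))
    (h1 : Tendsto (fun k => eLpNorm (φ k - u) p (volume.restrict Ω)) atTop (𝓝 0))
    (h2 : Tendsto (fun k => eLpNorm (fderiv ℝ (φ k) - fderiv ℝ u) p (volume.restrict Ω))
      atTop (𝓝 0))
    (hne : ∀ k, eLpNorm (φ k - u) p (volume.restrict Ω) ≠ ⊤ ∧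
      eLpNorm (fderiv ℝ (φ k) - fderiv ℝ u) p (volume.restrict Ω) ≠ ⊤) :
    ∃ g, HasTrace p Ω (A.base Θ) u g := by
  have hmφ : ∀ k, AEStronglyMeasurable (φ k) (volume.restrict Ω) := fun k =>
    (hφ k).1.continuousOn.aestronglyMeasurable hΩ.measurableSet
  have hmDφ : ∀ k, AEStronglyMeasurable (fderiv ℝ (φ k)) (volume.restrict Ω) := fun k =>
    ((hφ k).1.continuousOn_fderiv_of_isOpen hΩ le_rfl).aestronglyMeasurable hΩ.measurableSet
  set C := ENNReal.ofReal (ℓ ^ (-p.toReal⁻¹)) with hC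
  set a : ℕ → ℝ≥0∞ := fun k => C * (eLpNorm (φ k - u) p (volume.restrict Ω) +
    ENNReal.ofReal ℓ * eLpNorm (fderiv ℝ (φ k) - fderiv ℝ u) p (volume.restrict Ω)) with ha
  have ha0 : Tendsto a atTop (𝓝 0) := by
    have hz : C * (0 + ENNReal.ofReal ℓ * 0) = 0 := by simp
    rw [← hz]
    exact ENNReal.Tendsto.const_mul (h1.add (ENNReal.Tendsto.const_mul h2
      (Or.inr ENNReal.ofReal_ne_top))) (Or.inr ENNReal.ofReal_ne_top)
  have hφp : ∀ k, MemLp (φ k) p (μHE[m].restrict (A.base Θ)) := fun k =>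
    ⟨((hφ k).2.mono subset_union_right).aestronglyMeasurable (A.measurableSet_base hΘ),
      eLpNorm_base_lt_top hp hp' hΘ hℓ hcyl (hφ k).1 (hφ k).2
        (eLpNorm_lt_top_of_sub (hmφ k) hup (hne k).1)
        (eLpNorm_lt_top_of_sub (hmDφ k) hDup (hne k).2)⟩
  have hcau : ∀ k j, eLpNorm (φ k - φ j) p (μHE[m].restrict (A.base Θ)) ≤ a k + a j := by
    intro k j
    refine (eLpNorm_base_sub_le hp hp' hΩ hΘ hℓ hcyl (hφ k).1 (hφ k).2 (hφ j).1
      (hφ j).2).trans ?_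
    refine (mul_le_mul_right (add_le_add (eLpNorm_sub_le_add hp (hmφ k) (hmφ j) hup.1)
      (mul_le_mul_right (eLpNorm_sub_le_add hp (hmDφ k) (hmDφ j) hDup.1) _)) _).trans (le_of_eq ?_)
    simp only [ha]
    ring
  obtain ⟨g, hg, hgt⟩ := exists_tendsto_eLpNorm_of_cauchy hp hφp ha0 hcau
  exact ⟨g, hg, hup, fderiv ℝ u, hasWeakFDeriv_fderiv hΩ hu, hDup, φ, hφ, h1, h2, hgt⟩

end FlatChart

/-! ### Existence of traces on flat pieces -/

lemma norm_one_sub_heightCutoff_le (t s : ℝ) : ‖1 - heightCutoff t s‖ ≤ 1 := by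
  unfold heightCutoff
  rw [Real.norm_of_nonneg (sub_nonneg.2 (Real.smoothTransition.le_one _))]
  exact sub_le_self _ (Real.smoothTransition.nonneg _)

namespace FlatChart

variable {m : ℕ} {A : FlatChart m} {Θ : Set (Euc m)} {ℓ ε : ℝ} {Ω : Set (Euc (m + 1))}
  {F : Type} [NormedAddCommGroup F] [NormedSpace ℝ F] {u : Euc (m + 1) → F}

lemma hasFDerivAt_height (x : Euc (m + 1)) : HasFDerivAt A.height (innerSL ℝ A.axis) x :=
  (innerSL ℝ A.axis).hasFDerivAt.comp x ((hasFDerivAt_id x).sub_const _)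

lemma add_smul_axis_mem_cyl {x : Euc (m + 1)} (hx : x ∈ A.cyl Θ ℓ ∪ A.base Θ) {t : ℝ} (ht : 0 < t)
    (h : A.height x + t < ℓ) : x + t • A.axis ∈ A.cyl Θ ℓ := by
  rcases hx with ⟨⟨y, s⟩, ⟨hy, hs⟩, rfl⟩ | ⟨⟨y, s⟩, ⟨hy, hs⟩, rfl⟩
  · rw [height_point] at h
    rw [← point_add_axis]
    exact A.point_mem_cyl.2 ⟨hy, by linarith [hs.1], h⟩
  · rw [height_point] at h
    rw [← point_add_axis]
    obtain rfl : s = 0 := hs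
    exact A.point_mem_cyl.2 ⟨hy, by linarith, h⟩

/-- The change of `u` under an inward shift by `ε`, cut off away from the flat piece. -/
noncomputable def inwardIncrement (A : FlatChart m) (Θ : Set (Euc m)) (ℓ ε : ℝ)
    (u : Euc (m + 1) → F) : Euc (m + 1) → F :=
  (A.cyl Θ ℓ ∪ A.base Θ).indicator fun x =>
    (1 - heightCutoff (ℓ / 3) (A.height x)) • (u (x + ε • A.axis) - u x)

/-- The cutoff removes heights above `2 ℓ / 3`. Nothing is cut off laterally, hence the closure of
`Θ`. -/
lemma tsupport_inwardIncrement_subset (hℓ : 0 < ℓ) :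
    tsupport (inwardIncrement A Θ ℓ ε u) ⊆ A.point '' (closure Θ ×ˢ Icc 0 (2 * (ℓ / 3))) := by
  refine closure_minimal (fun x hx => ?_)
    (A.homeomorph.isClosedMap _ (isClosed_closure.prod isClosed_Icc))
  have hm : x ∈ A.cyl Θ ℓ ∪ A.base Θ := mem_of_indicator_ne_zero hx
  have hne : A.height x ≤ 2 * (ℓ / 3) := by
    by_contra! h
    refine hx ?_
    rw [inwardIncrement, indicator_of_mem hm, heightCutoff_eq_one (by positivity) h.le, sub_self,
      zero_smul]
  rcases hm with ⟨⟨y, s⟩, ⟨hy, hs⟩, rfl⟩ | ⟨⟨y, s⟩, ⟨hy, hs⟩, rfl⟩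
  · rw [height_point] at hne
    exact ⟨(y, s), ⟨subset_closure hy, hs.1.le, hne⟩, rfl⟩
  · rw [height_point] at hne
    exact ⟨(y, s), ⟨subset_closure hy, (show s = 0 from hs).ge, hne⟩, rfl⟩

lemma inwardIncrement_eventuallyEq (hΘ : IsOpen Θ) {x : Euc (m + 1)} (hx : x ∈ A.cyl Θ ℓ) :
    inwardIncrement A Θ ℓ ε u =ᶠ[𝓝 x] fun x =>
      (1 - heightCutoff (ℓ / 3) (A.height x)) • (u (x + ε • A.axis) - u x) := by
  filter_upwards [(A.isOpen_cyl hΘ ℓ).mem_nhds hx] with z hz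
  rw [inwardIncrement, indicator_of_mem (mem_union_left _ hz)]

/-- Above the base, `Ω` coincides with the cylinder `A.cyl Θ ℓ`, which reaches the complement of `Ω`
along its lateral surface and its base. -/
def IsInletCylinder (A : FlatChart m) (Θ : Set (Euc m)) (ℓ : ℝ) (Ω : Set (Euc (m + 1))) : Prop :=
  A.cyl Θ ℓ ⊆ Ω ∧
    ∀ y ∈ closure Θ, ∀ s ∈ Ico 0 ℓ, A.point (y, s) ∈ Ω → A.point (y, s) ∈ A.cyl Θ ℓ

/-- The support may touch the lateral surface, but those points are not in `Ω`. This is why no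
lateral cutoff and no regularity of the cross-section are needed. -/
lemma IsInletCylinder.mem_cyl_of_mem_tsupport (h : IsInletCylinder A Θ ℓ Ω) (hℓ : 0 < ℓ)
    {x : Euc (m + 1)} (hx : x ∈ Ω) (hxs : x ∈ tsupport (inwardIncrement A Θ ℓ ε u)) :
    x ∈ A.cyl Θ ℓ ∧ A.height x ≤ 2 * (ℓ / 3) := by
  obtain ⟨⟨y, s⟩, ⟨hy, hs⟩, rfl⟩ := tsupport_inwardIncrement_subset hℓ hxs
  rw [height_point]
  exact ⟨h.2 y hy s ⟨hs.1, by linarith [hs.2]⟩ hx, hs.2⟩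

lemma hasFDerivAt_inwardIncrement (hΩ : IsOpen Ω) (hΘ : IsOpen Θ) (hcyl : A.cyl Θ ℓ ⊆ Ω)
    (hu : ContDiffOn ℝ 1 u Ω) {x : Euc (m + 1)} (hx : x ∈ A.cyl Θ ℓ)
    (hxε : x + ε • A.axis ∈ A.cyl Θ ℓ) :
    HasFDerivAt (inwardIncrement A Θ ℓ ε u)
      ((1 - heightCutoff (ℓ / 3) (A.height x)) •
          (fderiv ℝ u (x + ε • A.axis) - fderiv ℝ u x) +
        (-(deriv (heightCutoff (ℓ / 3)) (A.height x) • innerSL ℝ A.axis)).smulRight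
          (u (x + ε • A.axis) - u x)) x := by
  have hd : ∀ z ∈ A.cyl Θ ℓ, HasFDerivAt u (fderiv ℝ u z) z := fun z hz =>
    ((hu.contDiffAt (hΩ.mem_nhds (hcyl hz))).differentiableAt (by simp)).hasFDerivAt
  have h1 : HasFDerivAt (fun z => u (z + ε • A.axis) - u z)
      (fderiv ℝ u (x + ε • A.axis) - fderiv ℝ u x) x :=
    (((hd _ hxε).comp x ((hasFDerivAt_id x).add_const _)).congr_fderiv
      (ContinuousLinearMap.comp_id _)).sub (hd x hx)
  have h2 : HasDerivAt (heightCutoff (ℓ / 3)) (deriv (heightCutoff (ℓ / 3)) (A.height x))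
      (A.height x) := ((contDiff_heightCutoff _).differentiable (by simp) _).hasDerivAt
  have h3 : HasFDerivAt (fun z => 1 - heightCutoff (ℓ / 3) (A.height z))
      (-(deriv (heightCutoff (ℓ / 3)) (A.height x) • innerSL ℝ A.axis)) x :=
    (h2.comp_hasFDerivAt x (hasFDerivAt_height x)).const_sub 1
  exact (h3.smul h1).congr_of_eventuallyEq (inwardIncrement_eventuallyEq hΘ hx)

/-- At a point of its support in `Ω` the height is at most `2 ℓ / 3`, so a shift by `ε < ℓ / 3`
stays in the cylinder and the defining formula is smooth enough. Elsewhere the increment vanishes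
locally. -/
lemma IsInletCylinder.contDiffOn_inwardIncrement (h : IsInletCylinder A Θ ℓ Ω) (hℓ : 0 < ℓ)
    (hΩ : IsOpen Ω) (hΘ : IsOpen Θ) (hε : 0 < ε) (hε' : ε < ℓ / 3) (hu : ContDiffOn ℝ 1 u Ω) :
    ContDiffOn ℝ 1 (inwardIncrement A Θ ℓ ε u) Ω := by
  intro x hx
  refine ContDiffAt.contDiffWithinAt ?_
  by_cases hxs : x ∈ tsupport (inwardIncrement A Θ ℓ ε u)
  · obtain ⟨hxc, hxh⟩ := h.mem_cyl_of_mem_tsupport hℓ hx hxs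
    have hxε := add_smul_axis_mem_cyl (mem_union_left _ hxc) hε (by linarith)
    refine ContDiffAt.congr_of_eventuallyEq ?_ (inwardIncrement_eventuallyEq hΘ hxc)
    have hc : ∀ z ∈ A.cyl Θ ℓ, ContDiffAt ℝ 1 u z := fun z hz =>
      hu.contDiffAt (hΩ.mem_nhds (h.1 hz))
    have hh : ContDiff ℝ 1 A.height := contDiff_const.inner ℝ (contDiff_id.sub contDiff_const)
    have hsh : ContDiffAt ℝ 1 (fun z => u (z + ε • A.axis)) x :=
      (hc _ hxε).comp x (contDiff_id.add contDiff_const).contDiffAt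
    exact (contDiff_const.sub (((contDiff_infty.1 (contDiff_heightCutoff _) 1)).comp hh)).contDiffAt.smul
      (hsh.sub (hc x hxc))
  · exact contDiffAt_const.congr_of_eventuallyEq (notMem_tsupport_iff_eventuallyEq.1 hxs)

/-- The inward shift of `u` is continuous up to the base. -/
lemma IsInletCylinder.continuousOn_add_inwardIncrement (h : IsInletCylinder A Θ ℓ Ω) (hℓ : 0 < ℓ)
    (hΩ : IsOpen Ω) (hΘ : IsOpen Θ)
    (hloc : ∀ x ∈ A.base Θ, ∀ᶠ z in 𝓝 x, z ∈ Ω → 0 < A.height z)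
    (hε : 0 < ε) (hε' : ε < ℓ / 3) (hu : ContDiffOn ℝ 1 u Ω) :
    ContinuousOn (u + inwardIncrement A Θ ℓ ε u) (Ω ∪ A.base Θ) := by
  rintro x (hx | hx)
  · refine ContinuousAt.continuousWithinAt ?_
    exact (hu.continuousOn.continuousAt (hΩ.mem_nhds hx)).add
      ((h.contDiffOn_inwardIncrement hℓ hΩ hΘ hε hε' hu).continuousOn.continuousAt
        (hΩ.mem_nhds hx))
  · have hx0 : A.height x = 0 := by
      obtain ⟨⟨y, s⟩, ⟨-, hs⟩, rfl⟩ := hx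
      rw [height_point]
      exact hs
    -- Below height `ℓ / 3` the cutoff is inactive and the sum is exactly the shifted function,
    -- whose values near the base are values of `u` inside `Ω`.
    have hval : ∀ z ∈ A.cyl Θ ℓ ∪ A.base Θ, A.height z < ℓ / 3 →
        (u + inwardIncrement A Θ ℓ ε u) z = u (z + ε • A.axis) := by
      intro z hz hzl
      rw [Pi.add_apply, inwardIncrement, indicator_of_mem hz,
        heightCutoff_eq_zero (by positivity) hzl.le, sub_zero, one_smul, add_sub_cancel]
    have hxs : x ∈ A.slab Θ ℓ := by
      obtain ⟨⟨y, s⟩, ⟨hy, hs⟩, rfl⟩ := hx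
      obtain rfl : s = 0 := hs
      exact ⟨(y, 0), ⟨hy, by simpa using hℓ⟩, rfl⟩
    have hsh : ContinuousWithinAt (fun z => u (z + ε • A.axis)) (Ω ∪ A.base Θ) x := by
      have hxε : x + ε • A.axis ∈ A.cyl Θ ℓ :=
        add_smul_axis_mem_cyl (mem_union_right _ hx) hε (by linarith)
      have hc : ContinuousAt u (x + ε • A.axis) :=
        hu.continuousOn.continuousAt (hΩ.mem_nhds (h.1 hxε))
      have ha : ContinuousAt (fun z => z + ε • A.axis) x := by fun_prop
      exact (ContinuousAt.comp (f := fun z => z + ε • A.axis) hc ha).continuousWithinAt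
    refine hsh.congr_of_eventuallyEq ?_ (hval x (mem_union_right _ hx) (by linarith))
    filter_upwards [self_mem_nhdsWithin, mem_nhdsWithin_of_mem_nhds (hloc x hx),
      mem_nhdsWithin_of_mem_nhds ((A.isOpen_slab hΘ ℓ).mem_nhds hxs),
      mem_nhdsWithin_of_mem_nhds (A.continuous_height.continuousAt.eventually_lt_const
        (show A.height x < ℓ / 3 by linarith))] with z hz hzl hzs hzh
    refine hval z ?_ hzh
    rcases hz with hz | hz
    · exact mem_union_left _ (mem_cyl_of_mem_slab hzs (hzl hz) (by linarith))
    · exact mem_union_right _ hz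

/-- The comparison is with a translation difference of the zero extension from the cylinder. That
extension is only in `L^p`, which suffices for continuity of translations. -/
lemma IsInletCylinder.norm_inwardIncrement_le (h : IsInletCylinder A Θ ℓ Ω) (hℓ : 0 < ℓ)
    (hε : 0 < ε) (hε' : ε < ℓ / 3) {x : Euc (m + 1)} (hx : x ∈ Ω) :
    ‖inwardIncrement A Θ ℓ ε u x‖ ≤
      ‖(A.cyl Θ ℓ).indicator u (x + ε • A.axis) - (A.cyl Θ ℓ).indicator u x‖ := by
  by_cases hxs : x ∈ tsupport (inwardIncrement A Θ ℓ ε u)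
  · obtain ⟨hxc, hxh⟩ := h.mem_cyl_of_mem_tsupport hℓ hx hxs
    rw [indicator_of_mem hxc, inwardIncrement, indicator_of_mem (mem_union_left _ hxc),
      indicator_of_mem (add_smul_axis_mem_cyl (mem_union_left _ hxc) hε (by linarith)), norm_smul]
    exact mul_le_of_le_one_left (norm_nonneg _) (norm_one_sub_heightCutoff_le _ _)
  · rw [image_eq_zero_of_notMem_tsupport hxs, norm_zero]
    exact norm_nonneg _

/-- The product rule gives a translation difference of the derivative, plus the difference of `u`
times the derivative of the cutoff. The cutoff scale `ℓ / 3` is fixed, so `K` does not depend on the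
shift. -/
lemma IsInletCylinder.norm_fderiv_inwardIncrement_le (h : IsInletCylinder A Θ ℓ Ω) (hℓ : 0 < ℓ)
    (hΩ : IsOpen Ω) (hΘ : IsOpen Θ) (hε : 0 < ε) (hε' : ε < ℓ / 3) (hu : ContDiffOn ℝ 1 u Ω) {K : ℝ}
    (hK : ∀ s, ‖deriv (heightCutoff (ℓ / 3)) s‖ ≤ K) {x : Euc (m + 1)} (hx : x ∈ Ω) :
    ‖fderiv ℝ (inwardIncrement A Θ ℓ ε u) x‖ ≤
      ‖(A.cyl Θ ℓ).indicator (fderiv ℝ u) (x + ε • A.axis) -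
        (A.cyl Θ ℓ).indicator (fderiv ℝ u) x‖ +
      K * ‖(A.cyl Θ ℓ).indicator u (x + ε • A.axis) - (A.cyl Θ ℓ).indicator u x‖ := by
  have hK0 : 0 ≤ K := (norm_nonneg _).trans (hK 0)
  by_cases hxs : x ∈ tsupport (inwardIncrement A Θ ℓ ε u)
  · obtain ⟨hxc, hxh⟩ := h.mem_cyl_of_mem_tsupport hℓ hx hxs
    have hxε := add_smul_axis_mem_cyl (mem_union_left _ hxc) hε (by linarith)
    rw [(hasFDerivAt_inwardIncrement hΩ hΘ h.1 hu hxc hxε).fderiv, indicator_of_mem hxc,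
      indicator_of_mem hxε, indicator_of_mem hxc, indicator_of_mem hxε]
    refine (norm_add_le _ _).trans (add_le_add ?_ ?_)
    · rw [norm_smul]
      exact mul_le_of_le_one_left (norm_nonneg _) (norm_one_sub_heightCutoff_le _ _)
    · rw [ContinuousLinearMap.norm_smulRight_apply, norm_neg, norm_smul, innerSL_apply_norm,
        A.norm_axis, mul_one]
      exact mul_le_mul_of_nonneg_right (hK _) (norm_nonneg _)
  · have : inwardIncrement A Θ ℓ ε u =ᶠ[𝓝 x] fun _ => 0 := notMem_tsupport_iff_eventuallyEq.1 hxs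
    rw [this.fderiv_eq, fderiv_fun_const, Pi.zero_apply, norm_zero]
    positivity

lemma IsInletCylinder.eLpNorm_add_inwardIncrement_sub_le {p : ℝ≥0∞} (h : IsInletCylinder A Θ ℓ Ω)
    (hℓ : 0 < ℓ) (hΩ : IsOpen Ω) (hε : 0 < ε) (hε' : ε < ℓ / 3) :
    eLpNorm (u + inwardIncrement A Θ ℓ ε u - u) p (volume.restrict Ω) ≤
      eLpNorm (fun x => (A.cyl Θ ℓ).indicator u (x + ε • A.axis) - (A.cyl Θ ℓ).indicator u x) p
        volume := by
  rw [add_sub_cancel_left]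
  refine le_trans (eLpNorm_mono_ae ?_) (eLpNorm_restrict_le _ p volume Ω)
  filter_upwards [ae_restrict_mem hΩ.measurableSet] with x hx
  exact h.norm_inwardIncrement_le hℓ hε hε' hx

lemma IsInletCylinder.eLpNorm_fderiv_add_inwardIncrement_sub_le {p : ℝ≥0∞} (hp : 1 ≤ p)
    (h : IsInletCylinder A Θ ℓ Ω) (hℓ : 0 < ℓ) (hΩ : IsOpen Ω) (hΘ : IsOpen Θ) (hε : 0 < ε)
    (hε' : ε < ℓ / 3) (hu : ContDiffOn ℝ 1 u Ω) {K : ℝ}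
    (hK : ∀ s, ‖deriv (heightCutoff (ℓ / 3)) s‖ ≤ K)
    (hd1 : AEStronglyMeasurable (fun x => (A.cyl Θ ℓ).indicator u (x + ε • A.axis) -
      (A.cyl Θ ℓ).indicator u x) volume)
    (hd2 : AEStronglyMeasurable (fun x => (A.cyl Θ ℓ).indicator (fderiv ℝ u) (x + ε • A.axis) -
      (A.cyl Θ ℓ).indicator (fderiv ℝ u) x) volume) :
    eLpNorm (fderiv ℝ (u + inwardIncrement A Θ ℓ ε u) - fderiv ℝ u) p (volume.restrict Ω) ≤
      eLpNorm (fun x => (A.cyl Θ ℓ).indicator (fderiv ℝ u) (x + ε • A.axis) -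
        (A.cyl Θ ℓ).indicator (fderiv ℝ u) x) p volume +
      ENNReal.ofReal ‖K‖ * eLpNorm (fun x => (A.cyl Θ ℓ).indicator u (x + ε • A.axis) -
        (A.cyl Θ ℓ).indicator u x) p volume := by
  refine le_trans (eLpNorm_mono_ae_real (g := fun x =>
    ‖(A.cyl Θ ℓ).indicator (fderiv ℝ u) (x + ε • A.axis) -
      (A.cyl Θ ℓ).indicator (fderiv ℝ u) x‖ +
    K * ‖(A.cyl Θ ℓ).indicator u (x + ε • A.axis) - (A.cyl Θ ℓ).indicator u x‖) ?_)
    ((eLpNorm_restrict_le _ p volume Ω).trans ?_)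
  · filter_upwards [ae_restrict_mem hΩ.measurableSet] with x hx
    rw [Pi.sub_apply, fderiv_add ((hu.contDiffAt (hΩ.mem_nhds hx)).differentiableAt (by simp))
      (((h.contDiffOn_inwardIncrement hℓ hΩ hΘ hε hε' hu).contDiffAt
        (hΩ.mem_nhds hx)).differentiableAt (by simp)), add_sub_cancel_left]
    exact h.norm_fderiv_inwardIncrement_le hℓ hΩ hΘ hε hε' hu hK hx
  · refine (eLpNorm_add_le hd2.norm (hd1.norm.const_mul K) hp).trans ?_
    refine add_le_add (le_of_eq (eLpNorm_norm _)) ?_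
    refine eLpNorm_le_mul_eLpNorm_of_ae_le_mul (Eventually.of_forall fun x => ?_) p
    rw [norm_mul, norm_norm]

lemma memLp_translate_sub {n : ℕ} {G : Type*} [NormedAddCommGroup G] {p : ℝ≥0∞} {f : Euc n → G}
    (hf : MemLp f p) (z : Euc n) : MemLp (fun x => f (x + z) - f x) p :=
  (hf.comp_measurePreserving (measurePreserving_add_right volume z)).sub hf

lemma memLp_indicator_of_subset {n : ℕ} {G : Type*} [NormedAddCommGroup G] {p : ℝ≥0∞}
    {f : Euc n → G} {S T : Set (Euc n)} (hS : MeasurableSet S) (hST : S ⊆ T)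
    (hf : MemLp f p (volume.restrict T)) : MemLp (S.indicator f) p :=
  (memLp_indicator_iff_restrict hS).2 (hf.mono_measure (Measure.restrict_mono hST le_rfl))

/-- A sequence of positive shifts, less than `t`, which tends to `0`. -/
lemma exists_shift {t : ℝ} (ht : 0 < t) :
    ∃ ε : ℕ → ℝ, (∀ k, 0 < ε k) ∧ (∀ k, ε k < t) ∧ Tendsto ε atTop (𝓝 0) := by
  obtain ⟨ε, -, hε, hεt⟩ := exists_seq_strictAnti_tendsto' ht
  exact ⟨ε, fun k => (hε k).1, fun k => (hε k).2, hεt⟩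

/-- A `W^{1,p}` function which is continuously differentiable in `Ω` has a trace on the base of an
inlet cylinder. -/
theorem IsInletCylinder.exists_hasTrace [CompleteSpace F] {p : ℝ≥0∞} (hp : 1 ≤ p) (hp' : p ≠ ⊤)
    (h : IsInletCylinder A Θ ℓ Ω) (hℓ : 0 < ℓ) (hΩ : IsOpen Ω) (hΘ : IsOpen Θ)
    (hloc : ∀ x ∈ A.base Θ, ∀ᶠ z in 𝓝 x, z ∈ Ω → 0 < A.height z) (hu : ContDiffOn ℝ 1 u Ω)
    (hup : MemLp u p (volume.restrict Ω)) (hDup : MemLp (fderiv ℝ u) p (volume.restrict Ω)) :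
    ∃ g, HasTrace p Ω (A.base Θ) u g := by
  have hcylo := A.isOpen_cyl hΘ ℓ
  have hm1 := memLp_indicator_of_subset hcylo.measurableSet h.1 hup
  have hm2 := memLp_indicator_of_subset hcylo.measurableSet h.1 hDup
  obtain ⟨C, hC⟩ := exists_norm_deriv_heightCutoff_le
  obtain ⟨ε, hε0, hε1, hεt⟩ := exists_shift (show 0 < ℓ / 3 by positivity)
  have hεt' : Tendsto (fun k => ε k • A.axis) atTop (𝓝 0) := by
    simpa using hεt.smul_const A.axis
  have hle1 := fun k => h.eLpNorm_add_inwardIncrement_sub_le (u := u) (p := p) hℓ hΩ (hε0 k) (hε1 k)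
  have hle2 := fun k => h.eLpNorm_fderiv_add_inwardIncrement_sub_le hp hℓ hΩ hΘ (hε0 k) (hε1 k) hu
    (hC (ℓ / 3) (by positivity)) (memLp_translate_sub hm1 (ε k • A.axis)).1
    (memLp_translate_sub hm2 (ε k • A.axis)).1
  have hat := (tendsto_eLpNorm_translate_sub hp hp' hm1).comp hεt'
  have hbt := (tendsto_eLpNorm_translate_sub hp hp' hm2).comp hεt'
  have hct := hbt.add (ENNReal.Tendsto.const_mul (a := ENNReal.ofReal ‖C * (ℓ / 3)⁻¹‖) hat
      (Or.inr ENNReal.ofReal_ne_top))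
  rw [mul_zero, add_zero] at hct
  refine exists_hasTrace_of_tendsto hp hp' hΩ hΘ hℓ h.1 hu hup hDup
    (φ := fun k => u + inwardIncrement A Θ ℓ (ε k) u)
    (fun k => ⟨hu.add (h.contDiffOn_inwardIncrement hℓ hΩ hΘ (hε0 k) (hε1 k) hu),
      h.continuousOn_add_inwardIncrement hℓ hΩ hΘ hloc (hε0 k) (hε1 k) hu⟩)
    (tendsto_of_tendsto_of_tendsto_of_le_of_le tendsto_const_nhds hat (fun _ => zero_le) hle1)
    (tendsto_of_tendsto_of_tendsto_of_le_of_le tendsto_const_nhds hct (fun _ => zero_le) hle2)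
    fun k => ⟨ne_top_of_le_ne_top (memLp_translate_sub hm1 _).2.ne (hle1 k),
      ne_top_of_le_ne_top (ENNReal.add_ne_top.2 ⟨(memLp_translate_sub hm2 _).2.ne,
        ENNReal.mul_ne_top ENNReal.ofReal_ne_top (memLp_translate_sub hm1 _).2.ne⟩) (hle2 k)⟩

end FlatChart

/-! ### The outward unit normal on flat pieces, and the normal derivative -/

namespace FlatChart

variable {m : ℕ} {A : FlatChart m} {Θ : Set (Euc m)} {ℓ : ℝ} {Ω : Set (Euc (m + 1))}

lemma height_add (x d : Euc (m + 1)) : A.height (x + d) = A.height x + inner ℝ A.axis d := by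
  rw [height, height, ← inner_add_right, add_sub_right_comm]

lemma height_eq_zero_of_mem_base {x : Euc (m + 1)} (hx : x ∈ A.base Θ) : A.height x = 0 := by
  obtain ⟨⟨y, s⟩, ⟨-, hs⟩, rfl⟩ := hx
  rw [height_point]
  exact hs

lemma base_subset_slab (hℓ : 0 < ℓ) : A.base Θ ⊆ A.slab Θ ℓ := by
  rintro - ⟨⟨y, s⟩, ⟨hy, hs⟩, rfl⟩
  obtain rfl : s = 0 := hs
  exact ⟨(y, 0), ⟨hy, by simpa using hℓ⟩, rfl⟩

lemma add_neg_height_smul_mem_base {x : Euc (m + 1)} (hx : x ∈ A.slab Θ ℓ) :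
    x + (-A.height x) • A.axis ∈ A.base Θ := by
  obtain ⟨⟨y, s⟩, ⟨hy, -⟩, rfl⟩ := hx
  rw [height_point, ← point_add_axis, add_neg_cancel]
  exact A.point_mem_base.2 ⟨hy, rfl⟩

lemma eventually_add_smul_mem_cyl (hΘ : IsOpen Θ) (hℓ : 0 < ℓ) {x d : Euc (m + 1)}
    (hx : x ∈ A.base Θ) (hd : 0 < inner ℝ A.axis d) :
    ∀ᶠ t : ℝ in 𝓝[>] 0, x + t • d ∈ A.cyl Θ ℓ := by
  have hc : ContinuousAt (fun t : ℝ => x + t • d) 0 := by fun_prop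
  have hs : A.slab Θ ℓ ∈ 𝓝 (x + (0 : ℝ) • d) := by
    rw [zero_smul, add_zero]
    exact (A.isOpen_slab hΘ ℓ).mem_nhds (base_subset_slab hℓ hx)
  filter_upwards [mem_nhdsWithin_of_mem_nhds (hc hs), self_mem_nhdsWithin] with t ht (ht0 : 0 < t)
  refine mem_cyl_of_mem_slab ht ?_ (height_lt_of_mem_slab ht)
  rw [height_add, height_eq_zero_of_mem_base hx, zero_add, inner_smul_right]
  positivity

/-- The gradient of a defining function at a point of a flat piece points against the axis. -/
lemma gradient_eq_of_mem_base (hΘ : IsOpen Θ) (hℓ : 0 < ℓ) (hcyl : A.cyl Θ ℓ ⊆ Ω)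
    {x : Euc (m + 1)} (hx : x ∈ A.base Θ) {ρ : Euc (m + 1) → ℝ}
    (hρ : IsC2DefiningFunctionAt Ω x ρ) :
    ∃ c < (0 : ℝ), gradient ρ x = c • A.axis := by
  obtain ⟨hρ2, hρx, hρ0, hρΩ⟩ := hρ
  have hd : DifferentiableAt ℝ ρ x := hρ2.differentiableAt (by simp)
  -- Every direction with positive height component enters the cylinder, where the defining function
  -- is negative, so its directional derivative is at most zero.
  have key : ∀ d, 0 < inner ℝ A.axis d → inner ℝ (gradient ρ x) d ≤ 0 := by
    intro d hd0
    rw [inner_gradient_left]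
    have hline : HasDerivAt (fun t : ℝ => ρ (x + t • d)) (fderiv ℝ ρ x d) 0 := by
      have h1 : HasDerivAt (fun t : ℝ => x + t • d) d 0 := by
        simpa using ((hasDerivAt_id (0 : ℝ)).smul_const d).const_add x
      have h2 : HasFDerivAt ρ (fderiv ℝ ρ x) (x + (0 : ℝ) • d) := by
        rw [zero_smul, add_zero]
        exact hd.hasFDerivAt
      exact h2.comp_hasDerivAt 0 h1
    have hslope := hline.tendsto_slope.mono_left
      (nhdsWithin_mono (0 : ℝ) (show Ioi (0 : ℝ) ⊆ {0}ᶜ from fun t ht => (mem_Ioi.1 ht).ne'))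
    refine le_of_tendsto hslope ?_
    have hc : ContinuousAt (fun t : ℝ => x + t • d) 0 := by fun_prop
    have hΩ' : ∀ᶠ t : ℝ in 𝓝 0, (x + t • d ∈ Ω ↔ ρ (x + t • d) < 0) := by
      refine hc.eventually (p := fun y => y ∈ Ω ↔ ρ y < 0) ?_
      simpa only [zero_smul, add_zero] using hρΩ
    filter_upwards [eventually_add_smul_mem_cyl hΘ hℓ hx hd0, nhdsWithin_le_nhds hΩ',
      self_mem_nhdsWithin] with t htc htΩ (ht0 : 0 < t)
    have := htΩ.1 (hcyl htc)
    rw [slope_def_field, zero_smul, add_zero, hρx, sub_zero, sub_zero]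
    exact (div_neg_of_neg_of_pos this ht0).le
  set c : ℝ := inner ℝ A.axis (gradient ρ x) with hc
  set w := gradient ρ x - c • A.axis with hw
  have haa : inner ℝ A.axis A.axis = (1 : ℝ) := by
    rw [real_inner_self_eq_norm_sq, A.norm_axis, one_pow]
  have hwa : inner ℝ A.axis w = (0 : ℝ) := by
    rw [hw, inner_sub_right, inner_smul_right, haa, ← hc, mul_one, sub_self]
  have hgw : gradient ρ x = w + c • A.axis := by rw [hw, sub_add_cancel]
  -- Test the direction `w + s • axis` with `w` the tangential part of the gradient. Letting `s ↓ 0`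
  -- forces `w = 0`, and then `s = 1` gives `c ≤ 0`.
  have hs : ∀ s : ℝ, 0 < s → ‖w‖ ^ 2 + s * c ≤ 0 := by
    intro s hs
    have h1 := key (w + s • A.axis) (by
      rw [inner_add_right, hwa, inner_smul_right, haa]
      simpa using hs)
    have h2 : inner ℝ (gradient ρ x) (w + s • A.axis) = ‖w‖ ^ 2 + s * c := by
      rw [hgw, inner_add_right, inner_smul_right, inner_add_left, inner_add_left, inner_smul_left,
        inner_smul_left, hwa, haa, real_inner_comm A.axis w, hwa, real_inner_self_eq_norm_sq]
      simp
    linarith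
  have hw0 : w = 0 := by
    have hlim : Tendsto (fun s : ℝ => ‖w‖ ^ 2 + s * c) (𝓝[>] 0) (𝓝 (‖w‖ ^ 2)) := by
      have : ContinuousAt (fun s : ℝ => ‖w‖ ^ 2 + s * c) 0 := by fun_prop
      have h3 := this.tendsto.mono_left (nhdsWithin_le_nhds (s := Ioi 0))
      simpa using h3
    have : ‖w‖ ^ 2 ≤ 0 := le_of_tendsto hlim (by
      filter_upwards [self_mem_nhdsWithin] with s hs0 using hs s hs0)
    have h4 : ‖w‖ = 0 := by nlinarith [norm_nonneg w]
    exact norm_eq_zero.1 h4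
  rw [hw0, zero_add] at hgw
  refine ⟨c, lt_of_le_of_ne ?_ fun h0 => hρ0 (by rw [hgw, h0, zero_smul]), hgw⟩
  have := hs 1 one_pos
  rw [hw0] at this
  simpa using this

/-- The outward unit normal on a flat piece. -/
lemma eq_neg_axis_of_isOutwardUnitNormal (hΘ : IsOpen Θ) (hℓ : 0 < ℓ) (hcyl : A.cyl Θ ℓ ⊆ Ω)
    {x n : Euc (m + 1)} (hx : x ∈ A.base Θ) (hn : IsOutwardUnitNormal Ω x n) : n = -A.axis := by
  obtain ⟨ρ, hρ, rfl⟩ := hn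
  obtain ⟨c, hc, h⟩ := gradient_eq_of_mem_base hΘ hℓ hcyl hx hρ
  rw [h, norm_smul, A.norm_axis, mul_one, Real.norm_of_nonpos hc.le, smul_smul, inv_neg, neg_mul,
    inv_mul_cancel₀ hc.ne, neg_smul, one_smul]

/-- Near a flat piece with a defining function, `Ω` lies above the piece. -/
lemma eventually_height_pos (hΘ : IsOpen Θ) (hℓ : 0 < ℓ) (hcyl : A.cyl Θ ℓ ⊆ Ω)
    (hbase : ∀ z ∈ A.base Θ, z ∉ Ω) {x : Euc (m + 1)} (hx : x ∈ A.base Θ)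
    {ρ : Euc (m + 1) → ℝ} (hρ : IsC2DefiningFunctionAt Ω x ρ) :
    ∀ᶠ z in 𝓝 x, z ∈ Ω → 0 < A.height z := by
  obtain ⟨c, hc, hgrad⟩ := gradient_eq_of_mem_base hΘ hℓ hcyl hx hρ
  obtain ⟨hρ2, hρx, hρ0, hρΩ⟩ := hρ
  have hd : ∀ᶠ z in 𝓝 x, DifferentiableAt ℝ ρ z := by
    filter_upwards [hρ2.eventually (by simp)] with z hz using hz.differentiableAt (by simp)
  have hneg : ∀ᶠ z in 𝓝 x, fderiv ℝ ρ z A.axis < 0 := by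
    have hcont : ContinuousAt (fun z => fderiv ℝ ρ z A.axis) x :=
      (hρ2.fderiv_right (m := 1) (by norm_num)).continuousAt.clm_apply continuousAt_const
    refine hcont.eventually_lt_const ?_
    show fderiv ℝ ρ x A.axis < 0
    rw [← inner_gradient_left, hgrad, inner_smul_left,
      real_inner_self_eq_norm_sq, A.norm_axis]
    simpa using hc
  obtain ⟨r, hr, hball⟩ := Metric.eventually_nhds_iff_ball.1 (hd.and (hneg.and (hρΩ.and
    ((A.isOpen_slab hΘ ℓ).mem_nhds (base_subset_slab hℓ hx)))))
  filter_upwards [Metric.ball_mem_nhds x hr] with z hz hzΩ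
  -- A point of `Ω` at height at most zero is pushed up along the axis to the base. The defining
  -- function does not increase on the way, so it stays negative and the base point would lie in
  -- `Ω`.
  by_contra! hzh
  set s := -A.height z with hs
  have hs0 : 0 ≤ s := by linarith
  have hzb : z + s • A.axis ∈ A.base Θ := add_neg_height_smul_mem_base (hball z hz).2.2.2
  have hin : inner ℝ A.axis (z - x) = -s := by
    have h1 := A.height_add x (z - x)
    rw [add_sub_cancel, height_eq_zero_of_mem_base hx] at h1
    linarith
  -- The displacement is the orthogonal projection onto the hyperplane through `x`, which does not
  -- increase the distance to `x`.
  have hzr : z + s • A.axis ∈ Metric.ball x r := by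
    rw [Metric.mem_ball, dist_eq_norm] at hz ⊢
    refine lt_of_le_of_lt ?_ hz
    refine le_of_sq_le_sq ?_ (norm_nonneg _)
    rw [add_sub_right_comm, norm_add_sq_real, inner_smul_right, real_inner_comm, hin, norm_smul,
      A.norm_axis, mul_one, Real.norm_of_nonneg hs0]
    nlinarith [sq_nonneg s]
  obtain ⟨ξ, hξ, hmv⟩ := domain_mvt (f := ρ) (f' := fderiv ℝ ρ) (s := Metric.ball x r)
    (fun w hw => (hball w hw).1.hasFDerivAt.hasFDerivWithinAt) (convex_ball x r) hz hzr
  have hξb : ξ ∈ Metric.ball x r := (convex_ball x r).segment_subset hz hzr hξ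
  rw [add_sub_cancel_left, map_smul, smul_eq_mul] at hmv
  have h1 : ρ z < 0 := (hball z hz).2.2.1.1 hzΩ
  have h2 : ¬ρ (z + s • A.axis) < 0 := fun h => hbase _ hzb ((hball _ hzr).2.2.1.2 h)
  have h3 := mul_nonpos_of_nonneg_of_nonpos hs0 (hball ξ hξb).2.1.le
  linarith

/-- Base and lateral surface lie in the frontier, which is disjoint from the open set `Ω`. The rim
at height zero is reached as a limit of lateral points, since the frontier is closed. -/
lemma isInletCylinder_of_frontier (hΩ : IsOpen Ω) (hΘ : IsOpen Θ) (hℓ : 0 < ℓ)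
    (hcyl : A.cyl Θ ℓ ⊆ Ω) (hbase : A.base Θ ⊆ frontier Ω)
    (hlat : ∀ y ∈ frontier Θ, ∀ s ∈ Ioo 0 ℓ, A.point (y, s) ∈ frontier Ω) :
    IsInletCylinder A Θ ℓ Ω := by
  have hdisj : ∀ z ∈ frontier Ω, z ∉ Ω := fun z hz hzΩ =>
    (disjoint_left.1 (disjoint_frontier_iff_isOpen.2 hΩ)) hz hzΩ
  refine ⟨hcyl, fun y hy s hs hyΩ => ?_⟩
  by_cases hyΘ : y ∈ Θ
  · refine A.point_mem_cyl.2 ⟨hyΘ, lt_of_le_of_ne hs.1 fun h0 => ?_, hs.2⟩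
    exact hdisj _ (hbase (A.point_mem_base.2 ⟨hyΘ, h0.symm⟩)) hyΩ
  · have hyf : y ∈ frontier Θ := ⟨hy, by rwa [hΘ.interior_eq]⟩
    refine absurd hyΩ (hdisj _ ?_)
    have hcl : s ∈ closure (Ioo 0 ℓ) := by
      rw [closure_Ioo hℓ.ne]
      exact ⟨hs.1, hs.2.le⟩
    have hmaps : MapsTo (fun t => A.point (y, t)) (Ioo 0 ℓ) (frontier Ω) := fun t ht =>
      hlat y hyf t ht
    have := hmaps.closure ((A.contDiff_line y).continuous) hcl
    rwa [isClosed_frontier.closure_eq] at this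

/-- The normal derivative of a harmonic `W^{2,p}` field without component along the axis. -/
theorem normal_derivative {p : ℝ≥0∞} (hp : 1 ≤ p) (hp' : p ≠ ⊤) (hΩ : IsOpen Ω) (hΘ : IsOpen Θ)
    (hℓ : 0 < ℓ) (h : IsInletCylinder A Θ ℓ Ω) {ν : Euc (m + 1) → Euc (m + 1)}
    (hν : ∀ x ∈ A.base Θ, IsOutwardUnitNormal Ω x (ν x)) {v : Euc (m + 1) → Euc (m + 1)}
    (hv : MemW2 p Ω v) (hharm : HarmonicOnNhd v Ω) (hzero : ∀ x ∈ Ω, inner ℝ A.axis (v x) = 0) :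
    (∃ G, HasTrace p Ω (A.base Θ) (fderiv ℝ v) G) ∧ ∀ G, HasTrace p Ω (A.base Θ) (fderiv ℝ v) G →
      ∀ᵐ x ∂(μHE[m].restrict (A.base Θ)), inner ℝ (G x (ν x)) (ν x) = 0 := by
  have hv2 : ContDiffOn ℝ 2 v Ω := hharm.contDiffOn
  have hDv : ContDiffOn ℝ 1 (fderiv ℝ v) Ω := hv2.fderiv_of_isOpen hΩ (by norm_num)
  constructor
  · have hbase : ∀ z ∈ A.base Θ, z ∉ Ω := by
      rintro - ⟨⟨y, s⟩, ⟨hy, hs⟩, rfl⟩ hz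
      obtain rfl : s = 0 := hs
      exact (A.point_mem_cyl.1 (h.2 y (subset_closure hy) 0 ⟨le_rfl, hℓ⟩ hz)).2.1.false
    obtain ⟨h1, h2⟩ := hv.memLp_fderiv hΩ hv2
    refine h.exists_hasTrace hp hp' hℓ hΩ hΘ (fun x hx => ?_) hDv h1 h2
    obtain ⟨ρ, hρ, -⟩ := hν x hx
    exact eventually_height_pos hΘ hℓ h.1 hbase hx hρ
  · intro G hG
    -- The normal-normal entry of the gradient is a fixed linear functional because the normal is
    -- constant on the flat piece. Replacing the outward normal `-axis` by `axis` does not change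
    -- it.
    set L : (Euc (m + 1) →L[ℝ] Euc (m + 1)) →L[ℝ] ℝ :=
      (innerSL ℝ A.axis) ∘L ContinuousLinearMap.apply ℝ (Euc (m + 1)) A.axis with hLdef
    have hLa : ∀ T, L T = inner ℝ A.axis (T A.axis) := fun T => rfl
    have hL : ∀ x ∈ Ω, L (fderiv ℝ v x) = 0 := by
      intro x hx
      have hd : HasFDerivAt v (fderiv ℝ v x) x :=
        ((hv2.contDiffAt (hΩ.mem_nhds hx)).differentiableAt (by simp)).hasFDerivAt
      have hc : HasFDerivAt (fun y => innerSL ℝ A.axis (v y)) (innerSL ℝ A.axis ∘L fderiv ℝ v x) x :=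
        (innerSL ℝ A.axis).hasFDerivAt.comp x hd
      have h0 : (fun y => innerSL ℝ A.axis (v y)) =ᶠ[𝓝 x] fun _ => 0 := by
        filter_upwards [hΩ.mem_nhds hx] with y hy using hzero y hy
      have h1 := (hc.congr_of_eventuallyEq h0.symm).unique (hasFDerivAt_const 0 x)
      exact DFunLike.congr_fun h1 A.axis
    have hae := ae_apply_eq_zero_of_hasTrace hp hp' hΩ hΘ hℓ h.1 le_rfl hDv hG L hL
    filter_upwards [hae, ae_restrict_mem (A.measurableSet_base hΘ)] with x hx hxb
    rw [eq_neg_axis_of_isOutwardUnitNormal hΘ hℓ h.1 hxb (hν x hxb), map_neg, inner_neg_neg,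
      real_inner_comm]
    exact hx

end FlatChart

/-! ### Charts of rectangles and cylinders -/

namespace FlatChart

variable {m : ℕ}

/-- The chart which, seen in the coordinate system `T`, is the isometry `J` followed by the
translation by `c`. -/
noncomputable def ofLinearIsometry (J : WithLp 2 (Euc m × ℝ) →ₗᵢ[ℝ] Euc (m + 1)) (c : Euc (m + 1))
    (T : Euc (m + 1) ≃ᵃⁱ[ℝ] Euc (m + 1)) : FlatChart m :=
  ((J.toLinearIsometryEquiv (by
      rw [(WithLp.linearEquiv 2 ℝ (Euc m × ℝ)).finrank_eq]
      simp)).toAffineIsometryEquiv.trans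
    (AffineIsometryEquiv.constVAdd ℝ (Euc (m + 1)) c)).trans T.symm

variable (J : WithLp 2 (Euc m × ℝ) →ₗᵢ[ℝ] Euc (m + 1)) (c : Euc (m + 1))
  (T : Euc (m + 1) ≃ᵃⁱ[ℝ] Euc (m + 1))

@[simp] lemma apply_point_ofLinearIsometry (p : Euc m × ℝ) :
    T ((ofLinearIsometry J c T).point p) = c + J (WithLp.toLp 2 p) := by
  simp [ofLinearIsometry, point]

/-- The translation drops out of the difference between the points of height one and height zero,
leaving only the linear part. -/
lemma apply_axis_ofLinearIsometry :
    T.linearIsometryEquiv (ofLinearIsometry J c T).axis = J (WithLp.toLp 2 (0, 1)) := by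
  have h1 := (ofLinearIsometry J c T).point_add_axis 0 0 1
  rw [zero_add, one_smul] at h1
  have h2 := congrArg T h1
  have h3 := T.map_vadd ((ofLinearIsometry J c T).point (0, 0)) (ofLinearIsometry J c T).axis
  rw [vadd_eq_add, vadd_eq_add, add_comm (ofLinearIsometry J c T).axis] at h3
  rw [h3, apply_point_ofLinearIsometry, apply_point_ofLinearIsometry] at h2
  have h4 : J (WithLp.toLp 2 ((0 : Euc m), (0 : ℝ))) = 0 := by
    rw [← J.map_zero]
    rfl
  rw [h4, add_zero, add_comm c] at h2
  exact (add_right_cancel h2).symm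

/-- `(y, s) ↦ (σ s, y)`. -/
noncomputable def planarAlong (σ : ℝ) (hσ : σ ^ 2 = 1) : WithLp 2 (Euc 1 × ℝ) →ₗᵢ[ℝ] Euc 2 where
  toFun p := !₂[σ * p.snd, p.fst 0]
  map_add' p q := by
    ext i
    fin_cases i <;> simp [mul_add]
  map_smul' r p := by
    ext i
    fin_cases i <;> simp [mul_left_comm]
  norm_map' p := by
    simp [EuclideanSpace.norm_eq, WithLp.prod_norm_eq_of_L2, mul_pow, hσ, add_comm]
    rw [Real.sq_sqrt (by positivity)]

/-- `(y, s) ↦ (y, s)`. -/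
noncomputable def planarAcross : WithLp 2 (Euc 1 × ℝ) →ₗᵢ[ℝ] Euc 2 where
  toFun p := !₂[p.fst 0, p.snd]
  map_add' p q := by
    ext i
    fin_cases i <;> simp
  map_smul' r p := by
    ext i
    fin_cases i <;> simp
  norm_map' p := by
    simp [EuclideanSpace.norm_eq, WithLp.prod_norm_eq_of_L2]
    rw [Real.sq_sqrt (by positivity)]

/-- `(y, s) ↦ (y, σ s)`. -/
noncomputable def spatialAlong (σ : ℝ) (hσ : σ ^ 2 = 1) : WithLp 2 (Euc 2 × ℝ) →ₗᵢ[ℝ] Euc 3 where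
  toFun p := !₂[p.fst 0, p.fst 1, σ * p.snd]
  map_add' p q := by
    ext i
    fin_cases i <;> simp [mul_add]
  map_smul' r p := by
    ext i
    fin_cases i <;> simp [mul_left_comm]
  norm_map' p := by
    simp [EuclideanSpace.norm_eq, WithLp.prod_norm_eq_of_L2, mul_pow, hσ, Fin.sum_univ_three]
    rw [Real.sq_sqrt (by positivity)]

/-- A set of real numbers as a subset of `ℝ¹`. -/
def lineSet (I : Set ℝ) : Set (Euc 1) := {y | y 0 ∈ I}

lemma isOpen_lineSet {I : Set ℝ} (hI : IsOpen I) : IsOpen (lineSet I) :=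
  hI.preimage (EuclideanSpace.proj (𝕜 := ℝ) (0 : Fin 1)).continuous

lemma volume_lineSet_ne_top (a b : ℝ) : volume (lineSet (Ioo a b)) ≠ ⊤ := by
  have hb : Bornology.IsBounded (lineSet (Ioo a b)) := by
    refine (Metric.isBounded_closedBall (x := (0 : Euc 1)) (r := max |a| |b|)).subset fun y hy => ?_
    rw [mem_closedBall_zero_iff, EuclideanSpace.norm_eq]
    simp only [Fin.sum_univ_one, Real.norm_eq_abs, sq_abs, Real.sqrt_sq_eq_abs]
    exact abs_le_max_abs_abs hy.1.le hy.2.le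
  exact hb.measure_lt_top.ne

lemma frontier_lineSet_subset (I : Set ℝ) : frontier (lineSet I) ⊆ lineSet (frontier I) :=
  (EuclideanSpace.proj (𝕜 := ℝ) (0 : Fin 1)).continuous.frontier_preimage_subset I

lemma set_eq_of_point {A : FlatChart m} {S S' : Set (Euc (m + 1))}
    (h : ∀ y s, A.point (y, s) ∈ S ↔ A.point (y, s) ∈ S') : S = S' := by
  ext x
  rw [← A.point_coord x]
  exact h _ _

/-- The chart of the inlet of a planar rectangle. -/
noncomputable def planarInlet (T : Euc 2 ≃ᵃⁱ[ℝ] Euc 2) : FlatChart 1 :=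
  ofLinearIsometry (planarAlong 1 (by norm_num)) 0 T

/-- The chart of the outlet of a planar rectangle of length `ℓ`. -/
noncomputable def planarOutlet (T : Euc 2 ≃ᵃⁱ[ℝ] Euc 2) (ℓ : ℝ) : FlatChart 1 :=
  ofLinearIsometry (planarAlong (-1) (by norm_num)) !₂[ℓ, 0] T

/-- The chart of the lower side of a planar rectangle of height `2h`. -/
noncomputable def planarSide (T : Euc 2 ≃ᵃⁱ[ℝ] Euc 2) (h : ℝ) : FlatChart 1 :=
  ofLinearIsometry planarAcross !₂[0, -h] T

/-- The chart of the inlet of a cylinder. -/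
noncomputable def spatialInlet (T : Euc 3 ≃ᵃⁱ[ℝ] Euc 3) : FlatChart 2 :=
  ofLinearIsometry (spatialAlong 1 (by norm_num)) 0 T

/-- The chart of the outlet of a cylinder of length `ℓ`. -/
noncomputable def spatialOutlet (T : Euc 3 ≃ᵃⁱ[ℝ] Euc 3) (ℓ : ℝ) : FlatChart 2 :=
  ofLinearIsometry (spatialAlong (-1) (by norm_num)) !₂[0, 0, ℓ] T

/-! ### Planar rectangles: inlet, outlet and lower side as flat pieces. -/

section Planar

variable (T : Euc 2 ≃ᵃⁱ[ℝ] Euc 2) (ℓ h : ℝ) (y : Euc 1) (s : ℝ)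

lemma apply_planarInlet : T ((planarInlet T).point (y, s)) = !₂[s, y 0] := by
  rw [planarInlet, apply_point_ofLinearIsometry]
  ext i
  fin_cases i <;> simp [planarAlong]

lemma apply_planarOutlet : T ((planarOutlet T ℓ).point (y, s)) = !₂[ℓ - s, y 0] := by
  rw [planarOutlet, apply_point_ofLinearIsometry]
  ext i
  fin_cases i <;> simp [planarAlong, sub_eq_add_neg]

lemma apply_planarSide : T ((planarSide T h).point (y, s)) = !₂[y 0, s - h] := by
  rw [planarSide, apply_point_ofLinearIsometry]
  ext i
  fin_cases i <;> simp [planarAcross, sub_eq_add_neg, add_comm]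

lemma cyl_planarInlet : (planarInlet T).cyl (lineSet (Ioo (-h) h)) ℓ = T ⁻¹' rectangle ℓ h :=
  set_eq_of_point (A := planarInlet T) fun y s => by
    rw [point_mem_cyl, mem_preimage, apply_planarInlet]
    simp [lineSet, rectangle]
    tauto

lemma base_planarInlet : (planarInlet T).base (lineSet (Ioo (-h) h)) = T ⁻¹' crossSegment 0 h :=
  set_eq_of_point (A := planarInlet T) fun y s => by
    rw [point_mem_base, mem_preimage, apply_planarInlet]
    simp [lineSet, crossSegment]
    tauto

lemma cyl_planarOutlet :
    (planarOutlet T ℓ).cyl (lineSet (Ioo (-h) h)) ℓ = T ⁻¹' rectangle ℓ h :=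
  set_eq_of_point (A := planarOutlet T ℓ) fun y s => by
    rw [point_mem_cyl, mem_preimage, apply_planarOutlet]
    simp [lineSet, rectangle]
    tauto

lemma base_planarOutlet :
    (planarOutlet T ℓ).base (lineSet (Ioo (-h) h)) = T ⁻¹' crossSegment ℓ h :=
  set_eq_of_point (A := planarOutlet T ℓ) fun y s => by
    rw [point_mem_base, mem_preimage, apply_planarOutlet]
    simp [lineSet, crossSegment]
    tauto

/-- The same rectangle viewed sideways, as a cylinder of height `2 h` over its lower side; this
provides a flat piece whose normal is orthogonal to that of the inlet. -/
lemma cyl_planarSide :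
    (planarSide T h).cyl (lineSet (Ioo 0 ℓ)) (2 * h) = T ⁻¹' rectangle ℓ h :=
  set_eq_of_point (A := planarSide T h) fun y s => by
    rw [point_mem_cyl, mem_preimage, apply_planarSide]
    have h1 : s - h < h ↔ s < 2 * h := by constructor <;> intro <;> linarith
    simp [lineSet, rectangle, h1]

lemma base_planarSide_subset :
    (planarSide T h).base (lineSet (Ioo 0 ℓ)) ⊆ T ⁻¹' rectangleSides ℓ h := by
  rintro - ⟨⟨y, s⟩, ⟨hy, hs⟩, rfl⟩
  obtain rfl : s = 0 := hs
  rw [mem_preimage, apply_planarSide]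
  exact ⟨hy, Or.inl (by simp)⟩

lemma lateral_planarOutlet {h : ℝ} (hh : 0 < h) {y : Euc 1}
    (hy : y ∈ frontier (lineSet (Ioo (-h) h))) {s : ℝ} (hs : s ∈ Ioo 0 ℓ) :
    (planarOutlet T ℓ).point (y, s) ∈ T ⁻¹' rectangleSides ℓ h := by
  have hy' := frontier_lineSet_subset _ hy
  rw [frontier_Ioo (by linarith)] at hy'
  rw [mem_preimage, apply_planarOutlet]
  exact ⟨⟨by simpa using hs.2, by simpa using hs.1⟩, hy'⟩

lemma apply_axis_planarInlet : T.linearIsometryEquiv (planarInlet T).axis = !₂[1, 0] := by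
  rw [planarInlet, apply_axis_ofLinearIsometry]
  ext i
  fin_cases i <;> simp [planarAlong]

lemma apply_axis_planarSide : T.linearIsometryEquiv (planarSide T h).axis = !₂[0, 1] := by
  rw [planarSide, apply_axis_ofLinearIsometry]
  ext i
  fin_cases i <;> simp [planarAcross]

end Planar

/-! ### Spatial cylinders: inlet and outlet as flat pieces. -/

section Spatial

variable (T : Euc 3 ≃ᵃⁱ[ℝ] Euc 3) (ℓ : ℝ) (Θ : Set (Euc 2)) (y : Euc 2) (s : ℝ)

lemma apply_spatialInlet : T ((spatialInlet T).point (y, s)) = !₂[y 0, y 1, s] := by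
  rw [spatialInlet, apply_point_ofLinearIsometry]
  ext i
  fin_cases i <;> simp [spatialAlong]

lemma apply_spatialOutlet : T ((spatialOutlet T ℓ).point (y, s)) = !₂[y 0, y 1, ℓ - s] := by
  rw [spatialOutlet, apply_point_ofLinearIsometry]
  ext i
  fin_cases i <;> simp [spatialAlong, sub_eq_add_neg]

lemma vec_eta : !₂[y 0, y 1] = y := by
  ext i
  fin_cases i <;> simp

lemma point_spatialInlet_mem_cylinder {I : Set ℝ} :
    (spatialInlet T).point (y, s) ∈ T ⁻¹' cylinder Θ I ↔ y ∈ Θ ∧ s ∈ I := by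
  rw [mem_preimage, apply_spatialInlet]
  simp [_root_.cylinder, vec_eta]

lemma point_spatialOutlet_mem_cylinder {I : Set ℝ} :
    (spatialOutlet T ℓ).point (y, s) ∈ T ⁻¹' cylinder Θ I ↔ y ∈ Θ ∧ ℓ - s ∈ I := by
  rw [mem_preimage, apply_spatialOutlet]
  simp [_root_.cylinder, vec_eta]

lemma cyl_spatialInlet : (spatialInlet T).cyl Θ ℓ = T ⁻¹' cylinder Θ (Ioo 0 ℓ) :=
  set_eq_of_point (A := spatialInlet T) fun y s => by
    rw [point_mem_cyl, point_spatialInlet_mem_cylinder]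

lemma base_spatialInlet : (spatialInlet T).base Θ = T ⁻¹' cylinder Θ {0} :=
  set_eq_of_point (A := spatialInlet T) fun y s => by
    rw [point_mem_base, point_spatialInlet_mem_cylinder, mem_singleton_iff]

lemma cyl_spatialOutlet : (spatialOutlet T ℓ).cyl Θ ℓ = T ⁻¹' cylinder Θ (Ioo 0 ℓ) :=
  set_eq_of_point (A := spatialOutlet T ℓ) fun y s => by
    rw [point_mem_cyl, point_spatialOutlet_mem_cylinder]
    simp only [mem_Ioo, sub_pos, sub_lt_self_iff]
    tauto

lemma base_spatialOutlet : (spatialOutlet T ℓ).base Θ = T ⁻¹' cylinder Θ {ℓ} :=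
  set_eq_of_point (A := spatialOutlet T ℓ) fun y s => by
    rw [point_mem_base, point_spatialOutlet_mem_cylinder, mem_singleton_iff, sub_eq_self]

lemma apply_axis_spatialInlet : T.linearIsometryEquiv (spatialInlet T).axis = !₂[0, 0, 1] := by
  rw [spatialInlet, apply_axis_ofLinearIsometry]
  ext i
  fin_cases i <;> simp [spatialAlong]

lemma apply_axis_spatialOutlet :
    T.linearIsometryEquiv (spatialOutlet T ℓ).axis = -!₂[0, 0, 1] := by
  rw [spatialOutlet, apply_axis_ofLinearIsometry]
  ext i
  fin_cases i <;> simp [spatialAlong]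

end Spatial

end FlatChart

/-! ### Admissible domains -/

section Admissible

open FlatChart

lemma normal_derivative_of_isAdmissiblePlanar {p : ℝ≥0∞} (hp : 1 ≤ p) (hp' : p ≠ ⊤)
    {Ω ΓI ΓW ΓO : Set (Euc 2)} (hΩ : IsAdmissiblePlanar Ω ΓI ΓW ΓO) {ν : Euc 2 → Euc 2}
    (hν : ∀ x ∈ ΓO, IsOutwardUnitNormal Ω x (ν x)) {v : Euc 2 → Euc 2} (hv : MemW2 p Ω v)
    (hharm : HarmonicOnNhd v Ω) (hdiv : ∀ x ∈ Ω, divergence v x = 0)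
    (hbdry : HasTrace p Ω (ΓI ∪ ΓW) v 0) :
    (∃ G, HasTrace p Ω ΓO (fderiv ℝ v) G) ∧ ∀ G, HasTrace p Ω ΓO (fderiv ℝ v) G →
      ∀ᵐ x ∂(μHE[1].restrict ΓO), inner ℝ (G x (ν x)) (ν x) = 0 := by
  obtain ⟨T₁, T₂, ℓ₁, h₁, ℓ₂, h₂, hℓ₁, hh₁, hℓ₂, hh₂, hc₁, hc₂, -, hI, hO, hs₁, hs₂, -⟩ :=
    hΩ.exists_geometry
  have hconn : IsPreconnected Ω := hΩ.isSimplyConnected.isPathConnected.isConnected.isPreconnected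
  have hin := inner_axis_eq_zero (A := planarInlet T₁) hp hΩ.isOpen hΩ.isBounded hconn
    (isOpen_lineSet isOpen_Ioo) ⟨0, by simpa [lineSet] using hh₁⟩ (volume_lineSet_ne_top (-h₁) h₁)
    hℓ₁ ((cyl_planarInlet T₁ ℓ₁ h₁).trans_subset hc₁)
    ((base_planarInlet T₁ h₁).trans_subset (hI ▸ subset_union_left)) hharm hdiv hbdry
  have hside := inner_axis_eq_zero (A := planarSide T₁ h₁) hp hΩ.isOpen hΩ.isBounded hconn
    (isOpen_lineSet isOpen_Ioo) ⟨!₂[ℓ₁ / 2], by simpa [lineSet] using hℓ₁⟩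
    (volume_lineSet_ne_top 0 ℓ₁) (by linarith : 0 < 2 * h₁)
    ((cyl_planarSide T₁ ℓ₁ h₁).trans_subset hc₁)
    ((base_planarSide_subset T₁ ℓ₁ h₁).trans (hs₁.trans subset_union_right)) hharm hdiv hbdry
  -- The axes of the inlet and of the side are, in the coordinates of `T₁`, the two standard basis
  -- vectors, so both components of `v` vanish and the orientation of the outlet is irrelevant.
  have hv0 : ∀ x ∈ Ω, v x = 0 := by
    intro x hx
    have h1 := hin x hx
    have h2 := hside x hx
    rw [← T₁.linearIsometryEquiv.inner_map_map, apply_axis_planarInlet] at h1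
    rw [← T₁.linearIsometryEquiv.inner_map_map, apply_axis_planarSide] at h2
    rw [← T₁.linearIsometryEquiv.map_eq_zero_iff]
    ext i
    fin_cases i
    · simpa [PiLp.inner_apply] using h1
    · simpa [PiLp.inner_apply] using h2
  have hfr : ΓO ⊆ frontier Ω := hΩ.frontier_eq ▸ subset_union_right
  have hfrW : ΓW ⊆ frontier Ω :=
    hΩ.frontier_eq ▸ subset_union_right.trans subset_union_left
  have hbO : (planarOutlet T₂ ℓ₂).base (lineSet (Ioo (-h₂) h₂)) = ΓO :=
    (base_planarOutlet T₂ ℓ₂ h₂).trans hO.symm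
  have hcyl := isInletCylinder_of_frontier hΩ.isOpen (isOpen_lineSet isOpen_Ioo) hℓ₂
    ((cyl_planarOutlet T₂ ℓ₂ h₂).trans_subset hc₂) (hbO.trans_subset hfr)
    fun y hy s hs => hfrW (hs₂ (lateral_planarOutlet T₂ ℓ₂ hh₂ hy hs))
  have := normal_derivative hp hp' hΩ.isOpen (isOpen_lineSet isOpen_Ioo) hℓ₂ hcyl
    (by rwa [hbO]) hv hharm fun x hx => by rw [hv0 x hx, inner_zero_right]
  rwa [hbO] at this

lemma normal_derivative_of_isAdmissibleSpatial {p : ℝ≥0∞} (hp : 1 ≤ p) (hp' : p ≠ ⊤)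
    {Ω ΓI ΓW ΓO : Set (Euc 3)} (hΩ : IsAdmissibleSpatial Ω ΓI ΓW ΓO) {ν : Euc 3 → Euc 3}
    (hν : ∀ x ∈ ΓO, IsOutwardUnitNormal Ω x (ν x)) {v : Euc 3 → Euc 3} (hv : MemW2 p Ω v)
    (hharm : HarmonicOnNhd v Ω) (hdiv : ∀ x ∈ Ω, divergence v x = 0)
    (hbdry : HasTrace p Ω (ΓI ∪ ΓW) v 0) :
    (∃ G, HasTrace p Ω ΓO (fderiv ℝ v) G) ∧ ∀ G, HasTrace p Ω ΓO (fderiv ℝ v) G →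
      ∀ᵐ x ∂(μHE[2].restrict ΓO), inner ℝ (G x (ν x)) (ν x) = 0 := by
  obtain ⟨T₁, T₂, Θ₁, Θ₂, ℓ₁, ℓ₂, ξ, hΘ₁, hΘ₂, hℓ₁, hℓ₂, hξ₁, hξ₂, hc₁, hc₂, -, hI, hO, -, hs₂⟩ :=
    hΩ.exists_geometry
  have hconn : IsPreconnected Ω := hΩ.isSimplyConnected.isPathConnected.isConnected.isPreconnected
  have hin := inner_axis_eq_zero (A := spatialInlet T₁) hp hΩ.isOpen hΩ.isBounded hconn
    hΘ₁.1 hΘ₁.2.2.1.nonempty hΘ₁.2.1.measure_lt_top.ne hℓ₁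
    ((cyl_spatialInlet T₁ ℓ₁ Θ₁).trans_subset hc₁)
    ((base_spatialInlet T₁ Θ₁).trans_subset (hI ▸ subset_union_left)) hharm hdiv hbdry
  have ha₁ : (spatialInlet T₁).axis = ξ :=
    T₁.linearIsometryEquiv.injective ((apply_axis_spatialInlet T₁).trans hξ₁.symm)
  -- This is where the common direction of the cylinders enters: the inlet only controls the
  -- component along `ξ`, and the inward axis of the outlet is `-ξ`.
  have ha₂ : (spatialOutlet T₂ ℓ₂).axis = -ξ :=
    T₂.linearIsometryEquiv.injective (by rw [apply_axis_spatialOutlet, map_neg, hξ₂])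
  have hfr : ΓO ⊆ frontier Ω := hΩ.frontier_eq ▸ subset_union_right
  have hfrW : ΓW ⊆ frontier Ω :=
    hΩ.frontier_eq ▸ subset_union_right.trans subset_union_left
  have hbO : (spatialOutlet T₂ ℓ₂).base Θ₂ = ΓO := (base_spatialOutlet T₂ ℓ₂ Θ₂).trans hO.symm
  have hcyl := isInletCylinder_of_frontier hΩ.isOpen hΘ₂.1 hℓ₂
    ((cyl_spatialOutlet T₂ ℓ₂ Θ₂).trans_subset hc₂) (hbO.trans_subset hfr)
    fun y hy s hs => hfrW (hs₂ ((point_spatialOutlet_mem_cylinder T₂ ℓ₂ _ y s).2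
      ⟨hy, sub_pos.2 hs.2, sub_lt_self _ hs.1⟩))
  have := normal_derivative hp hp' hΩ.isOpen hΘ₂.1 hℓ₂ hcyl (by rwa [hbO]) hv hharm
    fun x hx => by rw [ha₂, inner_neg_left, ← ha₁, hin x hx, neg_zero]
  rwa [hbO] at this

end Admissible

theorem corollary2p4 (n : ℕ) (Ω ΓI ΓW ΓO : Set (Euc n)) (hΩ : IsAdmissible n Ω ΓI ΓW ΓO)
    (ν : Euc n → Euc n) (hν : ∀ x ∈ ΓO, IsOutwardUnitNormal Ω x (ν x))
    (v : Euc n → Euc n) (hv : MemW2 (3 / 2) Ω v) (hharm : HarmonicOnNhd v Ω)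
    (hdiv : ∀ x ∈ Ω, divergence v x = 0)
    (hbdry : HasTrace (3 / 2) Ω (ΓI ∪ ΓW) v 0) :
    -- the trace of `∇v` on the outlet exists, and the normal component `(∂v/∂ν) · ν` of the normal
    -- derivative `∂v/∂ν = (∇v) ν` formed with it vanishes almost everywhere on the outlet
    (∃ G : Euc n → Euc n →L[ℝ] Euc n, HasTrace (3 / 2) Ω ΓO (fderiv ℝ v) G) ∧
      ∀ G : Euc n → Euc n →L[ℝ] Euc n, HasTrace (3 / 2) Ω ΓO (fderiv ℝ v) G →
        ∀ᵐ x ∂(μHE[n - 1].restrict ΓO), ⟪G x (ν x), ν x⟫_ℝ = 0 := by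
  have hp : (1 : ℝ≥0∞) ≤ 3 / 2 := by
    rw [ENNReal.le_div_iff_mul_le (Or.inl two_ne_zero) (Or.inl ENNReal.ofNat_ne_top)]
    norm_num
  have hp' : (3 / 2 : ℝ≥0∞) ≠ ⊤ := ENNReal.div_ne_top ENNReal.ofNat_ne_top two_ne_zero
  -- In every other dimension admissibility is `False`, so only two cases remain.
  match n, Ω, ΓI, ΓW, ΓO, hΩ, ν, hν, v, hv, hharm, hdiv, hbdry with
  | 2, Ω, ΓI, ΓW, ΓO, hΩ, ν, hν, v, hv, hharm, hdiv, hbdry =>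
    exact normal_derivative_of_isAdmissiblePlanar hp hp' hΩ hν hv hharm hdiv hbdry
  | 3, Ω, ΓI, ΓW, ΓO, hΩ, ν, hν, v, hv, hharm, hdiv, hbdry =>
    exact normal_derivative_of_isAdmissibleSpatial hp hp' hΩ hν hv hharm hdiv hbdry
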